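/- A *brace* means a skew left brace: a set $B$ with two (not necessarily abelian) group structures $(B,+)$ and $(B,\cdot)$ such that $a\cdot(b+c)=a\cdot b-a+a\cdot c$ for all $a,b,c\in B$; the two groups have the same identity element $0$. Put $\lambda_a(b)=-a+ab$ and $\operatorname{Soc}(B)=\operatorname{Ker}\lambda\cap Z(B,+)$. An *ideal* of $B$ is a subset which is a normal subgroup of both $(B,+)$ and $(B,\cdot)$ and is invariant under every $\lambda_b$, $b\in B$; ideals can be factored out. A brace $B$ is *almost polycyclic* if it has a finite chain of ideals $\{0\}=I_0\le I_1\le\dots\le I_n=B$ such that, for each $0\le i<n$, either $I_{i+1}/I_i$ is finite, or $(I_{i+1}/I_i,+)$ is finitely generated and $I_{i+1}/I_i\le\operatorname{Soc}(B/I_i)$. It is *supersoluble* if it has a finite chain of ideals $\{0\}=I_0\le I_1\le\dots\le I_n=B$ such that, for each $0\le i<n$, either $(I_{i+1}/I_i,+)$ is infinite cyclic and $I_{i+1}/I_i\le\operatorname{Soc}(B/I_i)$, or $I_{i+1}/I_i$ has prime order. A *$b$-word* in symbols $x_1,\dots,x_m$ is a formal expression built from the empty word and the $x_i$ by the operations $w_1+w_2$,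 $w_1\cdot w_2$, $-w$, $w^{-1}$. A *finite presentation* of $B$ consists of a number $m\ge 0$, finitely many $b$-words $\rho_1,\dots,\rho_k$ in $x_1,\dots,x_m$, and a surjective homomorphism $\theta\colon F\to B$ from the free brace $F$ on $x_1,\dots,x_m$ whose kernel is the ideal of $F$ generated by the elements that $\rho_1,\dots,\rho_k$ represent. The data $(m;\rho_1,\dots,\rho_k)$ are a finite object that can be given to an algorithm as input. **Theorem 3.46.** There is a single algorithm (a partial recursive function) which, given as input the data $(m;\rho_1,\dots,\rho_k)$ of any finite presentation of any almost polycyclic brace $B$, halts and correctly answers whether or not $B$ is supersoluble. -/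

import Mathlib

universe u v

/-- A skew left brace: a set with two group structures `(B, +)` (not necessarily abelian) and
`(B, *)` such that `a * (b + c) = a * b - a + a * c`. -/
class SkewBrace (B : Type u) extends AddGroup B, Group B where
  mul_add_eq : ∀ a b c : B, a * (b + c) = a * b - a + a * c

namespace SkewBrace

variable {B : Type u} [SkewBrace B]

/-- The two identity elements coincide. -/
theorem one_eq_zero : (1 : B) = 0 := by
  have h := mul_add_eq (1 : B) 0 0
  simp only [one_mul, add_zero, zero_sub] at h
  have h2 : -(1 : B) = 0 := h.symm
  simpa using h2

/-- `λ_a(b) = -a + a * b`. -/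
def lam (a b : B) : B := -a + a * b

theorem mul_eq (a b : B) : a * b = a + lam a b := by simp [lam]

theorem mul_zero' (a : B) : a * 0 = a := by rw [← one_eq_zero, mul_one]

theorem lam_mul (a b c : B) : lam (a * b) c = lam a (lam b c) := by
  have h : a * (b * c) = a * b - a + a * lam b c := by rw [mul_eq b c, mul_add_eq]
  rw [lam, lam, mul_assoc, h]
  simp [sub_eq_add_neg, add_assoc]

theorem lam_one (b : B) : lam 1 b = b := by simp [lam, one_eq_zero]

theorem add_eq (a i : B) : a + i = a * lam a⁻¹ i := by
  rw [mul_eq, ← lam_mul, mul_inv_cancel, lam_one]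

/-- The socle `Soc(B) = Ker λ ∩ Z(B, +)`. -/
def socle (B : Type u) [SkewBrace B] : Set B :=
  {a | (∀ b, lam a b = b) ∧ ∀ b, a + b = b + a}

end SkewBrace

open SkewBrace in
/-- An ideal of a skew brace: a subgroup of `(B, +)` and of `(B, *)` which is invariant under all
`λ_b`, normal in `(B, +)` and normal in `(B, *)`. -/
structure BraceIdeal (B : Type u) [SkewBrace B] extends AddSubgroup B where
  one_mem' : (1 : B) ∈ carrier
  mul_mem' : ∀ {a b : B}, a ∈ carrier → b ∈ carrier → a * b ∈ carrier
  inv_mem' : ∀ {a : B}, a ∈ carrier → a⁻¹ ∈ carrier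
  lam_mem' : ∀ (b : B) {a : B}, a ∈ carrier → lam b a ∈ carrier
  add_conj_mem' : ∀ (b : B) {a : B}, a ∈ carrier → b + a - b ∈ carrier
  mul_conj_mem' : ∀ (b : B) {a : B}, a ∈ carrier → b * a * b⁻¹ ∈ carrier

namespace BraceIdeal

open SkewBrace

variable {B : Type u} [SkewBrace B]

instance : Membership B (BraceIdeal B) := ⟨fun I a => a ∈ I.carrier⟩

/-- The ideal generated by a subset `S`: the smallest ideal containing `S`. -/
def span (S : Set B) : BraceIdeal B where
  carrier := {a | ∀ I : BraceIdeal B, S ⊆ I.carrier → a ∈ I.carrier}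
  zero_mem' _ _ := AddSubgroup.zero_mem _
  add_mem' ha hb I h := I.add_mem' (ha I h) (hb I h)
  neg_mem' ha I h := I.neg_mem' (ha I h)
  one_mem' I _ := I.one_mem'
  mul_mem' ha hb I h := I.mul_mem' (ha I h) (hb I h)
  inv_mem' ha I h := I.inv_mem' (ha I h)
  lam_mem' b _ ha I h := I.lam_mem' b (ha I h)
  add_conj_mem' b _ ha I h := I.add_conj_mem' b (ha I h)
  mul_conj_mem' b _ ha I h := I.mul_conj_mem' b (ha I h)

instance (I : BraceIdeal B) : I.toAddSubgroup.Normal :=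
  ⟨fun _ ha b => by
    have h := I.add_conj_mem' b ha
    rwa [sub_eq_add_neg] at h⟩

/-- The underlying set of the quotient brace `B / I`. -/
def Quot (I : BraceIdeal B) : Type u := B ⧸ I.toAddSubgroup

instance (I : BraceIdeal B) : AddGroup I.Quot :=
  inferInstanceAs (AddGroup (B ⧸ I.toAddSubgroup))

/-- The canonical projection `B → B / I`, as an additive homomorphism. -/
def proj (I : BraceIdeal B) : B →+ I.Quot := QuotientAddGroup.mk' I.toAddSubgroup

theorem proj_surjective (I : BraceIdeal B) : Function.Surjective I.proj :=
  QuotientAddGroup.mk'_surjective _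

theorem proj_eq (I : BraceIdeal B) {a b : B} : I.proj a = I.proj b ↔ -a + b ∈ I.carrier :=
  QuotientAddGroup.eq

/-- Additive and multiplicative cosets of an ideal coincide. -/
theorem proj_eq_iff_mul (I : BraceIdeal B) {a b : B} :
    I.proj a = I.proj b ↔ a⁻¹ * b ∈ I.carrier := by
  rw [proj_eq]
  constructor
  · intro h
    have h2 := I.lam_mem' a⁻¹ h
    have h3 : a⁻¹ * b = lam a⁻¹ (-a + b) := by
      have := add_eq a (-a + b)
      rw [add_neg_cancel_left] at this
      rw [eq_comm, ← mul_right_inj a, ← this, mul_inv_cancel_left]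
    rwa [h3]
  · intro h
    have h2 := I.lam_mem' a h
    simpa [lam] using h2

theorem proj_mul_congr (I : BraceIdeal B) {a a' b b' : B} (ha : I.proj a = I.proj a')
    (hb : I.proj b = I.proj b') : I.proj (a * b) = I.proj (a' * b') := by
  rw [proj_eq_iff_mul] at *
  have h1 : b⁻¹ * (a⁻¹ * a') * b ∈ I.carrier := by
    simpa using I.mul_conj_mem' b⁻¹ ha
  have h2 := I.mul_mem' h1 hb
  have h3 : (a * b)⁻¹ * (a' * b') = b⁻¹ * (a⁻¹ * a') * b * (b⁻¹ * b') := by group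
  rwa [h3]

theorem proj_inv_congr (I : BraceIdeal B) {a a' : B} (ha : I.proj a = I.proj a') :
    I.proj a⁻¹ = I.proj a'⁻¹ := by
  rw [proj_eq_iff_mul] at *
  have h1 := I.inv_mem' (I.mul_conj_mem' a ha)
  have h3 : a⁻¹⁻¹ * a'⁻¹ = (a * (a⁻¹ * a') * a⁻¹)⁻¹ := by group
  rwa [h3]

instance (I : BraceIdeal B) : Mul I.Quot :=
  ⟨Quotient.map₂ (· * ·) fun _ _ ha _ _ hb =>
    Quotient.exact (I.proj_mul_congr (Quotient.sound ha) (Quotient.sound hb))⟩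

instance (I : BraceIdeal B) : Inv I.Quot :=
  ⟨Quotient.map (·⁻¹) fun _ _ ha => Quotient.exact (I.proj_inv_congr (Quotient.sound ha))⟩

instance (I : BraceIdeal B) : One I.Quot := ⟨I.proj 1⟩

theorem proj_mul (I : BraceIdeal B) (a b : B) : I.proj (a * b) = I.proj a * I.proj b := rfl

theorem proj_inv (I : BraceIdeal B) (a : B) : I.proj a⁻¹ = (I.proj a)⁻¹ := rfl

theorem proj_one (I : BraceIdeal B) : I.proj (1 : B) = 1 := rfl

/-- The quotient brace `B / I`. -/
instance (I : BraceIdeal B) : SkewBrace I.Quot where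
  toAddGroup := inferInstance
  toGroup := Group.ofLeftAxioms
    (fun x y z => by
      obtain ⟨a, rfl⟩ := I.proj_surjective x
      obtain ⟨b, rfl⟩ := I.proj_surjective y
      obtain ⟨c, rfl⟩ := I.proj_surjective z
      simp only [← proj_mul, mul_assoc])
    (fun x => by
      obtain ⟨a, rfl⟩ := I.proj_surjective x
      simp only [← proj_mul, ← proj_one, one_mul])
    (fun x => by
      obtain ⟨a, rfl⟩ := I.proj_surjective x
      simp only [← proj_mul, ← proj_inv, ← proj_one, inv_mul_cancel])
  mul_add_eq x y z := by
    obtain ⟨a, rfl⟩ := I.proj_surjective x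
    obtain ⟨b, rfl⟩ := I.proj_surjective y
    obtain ⟨c, rfl⟩ := I.proj_surjective z
    have h := congrArg I.proj (mul_add_eq a b c)
    rw [map_add, map_sub] at h
    simp only [proj_mul, map_add] at h
    exact h

/-- The factor `J / I`, as a subgroup of `(B / I, +)` (it is used for ideals `I ≤ J`). -/
def factor (I J : BraceIdeal B) : AddSubgroup I.Quot := J.toAddSubgroup.map I.proj

end BraceIdeal

section Classes

variable (B : Type u) [SkewBrace B]

/-- `B` is supersoluble: there is a finite chain of ideals `{0} = I 0 ≤ I 1 ≤ ... ≤ I n = B` of `B`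
such that each factor `I (i+1) / I i` either is additively infinite cyclic and contained in
`Soc(B / I i)`, or has prime order. -/
def SkewBrace.IsSupersoluble : Prop :=
  ∃ (n : ℕ) (I : ℕ → BraceIdeal B),
    (I 0).carrier = {0} ∧ (I n).carrier = Set.univ ∧
    ∀ i < n, (I i).carrier ⊆ (I (i + 1)).carrier ∧
      ((IsAddCyclic ((I i).factor (I (i + 1))) ∧ Infinite ((I i).factor (I (i + 1))) ∧
          ((I i).factor (I (i + 1)) : Set (I i).Quot) ⊆ SkewBrace.socle (I i).Quot) ∨
        (Nat.card ((I i).factor (I (i + 1)))).Prime)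

/-- `B` is almost polycyclic: there is a finite chain of ideals
`{0} = I 0 ≤ I 1 ≤ ... ≤ I n = B` of `B` such that each factor `I (i+1) / I i` either is finite, or
is finitely generated and contained in `Soc(B / I i)`. -/
def SkewBrace.IsAlmostPolycyclic : Prop :=
  ∃ (n : ℕ) (I : ℕ → BraceIdeal B),
    (I 0).carrier = {0} ∧ (I n).carrier = Set.univ ∧
    ∀ i < n, (I i).carrier ⊆ (I (i + 1)).carrier ∧
      (Finite ((I i).factor (I (i + 1))) ∨
        (((I i).factor (I (i + 1))).FG ∧
          ((I i).factor (I (i + 1)) : Set (I i).Quot) ⊆ SkewBrace.socle (I i).Quot))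

end Classes

/-- A homomorphism of skew braces. -/
structure BraceHom (A : Type u) (B : Type v) [SkewBrace A] [SkewBrace B] where
  toFun : A → B
  map_add' : ∀ a b, toFun (a + b) = toFun a + toFun b
  map_mul' : ∀ a b, toFun (a * b) = toFun a * toFun b

/-- `b`-words in the symbols `X`. -/
inductive BWord (X : Type u) : Type u
  | empty : BWord X
  | of : X → BWord X
  | add : BWord X → BWord X → BWord X
  | mul : BWord X → BWord X → BWord X
  | neg : BWord X → BWord X
  | inv : BWord X → BWord X

namespace BWord

/-- Renaming the symbols of a `b`-word. -/
def map {X : Type u} {Y : Type v} (f : X → Y) : BWord X → BWord Y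
  | empty => empty
  | of x => of (f x)
  | add w₁ w₂ => add (map f w₁) (map f w₂)
  | mul w₁ w₂ => mul (map f w₁) (map f w₂)
  | neg w => neg (map f w)
  | inv w => inv (map f w)

/-- The value of a `b`-word in a skew brace. -/
def eval {X : Type u} {B : Type v} [SkewBrace B] (b : X → B) : BWord X → B
  | empty => 0
  | of x => b x
  | add w₁ w₂ => eval b w₁ + eval b w₂
  | mul w₁ w₂ => eval b w₁ * eval b w₂
  | neg w => -eval b w
  | inv w => (eval b w)⁻¹

/-- The smallest congruence on `b`-words whose quotient is a skew brace, the empty word being the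
common identity element. -/
inductive Rel {X : Type u} : BWord X → BWord X → Prop
  | refl (a) : Rel a a
  | symm {a b} : Rel a b → Rel b a
  | trans {a b c} : Rel a b → Rel b c → Rel a c
  | add_congr {a a' b b'} : Rel a a' → Rel b b' → Rel (add a b) (add a' b')
  | mul_congr {a a' b b'} : Rel a a' → Rel b b' → Rel (mul a b) (mul a' b')
  | neg_congr {a a'} : Rel a a' → Rel (neg a) (neg a')
  | inv_congr {a a'} : Rel a a' → Rel (inv a) (inv a')
  | add_assoc (a b c) : Rel (add (add a b) c) (add a (add b c))
  | zero_add (a) : Rel (add empty a) a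
  | neg_add_cancel (a) : Rel (add (neg a) a) empty
  | mul_assoc (a b c) : Rel (mul (mul a b) c) (mul a (mul b c))
  | one_mul (a) : Rel (mul empty a) a
  | inv_mul_cancel (a) : Rel (mul (inv a) a) empty
  | brace (a b c) : Rel (mul a (add b c)) (add (add (mul a b) (neg a)) (mul a c))

instance setoid (X : Type u) : Setoid (BWord X) := ⟨Rel, Rel.refl, Rel.symm, Rel.trans⟩

/-- A Gödel numbering of the `b`-words in the symbols `x_0, x_1, ...`. -/
def code : BWord ℕ → ℕ
  | empty => 0
  | of i => 5 * i + 1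
  | add w₁ w₂ => 5 * Nat.pair (code w₁) (code w₂) + 2
  | mul w₁ w₂ => 5 * Nat.pair (code w₁) (code w₂) + 3
  | neg w => 5 * code w + 4
  | inv w => 5 * code w + 5

/-- The inverse of the Gödel numbering. -/
def ofCode : ℕ → BWord ℕ
  | 0 => empty
  | n + 1 =>
    have h : n / 5 < n + 1 := Nat.lt_succ_of_le (Nat.div_le_self _ _)
    have _h1 : (n / 5).unpair.1 < n + 1 := (Nat.unpair_left_le _).trans_lt h
    have _h2 : (n / 5).unpair.2 < n + 1 := (Nat.unpair_right_le _).trans_lt h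
    match n % 5 with
    | 0 => of (n / 5)
    | 1 => add (ofCode (n / 5).unpair.1) (ofCode (n / 5).unpair.2)
    | 2 => mul (ofCode (n / 5).unpair.1) (ofCode (n / 5).unpair.2)
    | 3 => neg (ofCode (n / 5))
    | _ => inv (ofCode (n / 5))

theorem ofCode_code (w : BWord ℕ) : ofCode (code w) = w := by
  have key : ∀ m r : ℕ, r < 5 → (5 * m + r) / 5 = m ∧ (5 * m + r) % 5 = r := by
    intro m r hr; omega
  induction w with
  | empty => simp [code, ofCode]
  | of i => rw [code, ofCode]; simp
  | add a b iha ihb =>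
    obtain ⟨h1, h2⟩ := key (Nat.pair (code a) (code b)) 1 (by omega)
    rw [code, ofCode]; simp [h1, h2, iha, ihb]
  | mul a b iha ihb =>
    obtain ⟨h1, h2⟩ := key (Nat.pair (code a) (code b)) 2 (by omega)
    rw [code, ofCode]; simp [h1, h2, iha, ihb]
  | neg a iha =>
    obtain ⟨h1, h2⟩ := key (code a) 3 (by omega)
    rw [code, ofCode]; simp [h1, h2, iha]
  | inv a iha =>
    obtain ⟨h1, h2⟩ := key (code a) 4 (by omega)
    rw [code, ofCode]; simp [h1, h2, iha]

theorem code_ofCode (n : ℕ) : code (ofCode n) = n := by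
  induction n using Nat.strong_induction_on with
  | _ n ih =>
    cases n with
    | zero => simp [code, ofCode]
    | succ n =>
      have h : n / 5 < n + 1 := Nat.lt_succ_of_le (Nat.div_le_self _ _)
      have i0 := ih _ h
      have i1 := ih _ ((Nat.unpair_left_le (n / 5)).trans_lt h)
      have i2 := ih _ ((Nat.unpair_right_le (n / 5)).trans_lt h)
      have hm := Nat.mod_lt n (show 5 > 0 by omega)
      have hd := Nat.div_add_mod n 5
      rw [ofCode]
      generalize n % 5 = r at *
      interval_cases r <;> simp [code, i0, i1, i2] <;> omega

instance : Denumerable (BWord ℕ) :=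
  Denumerable.mk' ⟨code, ofCode, ofCode_code, code_ofCode⟩

end BWord

/-- The free skew brace on `X`. -/
def FreeBrace (X : Type u) : Type u := Quotient (BWord.setoid X)

namespace FreeBrace

variable {X : Type u}

/-- The element of the free skew brace represented by a `b`-word. -/
def mk (w : BWord X) : FreeBrace X := Quotient.mk _ w

instance : Add (FreeBrace X) := ⟨Quotient.map₂ .add fun _ _ h _ _ h' => .add_congr h h'⟩
instance : Mul (FreeBrace X) := ⟨Quotient.map₂ .mul fun _ _ h _ _ h' => .mul_congr h h'⟩
instance : Neg (FreeBrace X) := ⟨Quotient.map .neg fun _ _ h => .neg_congr h⟩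
instance : Inv (FreeBrace X) := ⟨Quotient.map .inv fun _ _ h => .inv_congr h⟩
instance : Zero (FreeBrace X) := ⟨mk .empty⟩
instance : One (FreeBrace X) := ⟨mk .empty⟩

instance : SkewBrace (FreeBrace X) where
  toAddGroup := AddGroup.ofLeftAxioms
    (by rintro ⟨a⟩ ⟨b⟩ ⟨c⟩; exact Quotient.sound (.add_assoc a b c))
    (by rintro ⟨a⟩; exact Quotient.sound (.zero_add a))
    (by rintro ⟨a⟩; exact Quotient.sound (.neg_add_cancel a))
  toGroup := Group.ofLeftAxioms
    (by rintro ⟨a⟩ ⟨b⟩ ⟨c⟩; exact Quotient.sound (.mul_assoc a b c))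
    (by rintro ⟨a⟩; exact Quotient.sound (.one_mul a))
    (by rintro ⟨a⟩; exact Quotient.sound (.inv_mul_cancel a))
  mul_add_eq := by
    rintro ⟨a⟩ ⟨b⟩ ⟨c⟩
    exact Quotient.sound (.brace a b c)

theorem eval_eq_of_rel {B : Type v} [SkewBrace B] (b : X → B) {w w' : BWord X}
    (h : BWord.Rel w w') : w.eval b = w'.eval b := by
  induction h with
  | refl => rfl
  | symm _ ih => exact ih.symm
  | trans _ _ ih ih' => exact ih.trans ih'
  | add_congr _ _ ih ih' => simp only [BWord.eval, ih, ih']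
  | mul_congr _ _ ih ih' => simp only [BWord.eval, ih, ih']
  | neg_congr _ ih => simp only [BWord.eval, ih]
  | inv_congr _ ih => simp only [BWord.eval, ih]
  | add_assoc => simp only [BWord.eval, _root_.add_assoc]
  | zero_add => simp only [BWord.eval, _root_.zero_add]
  | neg_add_cancel => simp only [BWord.eval, _root_.neg_add_cancel]
  | mul_assoc => simp only [BWord.eval, _root_.mul_assoc]
  | one_mul => simp only [BWord.eval, ← SkewBrace.one_eq_zero, _root_.one_mul]
  | inv_mul_cancel => simp only [BWord.eval, ← SkewBrace.one_eq_zero, _root_.inv_mul_cancel]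
  | brace => simp only [BWord.eval, SkewBrace.mul_add_eq, sub_eq_add_neg]

/-- The homomorphism out of the free skew brace given by a map on the generators. -/
def lift {B : Type v} [SkewBrace B] (b : X → B) : BraceHom (FreeBrace X) B where
  toFun := Quotient.lift (BWord.eval b) fun _ _ h => eval_eq_of_rel b h
  map_add' := by rintro ⟨a⟩ ⟨b⟩; rfl
  map_mul' := by rintro ⟨a⟩ ⟨b⟩; rfl

end FreeBrace

/-- A finite presentation: `n` generators `x_0, ..., x_{n-1}` and finitely many relators, which are
`b`-words in these generators. -/
structure FiniteBracePresentation where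
  n : ℕ
  relators : List (BWord (Fin n))

namespace FiniteBracePresentation

/-- The finite presentation as an input of an algorithm: the number of generators and the list of
relators. -/
def code (P : FiniteBracePresentation) : ℕ × List (BWord ℕ) :=
  (P.n, P.relators.map (BWord.map Fin.val))

/-- `θ` makes `P` a presentation of `B`: `θ` is a surjective homomorphism from the free skew brace
on the generators of `P` onto `B`, and its kernel is the ideal generated by the relators of `P`. -/
def IsPresentation (P : FiniteBracePresentation) {B : Type u} [SkewBrace B]
    (θ : BraceHom (FreeBrace (Fin P.n)) B) : Prop :=
  Function.Surjective θ.toFun ∧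
    {x | θ.toFun x = 0} = (BraceIdeal.span {x | ∃ w ∈ P.relators, x = FreeBrace.mk w}).carrier

end FiniteBracePresentation

/-! Two searches run in parallel. Supersolubility is witnessed by a finite list of words that
generates, term by term, a chain of ideals with cyclic factors. Its failure is witnessed by
operation tables of a nonzero finite quotient without ideals of prime order. Both kinds of witness
can be recognised from the presentation, because the identities that hold in the presented brace are
exactly the derivable ones. The theorem is thus reduced to a residual property: an almost polycyclic
brace B that is not supersoluble has such a finite quotient.

All additive subgroups of B are finitely generated, so some ideal J is maximal with B/J not
supersoluble. By maximality B/J has no ideal of prime order; it remains to see that it is finite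
(`finite_quot_of_maximal`). If it is infinite, its socle contains an element of infinite order,
hence a nonzero torsion-free ideal A. For each prime p the quotient of B/J by pA is supersoluble, so
A/pA has a filtration on whose factors the multiplicative group acts, via λ, by commuting maps g
with g^p = g. By `exists_common_eigenvector` some nonzero v in A satisfies λ_g(v) = ±v for all g.
The multiples of v then form an infinite cyclic ideal in the socle with supersoluble quotient, so
B/J is supersoluble, a contradiction.

The eigenvector comes from number theory: an algebraic integer α such that α^p - α is nilpotent
modulo p for every prime p is a rational integer (`exists_int_eq_of_pow_sub_integral`). Otherwise
ℚ(α) has degree at least 2 and almost every p has two distinct primes of norm p above it. Products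
of these give more ideals of norm at most x than any constant multiple of x, whereas the number of
ideals grows linearly.

On the positive side, a chain must be verified by finitely many conditions on its generators,
although ideals involve the action of every element. This works because the additive and the
multiplicative spans of the generators coincide (`IdealChain.mem_mulSpan_iff`). -/

section

/-! ### Number fields in which almost all primes have residue degree one -/

section SplitPrimes

open NumberField Polynomial

theorem exists_mul_mem_adjoin_int {K : Type*} [Field K] [CharZero K] (a x : K)
    (hx : x ∈ Algebra.adjoin ℚ {a}) :
    ∃ N : ℕ, N ≠ 0 ∧ (N : K) * x ∈ Algebra.adjoin ℤ {a} := by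
  induction hx using Algebra.adjoin_induction with
  | mem x hx => exact ⟨1, one_ne_zero, by simpa using Algebra.subset_adjoin hx⟩
  | algebraMap r =>
    refine ⟨r.den, r.den_nz, ?_⟩
    have h : ((r.den : ℕ) : K) * algebraMap ℚ K r = algebraMap ℤ K r.num := by
      rw [eq_ratCast, mul_comm]
      have := Rat.mul_den_eq_num r
      simp only [algebraMap_int_eq, eq_intCast]
      exact_mod_cast congrArg (Rat.cast : ℚ → K) this
    rw [h]
    exact Subalgebra.algebraMap_mem _ _
  | add x y _ _ hx hy =>
    obtain ⟨m, hm, hx⟩ := hx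
    obtain ⟨n, hn, hy⟩ := hy
    refine ⟨m * n, mul_ne_zero hm hn, ?_⟩
    have h : ((m * n : ℕ) : K) * (x + y) = n * (m * x) + m * (n * y) := by push_cast; ring
    rw [h]
    exact add_mem (mul_mem (natCast_mem _ _) hx) (mul_mem (natCast_mem _ _) hy)
  | mul x y _ _ hx hy =>
    obtain ⟨m, hm, hx⟩ := hx
    obtain ⟨n, hn, hy⟩ := hy
    refine ⟨m * n, mul_ne_zero hm hn, ?_⟩
    have h : ((m * n : ℕ) : K) * (x * y) = (m * x) * (n * y) := by push_cast; ring
    rw [h]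
    exact mul_mem hx hy

variable {K : Type*} [Field K] [NumberField K]

/-- The ring of integers is finitely generated over ℤ, so the product of the denominators of
finitely many generators serves for all elements. For primes not dividing `N`, the Frobenius of a
residue field can then be tested on `a` alone. -/
theorem exists_forall_mul_mem_adjoin_int (a : 𝓞 K)
    (ha : Algebra.adjoin ℚ {(a : K)} = ⊤) :
    ∃ N : ℕ, N ≠ 0 ∧ ∀ x : 𝓞 K, (N : 𝓞 K) * x ∈ Algebra.adjoin ℤ {a} := by
  have h1 : ∀ x : 𝓞 K, ∃ N : ℕ, N ≠ 0 ∧ (N : 𝓞 K) * x ∈ Algebra.adjoin ℤ {a} := by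
    intro x
    obtain ⟨N, hN, h⟩ := exists_mul_mem_adjoin_int (a : K) (x : K) (by rw [ha]; trivial)
    refine ⟨N, hN, ?_⟩
    have hmap : Algebra.adjoin ℤ {(a : K)} =
        (Algebra.adjoin ℤ {a}).map (IsScalarTower.toAlgHom ℤ (𝓞 K) K) := by
      rw [AlgHom.map_adjoin, Set.image_singleton]
      rfl
    rw [hmap] at h
    obtain ⟨y, hy, hyx⟩ := h
    have : y = (N : 𝓞 K) * x := by
      apply RingOfIntegers.coe_injective
      simpa using hyx
    rwa [← this]
  obtain ⟨s, hs⟩ := Module.Finite.fg_top (R := ℤ) (M := 𝓞 K)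
  choose f hf0 hf using h1
  refine ⟨∏ x ∈ s, f x, Finset.prod_ne_zero_iff.2 fun x _ => hf0 x, fun x => ?_⟩
  have hx : x ∈ Submodule.span ℤ (s : Set (𝓞 K)) := by rw [hs]; trivial
  induction hx using Submodule.span_induction with
  | mem x hx =>
    obtain ⟨k, hk⟩ := Finset.dvd_prod_of_mem f hx
    rw [hk, Nat.cast_mul, mul_comm (f x : 𝓞 K), mul_assoc]
    exact mul_mem (natCast_mem _ _) (hf x)
  | zero => simp
  | add x y _ _ hx hy => rw [mul_add]; exact add_mem hx hy
  | smul c x _ hx =>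
    rw [mul_smul_comm]
    exact Subalgebra.smul_mem _ hx c

/-- If a generator of `K` is fixed by the Frobenius of the residue field at `P`, then `P` has
residue degree one, provided that `p` does not divide the index of `ℤ[a]`. -/
theorem absNorm_eq_of_pow_sub_mem (a : 𝓞 K) {N : ℕ}
    (hN : ∀ x : 𝓞 K, (N : 𝓞 K) * x ∈ Algebra.adjoin ℤ {a}) {p : ℕ} (hp : p.Prime)
    (hpN : ¬ p ∣ N) (P : Ideal (𝓞 K)) [P.IsMaximal] (hpP : (p : 𝓞 K) ∈ P)
    (haP : a ^ p - a ∈ P) : Ideal.absNorm P = p := by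
  have hP0 : P ≠ ⊥ := by
    rintro rfl
    rw [Ideal.mem_bot] at hpP
    exact hp.ne_zero (by exact_mod_cast hpP)
  have : Fact p.Prime := ⟨hp⟩
  let k := 𝓞 K ⧸ P
  let : Field k := Ideal.Quotient.field P
  have : Finite k := Ideal.finiteQuotientOfFreeOfNeBot P hP0
  let : Fintype k := Fintype.ofFinite k
  have hpk : (p : k) = 0 := by
    have := Ideal.Quotient.eq_zero_iff_mem.2 hpP
    simpa using this
  have hchar : CharP k p := (CharP.charP_iff_prime_eq_zero hp).2 hpk
  let F : k →+* k := frobenius k p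
  let π := Ideal.Quotient.mk P
  -- The elements fixed by Frobenius form a subring, so it suffices that the image of `a` is fixed.
  have h1 : ∀ y ∈ Algebra.adjoin ℤ {a}, F (π y) = π y := by
    intro y hy
    induction hy using Algebra.adjoin_induction with
    | mem x hx =>
      rw [Set.mem_singleton_iff] at hx
      subst hx
      have h := Ideal.Quotient.eq_zero_iff_mem.2 haP
      rw [map_sub, map_pow, sub_eq_zero] at h
      simpa [F, frobenius_def, π] using h
    | algebraMap r => simp
    | add x y _ _ hx hy => rw [map_add, map_add, hx, hy]
    | mul x y _ _ hx hy => rw [map_mul, map_mul, hx, hy]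
  have hN0 : (N : k) ≠ 0 := by
    rwa [Ne, CharP.cast_eq_zero_iff k p]
  have h2 : ∀ x : k, x ^ p = x := by
    intro x
    obtain ⟨x, rfl⟩ := Ideal.Quotient.mk_surjective x
    -- `N * x` is fixed, and `N` is fixed and invertible in the residue field, so `x` is fixed.
    have h := h1 _ (hN x)
    rw [map_mul, map_mul, map_natCast, map_natCast] at h
    exact mul_left_cancel₀ hN0 h
  -- Every element of `k` is a root of X^p - X.
  have hcard : Fintype.card k ≤ p := by
    have hne := FiniteField.X_pow_card_sub_X_ne_zero k hp.one_lt
    rw [← FiniteField.X_pow_card_sub_X_natDegree_eq k hp.one_lt]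
    calc Fintype.card k = (Finset.univ : Finset k).card := rfl
      _ ≤ _ := Polynomial.card_le_degree_of_subset_roots fun x _ => by
        rw [mem_roots hne]
        simp [h2 x]
  have hcard2 : Ideal.absNorm P = Fintype.card k := by
    rw [Ideal.absNorm_apply, Submodule.cardQuot_apply, Nat.card_eq_fintype_card]
  rw [hcard2]
  refine le_antisymm hcard ?_
  exact Nat.le_of_dvd Fintype.card_pos ((CharP.cast_eq_zero_iff k p _).1 (Nat.cast_card_eq_zero k))

/-- If the Frobenius at almost all primes fixes a generator of `K`, then almost all primes have
two prime ideals of degree one above them. -/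
theorem exists_two_primes (hd : Module.finrank ℚ K ≠ 1) {p : ℕ} (hp : p.Prime)
    (hdisc : ¬ (p : ℤ) ∣ discr K)
    (h : ∀ P : Ideal (𝓞 K), P.IsMaximal → (p : 𝓞 K) ∈ P → Ideal.absNorm P = p) :
    ∃ P Q : Ideal (𝓞 K), Prime P ∧ Prime Q ∧ P ≠ Q ∧ Ideal.absNorm P = p ∧
      Ideal.absNorm Q = p := by
  classical
  have hpz : Prime (p : ℤ) := Nat.prime_iff_prime_int.mp hp
  have hun := (not_dvd_discr_iff_isUnramifiedIn K (𝓞 K) hpz).1 hdisc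
  have hp0 : (Ideal.span {(p : ℤ)}) ≠ ⊥ := by simpa using hp.ne_zero
  have : (Ideal.span {(p : ℤ)}).IsPrime := by rwa [Ideal.span_singleton_prime hpz.ne_zero]
  have hmax : (Ideal.span {(p : ℤ)}).IsMaximal := this.isMaximal hp0
  have hfin : Finite ((Ideal.span {(p : ℤ)}).primesOver (𝓞 K)) :=
    IsDedekindDomain.primesOver_finite _ _
  let := Fintype.ofFinite ((Ideal.span {(p : ℤ)}).primesOver (𝓞 K))
  have hmem : ∀ q : (Ideal.span {(p : ℤ)}).primesOver (𝓞 K), q.1.IsMaximal ∧ Prime q.1 ∧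
      Ideal.absNorm q.1 = p ∧ q.1.ramificationIdx ℤ * q.1.inertiaDeg ℤ = 1 := by
    rintro ⟨q, hq1, hq2⟩
    have hqm : q.IsMaximal := Ideal.IsMaximal.of_liesOver_isMaximal q (Ideal.span {(p : ℤ)})
    have hpq : (p : 𝓞 K) ∈ q := by
      have h1 : (p : ℤ) ∈ Ideal.span {(p : ℤ)} := Ideal.mem_span_singleton_self _
      rw [hq2.over, Ideal.mem_comap] at h1
      simpa using h1
    have hn := h q hqm hpq
    have hq0 : q ≠ ⊥ := by
      rintro rfl
      rw [Ideal.absNorm_bot] at hn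
      exact hp.ne_zero hn.symm
    refine ⟨hqm, Ideal.prime_of_isPrime hq0 hq1, hn, ?_⟩
    have hr := hun.ramificationIdx_eq_one (𝔓 := q) hq2
    have hi := Ideal.natAbs_pow_inertiaDeg (p : ℤ) q
    rw [hn, Int.natAbs_natCast] at hi
    have hi1 : q.inertiaDeg ℤ = 1 := Nat.pow_right_injective hp.two_le (by simpa using hi)
    rw [hr, hi1]
  -- All ramification indices and inertia degrees are 1, so the fundamental identity says that the
  -- number of primes above `p` is the degree of `K`, which is at least 2.
  have hsum := Ideal.sum_ramification_inertia_eq_finrank (Ideal.span {(p : ℤ)}) (𝓞 K)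
  rw [Finset.sum_congr rfl fun q _ => (hmem q).2.2.2, Finset.sum_const, smul_eq_mul, mul_one,
    RingOfIntegers.rank] at hsum
  have hpos : 0 < Module.finrank ℚ K := Module.finrank_pos
  obtain ⟨P, -, Q, -, hPQ⟩ := Finset.one_lt_card.1 (show 1 < Finset.univ.card by
    rw [hsum]; omega)
  exact ⟨P.1, Q.1, (hmem P).2.1, (hmem Q).2.1, fun h => hPQ (Subtype.ext h), (hmem P).2.2.1,
    (hmem Q).2.2.1⟩


/-- The multiset of prime ideals obtained by replacing each prime factor of `m` by its image
under `P`. -/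
def primeFactorsMap (P : ℕ → Ideal (𝓞 K)) (m : ℕ) : Multiset (Ideal (𝓞 K)) :=
  (m.primeFactorsList : Multiset ℕ).map P

/-! ### Counting ideals by norm -/

section

variable {P Q : ℕ → Ideal (𝓞 K)} {S : ℕ → Prop}

theorem primeFactorsMap_prod_absNorm (hP : ∀ p, p.Prime → S p → Ideal.absNorm (P p) = p) {m : ℕ}
    (hm : m ≠ 0) (hS : ∀ p, p.Prime → p ∣ m → S p) :
    ((primeFactorsMap P m).map Ideal.absNorm).prod = m := by
  rw [primeFactorsMap, Multiset.map_map]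
  have : Multiset.map (Ideal.absNorm ∘ P) (m.primeFactorsList : Multiset ℕ) =
      Multiset.map id (m.primeFactorsList : Multiset ℕ) := by
    refine Multiset.map_congr rfl fun p hp => ?_
    have hp' := Nat.prime_of_mem_primeFactorsList hp
    exact hP p hp' (hS p hp' (Nat.dvd_of_mem_primeFactorsList hp))
  rw [this, Multiset.map_id, Multiset.prod_coe, Nat.prod_primeFactorsList hm]

-- A pair (m, n) is sent to the product of the `P p` over the prime factors p of m and the `Q p`
-- over those of n, an ideal of norm mn. The map is injective by unique factorization: the norm of a
-- factor determines p, and `P p ≠ Q p`, so the two kinds of factors can be told apart; the norms of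
-- the two partial products return m and n.
open Classical in
theorem pairs_le_card_ideals
    (hP : ∀ p, p.Prime → S p → Prime (P p) ∧ Ideal.absNorm (P p) = p)
    (hQ : ∀ p, p.Prime → S p → Prime (Q p) ∧ Ideal.absNorm (Q p) = p)
    (hPQ : ∀ p, p.Prime → S p → P p ≠ Q p) (F : Finset (ℕ × ℕ)) (x : ℝ)
    (hF : ∀ t ∈ F, t.1 ≠ 0 ∧ t.2 ≠ 0 ∧ ((t.1 * t.2 : ℕ) : ℝ) ≤ x ∧
      (∀ p, p.Prime → p ∣ t.1 → S p) ∧ ∀ p, p.Prime → p ∣ t.2 → S p) :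
    F.card ≤ Nat.card {I : Ideal (𝓞 K) // (Ideal.absNorm I : ℝ) ≤ x} := by
  let f : ℕ × ℕ → Multiset (Ideal (𝓞 K)) := fun t => primeFactorsMap P t.1 + primeFactorsMap Q t.2
  let good : Ideal (𝓞 K) → Prop := fun I => ∃ p, p.Prime ∧ S p ∧ I = P p
  have hgood : ∀ m, (∀ p, p.Prime → p ∣ m → S p) → ∀ I ∈ primeFactorsMap P m, good I := by
    intro m hm I hI
    obtain ⟨p, hp, rfl⟩ := Multiset.mem_map.1 hI
    have hp' := Nat.prime_of_mem_primeFactorsList hp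
    exact ⟨p, hp', hm p hp' (Nat.dvd_of_mem_primeFactorsList hp), rfl⟩
  have hbad : ∀ m, (∀ p, p.Prime → p ∣ m → S p) → ∀ I ∈ primeFactorsMap Q m, ¬ good I := by
    rintro m hm I hI ⟨q, hq, hqS, rfl⟩
    obtain ⟨p, hp, h⟩ := Multiset.mem_map.1 hI
    have hp' := Nat.prime_of_mem_primeFactorsList hp
    have hpS := hm p hp' (Nat.dvd_of_mem_primeFactorsList hp)
    have : p = q := by rw [← (hQ p hp' hpS).2, h, (hP q hq hqS).2]
    subst this
    exact hPQ p hp' hpS h.symm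
  have hfilter : ∀ t ∈ F, (f t).filter good = primeFactorsMap P t.1 ∧
      (f t).filter (fun I => ¬ good I) = primeFactorsMap Q t.2 := by
    intro t ht
    obtain ⟨-, -, -, h1, h2⟩ := hF t ht
    simp only [f, Multiset.filter_add]
    rw [Multiset.filter_eq_self.2 (hgood _ h1), Multiset.filter_eq_nil.2 (hbad _ h2),
      Multiset.filter_eq_self.2 (hbad _ h2),
      Multiset.filter_eq_nil.2 fun I hI => not_not.2 (hgood _ h1 I hI), add_zero, zero_add]
    exact ⟨rfl, rfl⟩
  have hprime : ∀ t ∈ F, ∀ I ∈ f t, Prime I := by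
    intro t ht I hI
    obtain ⟨-, -, -, h1, h2⟩ := hF t ht
    rcases Multiset.mem_add.1 hI with hI | hI
    · obtain ⟨p, hp, hpS, rfl⟩ := hgood _ h1 I hI
      exact (hP p hp hpS).1
    · obtain ⟨p, hp, rfl⟩ := Multiset.mem_map.1 hI
      have hp' := Nat.prime_of_mem_primeFactorsList hp
      exact (hQ p hp' (h2 p hp' (Nat.dvd_of_mem_primeFactorsList hp))).1
  have hP' : ∀ p, p.Prime → S p → Ideal.absNorm (P p) = p := fun p hp h => (hP p hp h).2
  have hQ' : ∀ p, p.Prime → S p → Ideal.absNorm (Q p) = p := fun p hp h => (hQ p hp h).2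
  have hnorm : ∀ t ∈ F, Ideal.absNorm (f t).prod = t.1 * t.2 := by
    intro t ht
    obtain ⟨h0, h0', -, h1, h2⟩ := hF t ht
    rw [map_multiset_prod, Multiset.map_add, Multiset.prod_add,
      primeFactorsMap_prod_absNorm hP' h0 h1, primeFactorsMap_prod_absNorm hQ' h0' h2]
  have hfin : Finite {I : Ideal (𝓞 K) // (Ideal.absNorm I : ℝ) ≤ x} := by
    refine Set.Finite.subset (Ideal.finite_setOfPred_absNorm_le (S := 𝓞 K) ⌊x⌋₊) ?_
    intro I hI
    exact Nat.le_floor hI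
  let g : F → {I : Ideal (𝓞 K) // (Ideal.absNorm I : ℝ) ≤ x} := fun t =>
    ⟨(f t).prod, by rw [hnorm t t.2]; exact (hF t t.2).2.2.1⟩
  have hg : Function.Injective g := by
    rintro ⟨t, ht⟩ ⟨u, hu⟩ h
    have h1 : f t = f u := by
      have h2 : (f t).prod = (f u).prod := congrArg Subtype.val h
      rw [← UniqueFactorizationMonoid.normalizedFactors_prod_of_prime (hprime t ht), h2,
        UniqueFactorizationMonoid.normalizedFactors_prod_of_prime (hprime u hu)]
    have e1 : t.1 = u.1 := by
      rw [← primeFactorsMap_prod_absNorm hP' (hF t ht).1 (hF t ht).2.2.2.1, ← (hfilter t ht).1,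
        h1, (hfilter u hu).1, primeFactorsMap_prod_absNorm hP' (hF u hu).1 (hF u hu).2.2.2.1]
    have e2 : t.2 = u.2 := by
      rw [← primeFactorsMap_prod_absNorm hQ' (hF t ht).2.1 (hF t ht).2.2.2.2, ← (hfilter t ht).2,
        h1, (hfilter u hu).2, primeFactorsMap_prod_absNorm hQ' (hF u hu).2.1 (hF u hu).2.2.2.2]
    exact Subtype.ext (Prod.ext e1 e2)
  have := Nat.card_le_card_of_injective g hg
  simpa using this

variable (K) in
/-- There is no number field in which all primes not dividing some `M` have two prime ideals of
degree one above them. -/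
theorem not_forall_exists_two_primes {M : ℕ} (hM : M ≠ 0)
    (h : ∀ p : ℕ, p.Prime → ¬ p ∣ M → ∃ P Q : Ideal (𝓞 K), Prime P ∧ Prime Q ∧ P ≠ Q ∧
      Ideal.absNorm P = p ∧ Ideal.absNorm Q = p) : False := by
  choose! P Q hP hQ hPQ hPn hQn using h
  obtain ⟨c, hc⟩ : ∃ c, Filter.Tendsto (fun s : ℝ ↦
      (Nat.card {I : Ideal (𝓞 K) // Ideal.absNorm I ≤ s} : ℝ) / s) Filter.atTop (nhds c) :=
    ⟨_, Ideal.tendsto_norm_le_div_atTop K⟩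
  have hM' : (0 : ℝ) < M := by positivity
  have hdvd : ∀ i p : ℕ, p.Prime → p ∣ i * M + 1 → ¬ p ∣ M := by
    intro i p hp h1 h2
    exact hp.one_lt.ne' (Nat.dvd_one.1 ((Nat.dvd_add_right (h2.mul_left i)).1 h1))
  -- The pairs used are (iM + 1, jM + 1), whose entries are coprime to M. Since jM + 1 ≤ (j + 1)M,
  -- the product is at most s whenever j + 1 ≤ s / ((iM + 1)M), which leaves at least s / ((iM +
  -- 1)M) - 1 values of j for each i.
  have hcount : ∀ (L : ℕ) (s : ℝ), 0 < s →
      ∑ i ∈ Finset.range L, (s / ((i * M + 1) * M) - 1) ≤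
        Nat.card {I : Ideal (𝓞 K) // (Ideal.absNorm I : ℝ) ≤ s} := by
    intro L s hs
    let F₀ := (Finset.range L).sigma fun i => Finset.range ⌊s / ((i * M + 1) * M)⌋₊
    let e : (Σ _ : ℕ, ℕ) → ℕ × ℕ := fun t => (t.1 * M + 1, t.2 * M + 1)
    have he : Function.Injective e := by
      rintro ⟨i, j⟩ ⟨i', j'⟩ h
      simp only [e, Prod.mk.injEq, Nat.add_right_cancel_iff] at h
      have h1 := Nat.eq_of_mul_eq_mul_right (Nat.pos_of_ne_zero hM) h.1
      have h2 := Nat.eq_of_mul_eq_mul_right (Nat.pos_of_ne_zero hM) h.2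
      simp [h1, h2]
    have hle := pairs_le_card_ideals (S := fun p => ¬ p ∣ M) (P := P) (Q := Q)
      (fun p hp hS => ⟨hP p hp hS, hPn p hp hS⟩) (fun p hp hS => ⟨hQ p hp hS, hQn p hp hS⟩) hPQ
      (F₀.image e) s (by
        intro t ht
        obtain ⟨⟨i, j⟩, hij, rfl⟩ := Finset.mem_image.1 ht
        refine ⟨Nat.succ_ne_zero _, Nat.succ_ne_zero _, ?_, hdvd i, hdvd j⟩
        have hj := (Finset.mem_sigma.1 hij).2
        rw [Finset.mem_range] at hj
        have hj2 : ((j + 1 : ℕ) : ℝ) ≤ s / ((i * M + 1) * M) :=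
          (Nat.le_floor_iff (by positivity)).1 hj
        rw [le_div_iff₀ (by positivity)] at hj2
        simp only [e]
        push_cast at hj2 ⊢
        have hM1 : (1 : ℝ) ≤ M := by exact_mod_cast Nat.one_le_iff_ne_zero.2 hM
        have : (0 : ℝ) ≤ i * M + 1 := by positivity
        nlinarith [mul_nonneg this (sub_nonneg.2 hM1)])
    rw [Finset.card_image_of_injective _ he, Finset.card_sigma] at hle
    calc ∑ i ∈ Finset.range L, (s / ((i * M + 1) * M) - 1)
        ≤ ∑ i ∈ Finset.range L, ((Finset.range ⌊s / ((i * M + 1) * M)⌋₊).card : ℝ) := by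
          refine Finset.sum_le_sum fun i _ => ?_
          rw [Finset.card_range]
          exact (Nat.sub_one_lt_floor _).le
      _ ≤ _ := by exact_mod_cast hle
  -- Divide by s and let s tend to infinity with L fixed; the L subtracted ones disappear in the
  -- limit.
  have hbound : ∀ L : ℕ, ∑ i ∈ Finset.range L, 1 / (((i : ℝ) * M + 1) * M) ≤ c := by
    intro L
    refine le_of_tendsto_of_tendsto (f := fun s : ℝ =>
      ∑ i ∈ Finset.range L, 1 / (((i : ℝ) * M + 1) * M) - L / s) (b := Filter.atTop) ?_ hc ?_
    · have := (tendsto_const_nhds (x := (L : ℝ))).div_atTop (Filter.tendsto_id (α := ℝ))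
      simpa using this.const_sub (∑ i ∈ Finset.range L, 1 / (((i : ℝ) * M + 1) * M))
    · filter_upwards [Filter.eventually_gt_atTop 0] with s hs
      rw [le_div_iff₀ hs]
      refine le_trans (le_of_eq ?_) (hcount L s hs)
      rw [Finset.sum_sub_distrib, sub_mul, div_mul_cancel₀ _ hs.ne', Finset.sum_mul]
      simp [div_eq_mul_inv, mul_comm]
  -- Up to the factor M², the bounded sums dominate the harmonic series.
  have hdiv := Real.tendsto_sum_range_one_div_nat_succ_atTop
  obtain ⟨L, hL⟩ := (hdiv.eventually_gt_atTop (c * (M * M))).exists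
  have h1 := hbound L
  have h2 : (∑ i ∈ Finset.range L, 1 / ((i : ℝ) + 1)) ≤
      (∑ i ∈ Finset.range L, 1 / (((i : ℝ) * M + 1) * M)) * (M * M) := by
    rw [Finset.sum_mul]
    refine Finset.sum_le_sum fun i _ => ?_
    have hM1 : (1 : ℝ) ≤ M := by exact_mod_cast Nat.one_le_iff_ne_zero.2 hM
    rw [div_mul_eq_mul_div, div_le_div_iff₀ (by positivity) (by positivity)]
    nlinarith [mul_nonneg hM'.le (sub_nonneg.2 hM1)]
  have h3 := mul_le_mul_of_nonneg_right h1 (by positivity : (0 : ℝ) ≤ M * M)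
  linarith

end

end SplitPrimes

open NumberField in
/-- An algebraic integer which is fixed by the Frobenius modulo every prime is an integer. -/
theorem exists_int_eq_of_pow_sub_integral {α : ℂ} (hα : IsIntegral ℤ α)
    (h : ∀ p : ℕ, p.Prime → ∃ k : ℕ, IsIntegral ℤ ((α ^ p - α) ^ k / p)) :
    ∃ m : ℤ, α = m := by
  have hαQ : IsIntegral ℚ α := hα.tower_top
  let K := IntermediateField.adjoin ℚ {α}
  have : FiniteDimensional ℚ K := IntermediateField.adjoin.finiteDimensional hαQ
  have : NumberField K := ⟨⟩
  let g : K := IntermediateField.AdjoinSimple.gen ℚ α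
  have hinj : Function.Injective (algebraMap K ℂ) := (algebraMap K ℂ).injective
  have hg : IsIntegral ℤ g := (isIntegral_algebraMap_iff hinj).1 hα
  let a : 𝓞 K := ⟨g, hg⟩
  have htop : Algebra.adjoin ℚ {(a : K)} = ⊤ :=
    (IntermediateField.adjoin.powerBasis hαQ).adjoin_gen_eq_top
  -- In degree one, α is rational and integral, hence an integer. In higher degree the hypothesis
  -- leads to a contradiction.
  by_cases hd : Module.finrank ℚ K = 1
  · obtain ⟨q, hq⟩ := IntermediateField.mem_bot.1
      (IntermediateField.finrank_adjoin_simple_eq_one_iff.1 hd)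
    rw [← hq] at hα
    obtain ⟨m, hm⟩ := IsIntegrallyClosed.isIntegral_iff.1
      ((isIntegral_algebraMap_iff (algebraMap ℚ ℂ).injective).1 hα)
    exact ⟨m, by rw [← hq, ← hm]; simp⟩
  · exfalso
    obtain ⟨N, hN0, hN⟩ := exists_forall_mul_mem_adjoin_int a htop
    have hD0 : (discr K).natAbs ≠ 0 := Int.natAbs_ne_zero.2 (discr_ne_zero K)
    -- The exceptional primes are those dividing the denominator `N` of ℤ[a] and the ramified ones.
    refine not_forall_exists_two_primes K (mul_ne_zero hN0 hD0) fun p hp hpM => ?_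
    refine exists_two_primes hd hp (fun hdv => hpM (Dvd.dvd.mul_left ?_ _)) ?_
    · exact Int.natCast_dvd.1 hdv
    · intro P hPm hpP
      refine absNorm_eq_of_pow_sub_mem a hN hp (fun hdv => hpM (hdv.mul_right _)) P hpP ?_
      obtain ⟨k, hk⟩ := h p hp
      have hk' : IsIntegral ℤ ((g ^ p - g) ^ k / p) := by
        refine (isIntegral_algebraMap_iff hinj).1 ?_
        simpa [g] using hk
      let b : 𝓞 K := ⟨_, hk'⟩
      have hb : (a ^ p - a) ^ k = p * b := by
        apply RingOfIntegers.coe_injective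
        have hp0 : (p : K) ≠ 0 := by exact_mod_cast hp.ne_zero
        change (g ^ p - g) ^ k = p * ((g ^ p - g) ^ k / p)
        field_simp
      refine hPm.isPrime.mem_of_pow_mem k ?_
      rw [hb]
      exact P.mul_mem_right _ hpP

end

section

/-! ### Common eigenvectors of integral representations -/

section CommonEigenvector

theorem isIntegral_of_mulVec_eq {ι : Type*} [Fintype ι] [DecidableEq ι] (u : Matrix ι ι ℤ) {β : ℂ}
    {v : ι → ℂ} (hv : v ≠ 0) (h : (u.map (Int.castRingHom ℂ)).mulVec v = β • v) :
    IsIntegral ℤ β := by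
  refine ⟨u.charpoly, u.charpoly_monic, ?_⟩
  have h1 : (Matrix.scalar ι β - u.map (Int.castRingHom ℂ)).det = 0 := by
    refine Matrix.exists_mulVec_eq_zero_iff.1 ⟨v, hv, ?_⟩
    rw [Matrix.sub_mulVec, h]
    simp [Matrix.scalar_apply, ← Matrix.smul_one_eq_diagonal, Matrix.smul_mulVec]
  rw [← Matrix.eval_charpoly, Matrix.charpoly_map, Polynomial.eval_map] at h1
  exact h1

/-- An invertible integer matrix whose Frobenius is nilpotent modulo every prime has an
eigenvalue `1` or `-1`. -/
theorem exists_int_eigenvalue {ι : Type*} [Fintype ι] [DecidableEq ι] [Nonempty ι]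
    (m m' : Matrix ι ι ℤ) (hm : m' * m = 1)
    (h : ∀ p : ℕ, p.Prime → ∃ (k : ℕ) (u : Matrix ι ι ℤ), (m ^ p - m) ^ k = (p : ℤ) • u) :
    ∃ a : ℤ, (a = 1 ∨ a = -1) ∧ ∃ v : ι → ℤ, v ≠ 0 ∧ m.mulVec v = a • v := by
  let c : Matrix ι ι ℤ →+* Matrix ι ι ℂ := (Int.castRingHom ℂ).mapMatrix
  obtain ⟨α, hα⟩ := Module.End.exists_eigenvalue (Matrix.toLin' (c m))
  obtain ⟨v, hv⟩ := hα.exists_hasEigenvector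
  have hv0 : v ≠ 0 := hv.2
  have hmv : (c m).mulVec v = α • v := by simpa using hv.apply_eq_smul
  have hpow : ∀ j : ℕ, ((c m) ^ j).mulVec v = α ^ j • v := by
    intro j
    induction j with
    | zero => simp
    | succ j ih =>
      rw [pow_succ', ← Matrix.mulVec_mulVec, ih, Matrix.mulVec_smul, hmv, smul_smul, pow_succ]
  have hpow2 : ∀ p k : ℕ, ((c m ^ p - c m) ^ k).mulVec v = (α ^ p - α) ^ k • v := by
    intro p k
    induction k with
    | zero => simp
    | succ k ih =>
      rw [pow_succ', ← Matrix.mulVec_mulVec, ih, Matrix.mulVec_smul, Matrix.sub_mulVec, hpow,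
        hmv, ← sub_smul, smul_smul, pow_succ]
  have hint : IsIntegral ℤ α := isIntegral_of_mulVec_eq m hv0 hmv
  -- Applied to the eigenvector `v`, the relation (m^p - m)^k = pu shows that (α^p - α)^k / p is an
  -- eigenvalue of the integer matrix u, hence integral.
  obtain ⟨a, rfl⟩ := exists_int_eq_of_pow_sub_integral hint (by
    intro p hp
    obtain ⟨k, u, hu⟩ := h p hp
    refine ⟨k, isIntegral_of_mulVec_eq u hv0 ?_⟩
    have h1 := congrArg (fun x => (c x).mulVec v) hu
    simp only [map_pow, map_sub, hpow2] at h1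
    have h2 : c ((p : ℤ) • u) = (p : ℂ) • c u := by
      ext i j
      change ((((p : ℤ) • u) i j : ℤ) : ℂ) = (p : ℂ) * ((u i j : ℤ) : ℂ)
      rw [Matrix.smul_apply, smul_eq_mul, Int.cast_mul, Int.cast_natCast]
    rw [h2, Matrix.smul_mulVec] at h1
    have hp0 : (p : ℂ) ≠ 0 := by exact_mod_cast hp.ne_zero
    change (c u).mulVec v = _
    rw [div_eq_inv_mul, mul_smul, h1, smul_smul, inv_mul_cancel₀ hp0, one_smul])
  -- The inverse matrix has the eigenvalue 1/a on `v`, so 1/a is integral too and a is a unit of ℤ.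
  have hinv : (a : ℂ) • (c m').mulVec v = v := by
    rw [← Matrix.mulVec_smul, ← hmv, Matrix.mulVec_mulVec, ← map_mul, hm, map_one,
      Matrix.one_mulVec]
  have ha0 : (a : ℂ) ≠ 0 := by
    intro h0
    rw [h0, zero_smul] at hinv
    exact hv0 hinv.symm
  have hint' : IsIntegral ℤ ((a : ℂ)⁻¹) := by
    refine isIntegral_of_mulVec_eq m' hv0 ?_
    change (c m').mulVec v = _
    rw [← hinv, smul_smul, inv_mul_cancel₀ ha0, one_smul, hinv]
  have hint'' : IsIntegral ℤ ((a : ℚ)⁻¹) := by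
    refine (isIntegral_algebraMap_iff (algebraMap ℚ ℂ).injective).1 ?_
    simpa using hint'
  obtain ⟨b, hb⟩ := IsIntegrallyClosed.isIntegral_iff.1 hint''
  have ha0' : (a : ℚ) ≠ 0 := by exact_mod_cast ha0
  have hab : a * b = 1 := by
    have : (a : ℚ) * b = 1 := by
      have hb' : (b : ℚ) = (a : ℚ)⁻¹ := by simpa using hb
      rw [hb', mul_inv_cancel₀ ha0']
    exact_mod_cast this
  refine ⟨a, Int.isUnit_iff.1 (IsUnit.of_mul_eq_one _ hab), ?_⟩
  -- Since a is an integer, the eigenvalue equation is singular already over ℤ, which gives an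
  -- integral eigenvector.
  have hdet : (m - a • (1 : Matrix ι ι ℤ)).det = 0 := by
    have h1 : (c (m - a • (1 : Matrix ι ι ℤ))).det = 0 := by
      refine Matrix.exists_mulVec_eq_zero_iff.1 ⟨v, hv0, ?_⟩
      have h2 : c (a • (1 : Matrix ι ι ℤ)) = (a : ℂ) • 1 := by
        rw [map_zsmul, map_one, Int.cast_smul_eq_zsmul]
      rw [map_sub, Matrix.sub_mulVec, hmv, h2, Matrix.smul_mulVec, Matrix.one_mulVec, sub_self]
    rw [← RingHom.map_det] at h1
    have h2 : (((m - a • (1 : Matrix ι ι ℤ)).det : ℤ) : ℂ) = 0 := h1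
    exact_mod_cast h2
  obtain ⟨w, hw0, hw⟩ := Matrix.exists_mulVec_eq_zero_iff.2 hdet
  refine ⟨w, hw0, ?_⟩
  rw [Matrix.sub_mulVec, sub_eq_zero] at hw
  rw [hw, Matrix.smul_mulVec, Matrix.one_mulVec]

variable {M : Type*} [AddCommGroup M]

theorem exists_smul_mem_of_fg (W U : Submodule ℤ M) (hW : W.FG)
    (h : ∀ w ∈ W, ∃ k : ℤ, k ≠ 0 ∧ k • w ∈ U) : ∃ k : ℤ, k ≠ 0 ∧ ∀ w ∈ W, k • w ∈ U := by
  induction W, hW using Submodule.fg_induction with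
  | singleton x =>
    obtain ⟨k, hk, hx⟩ := h x (Submodule.mem_span_singleton_self x)
    refine ⟨k, hk, fun w hw => ?_⟩
    obtain ⟨a, rfl⟩ := Submodule.mem_span_singleton.1 hw
    rw [smul_comm]
    exact U.smul_mem a hx
  | sup W₁ W₂ _ _ h₁ h₂ =>
    obtain ⟨k₁, hk₁, h₁⟩ := h₁ fun w hw => h w (Submodule.mem_sup_left hw)
    obtain ⟨k₂, hk₂, h₂⟩ := h₂ fun w hw => h w (Submodule.mem_sup_right hw)
    refine ⟨k₁ * k₂, mul_ne_zero hk₁ hk₂, fun w hw => ?_⟩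
    obtain ⟨x, hx, y, hy, rfl⟩ := Submodule.mem_sup.1 hw
    rw [smul_add]
    refine U.add_mem ?_ ?_
    · rw [mul_comm, mul_smul]; exact U.smul_mem _ (h₁ x hx)
    · rw [mul_smul]; exact U.smul_mem _ (h₂ y hy)

variable [Module.Finite ℤ M] [Module.IsTorsionFree ℤ M]

/-- A nonzero `W` is free of positive rank, and a basis vector is not divisible by `p` in `W`. -/
theorem eq_bot_of_prime_divisible (W : Submodule ℤ M) {p : ℕ} (hp : p.Prime)
    (h : ∀ w ∈ W, ∃ y ∈ W, w = (p : ℤ) • y) : W = ⊥ := by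
  by_contra hW
  have : Nontrivial W := (Submodule.nontrivial_iff_ne_bot).2 hW
  let b := Module.Free.chooseBasis ℤ W
  obtain ⟨i⟩ := b.index_nonempty
  obtain ⟨y, hy, hb⟩ := h (b i) (b i).2
  have h1 : b i = (p : ℤ) • (⟨y, hy⟩ : W) := Subtype.ext hb
  have h2 := congrArg (fun x => b.repr x i) h1
  simp only [Module.Basis.repr_self, Finsupp.single_eq_same, map_smul, Finsupp.smul_apply,
    smul_eq_mul] at h2
  have h3 : (p : ℤ) ∣ 1 := ⟨_, h2⟩
  exact hp.one_lt.ne' (Nat.dvd_one.1 (by exact_mod_cast h3))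

variable {G : Type*} [Group G] (ρ : G →* Module.End ℤ M)

/-- If, for each prime `p`, the module `M / pM` has a finite filtration on whose factors a group
acts commutatively and through elements fixed by the Frobenius, then `M` contains a common
eigenvector with eigenvalues `1` and `-1`. -/
theorem exists_common_eigenvector [Nontrivial M]
    (h : ∀ p : ℕ, p.Prime → ∃ (n : ℕ) (F : ℕ → Submodule ℤ M),
      (∀ x, x ∈ F 0 ↔ ∃ y, x = (p : ℤ) • y) ∧ F n = ⊤ ∧ (∀ i < n, F i ≤ F (i + 1)) ∧
      (∀ i < n, ∀ x ∈ F (i + 1), ∀ g g' : G, ρ g (ρ g' x) - ρ g' (ρ g x) ∈ F i) ∧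
      ∀ i < n, ∀ x ∈ F (i + 1), ∀ g : G, (ρ g ^ p) x - ρ g x ∈ F i) :
    ∃ v : M, v ≠ 0 ∧ ∀ g, ρ g v = v ∨ ρ g v = -v := by
  -- Invariant, pure and nonzero submodules. One of least rank plays the part of an irreducible
  -- subrepresentation over ℚ.
  let Good : Submodule ℤ M → Prop := fun W =>
    (∀ g, ∀ x ∈ W, ρ g x ∈ W) ∧ (∀ (k : ℤ) x, k ≠ 0 → k • x ∈ W → x ∈ W) ∧ W ≠ ⊥
  have hex : ∃ n, ∃ W, Good W ∧ Module.finrank ℤ W = n :=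
    ⟨_, ⊤, ⟨fun _ _ _ => trivial, fun _ _ _ _ => trivial, top_ne_bot⟩, rfl⟩
  classical
  obtain ⟨W, hW, hWn⟩ := Nat.find_spec hex
  obtain ⟨hinv, hsat, hne⟩ := id hW
  have hmin : ∀ U : Submodule ℤ M, Good U → Module.finrank ℤ W ≤ Module.finrank ℤ U :=
    fun U hU => hWn ▸ Nat.find_min' hex ⟨U, hU, rfl⟩
  -- By minimality, the purification `U'` of a nonzero invariant `U` in `W` has the full rank of
  -- `W`, so W/U is torsion.
  have hess : ∀ U : Submodule ℤ M, U ≤ W → (∀ g, ∀ x ∈ U, ρ g x ∈ U) → U ≠ ⊥ →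
      ∀ w ∈ W, ∃ k : ℤ, k ≠ 0 ∧ k • w ∈ U := by
    intro U hUW hUinv hU0 w hw
    let U' : Submodule ℤ M :=
      { carrier := {x | ∃ k : ℤ, k ≠ 0 ∧ k • x ∈ U}
        zero_mem' := ⟨1, one_ne_zero, by simp⟩
        add_mem' := by
          rintro x y ⟨k, hk, hx⟩ ⟨l, hl, hy⟩
          refine ⟨k * l, mul_ne_zero hk hl, ?_⟩
          rw [smul_add]
          refine U.add_mem ?_ ?_
          · rw [mul_comm, mul_smul]; exact U.smul_mem _ hx
          · rw [mul_smul]; exact U.smul_mem _ hy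
        smul_mem' := by
          rintro c x ⟨k, hk, hx⟩
          exact ⟨k, hk, by rw [smul_comm]; exact U.smul_mem _ hx⟩ }
    have hUU' : U ≤ U' := fun x hx => ⟨1, one_ne_zero, by rwa [one_smul]⟩
    have hU'W : U' ≤ W := fun x ⟨k, hk, hx⟩ => hsat k x hk (hUW hx)
    have hgood : Good U' := by
      refine ⟨?_, ?_, fun h0 => hU0 (le_bot_iff.1 (h0 ▸ hUU'))⟩
      · rintro g x ⟨k, hk, hx⟩
        exact ⟨k, hk, by rw [← map_smul]; exact hUinv g _ hx⟩
      · rintro k x hk ⟨l, hl, hx⟩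
        exact ⟨l * k, mul_ne_zero hl hk, by rwa [mul_smul]⟩
    have h1 := hmin U' hgood
    have h2 := Submodule.finrank_quotient_add_finrank (U'.comap W.subtype)
    have h3 : Module.finrank ℤ (U'.comap W.subtype) = Module.finrank ℤ U' :=
      (Submodule.comapSubtypeEquivOfLe hU'W).finrank_eq
    have h4 : Module.finrank ℤ (W ⧸ U'.comap W.subtype) = 0 := by omega
    rw [Module.finrank_eq_zero_iff] at h4
    obtain ⟨k, hk, hkw⟩ := h4 (Submodule.Quotient.mk ⟨w, hw⟩)
    rw [← Submodule.Quotient.mk_smul, Submodule.Quotient.mk_eq_zero] at hkw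
    obtain ⟨l, hl, hlw⟩ := hkw
    refine ⟨l * k, mul_ne_zero hl hk, ?_⟩
    rw [mul_smul]
    exact hlw
  have hWfg : W.FG := IsNoetherian.noetherian W
  -- Suppose the action on `W` is not commutative. The span `C` of the values of commutators is
  -- invariant and nonzero, so NW lies in C for some N ≠ 0. A prime p > |N| then contradicts the
  -- filtration modulo p.
  have hcomm : ∀ g g' : G, ∀ w ∈ W, ρ g (ρ g' w) = ρ g' (ρ g w) := by
    by_contra hcon
    push Not at hcon
    obtain ⟨g₀, g₀', w₀, hw₀, hne₀⟩ := hcon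
    let C : Submodule ℤ M :=
      Submodule.span ℤ {x | ∃ g g' : G, ∃ w ∈ W, x = ρ g (ρ g' w) - ρ g' (ρ g w)}
    have hCW : C ≤ W := by
      refine Submodule.span_le.2 ?_
      rintro _ ⟨g, g', w, hw, rfl⟩
      exact W.sub_mem (hinv _ _ (hinv _ _ hw)) (hinv _ _ (hinv _ _ hw))
    have hCinv : ∀ g, ∀ x ∈ C, ρ g x ∈ C := by
      intro g x hx
      induction hx using Submodule.span_induction with
      | mem x hx =>
        obtain ⟨a, b, w, hw, rfl⟩ := hx
        -- Applying `ρ g` conjugates both group elements and moves the vector to `ρ g w`.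
        refine Submodule.subset_span ⟨g * a * g⁻¹, g * b * g⁻¹, ρ g w, hinv _ _ hw, ?_⟩
        rw [map_sub]
        have e : ∀ a b : G, g * a * g⁻¹ * (g * b * g⁻¹ * g) = g * (a * b) := by
          intros; group
        simp only [← Module.End.mul_apply, ← map_mul, e]
      | zero => rw [map_zero]; exact C.zero_mem
      | add x y _ _ hx hy => rw [map_add]; exact C.add_mem hx hy
      | smul c x _ hx => rw [map_smul]; exact C.smul_mem _ hx
    have hC0 : C ≠ ⊥ := by
      intro h0
      have : ρ g₀ (ρ g₀' w₀) - ρ g₀' (ρ g₀ w₀) ∈ C :=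
        Submodule.subset_span ⟨g₀, g₀', w₀, hw₀, rfl⟩
      rw [h0, Submodule.mem_bot, sub_eq_zero] at this
      exact hne₀ this
    obtain ⟨N, hN0, hN⟩ := exists_smul_mem_of_fg W C hWfg (hess C hCW hCinv hC0)
    obtain ⟨p, hpN, hp⟩ := Nat.exists_infinite_primes (N.natAbs + 1)
    have hcop : IsCoprime (N : ℤ) p := by
      rw [Int.isCoprime_iff_gcd_eq_one, Int.gcd_comm]
      change Nat.gcd p N.natAbs = 1
      refine (Nat.Prime.coprime_iff_not_dvd hp).2 fun hd => ?_
      have := Nat.le_of_dvd (Int.natAbs_pos.2 hN0) hd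
      omega
    obtain ⟨a, b, hab⟩ := hcop
    obtain ⟨n, F, hF0, hFn, hmono, hFc, -⟩ := h p hp
    have hF0i : ∀ i ≤ n, F 0 ≤ F i := by
      intro i hi
      induction i with
      | zero => exact le_rfl
      | succ i ih => exact (ih (by omega)).trans (hmono i (by omega))
    -- Descent through the filtration: if W lies in F (i + 1), then C lies in F i, and W = aNW + pbW
    -- lies in F i as well. At the bottom W lies in pM, so by purity W = pW.
    have hdesc : ∀ j ≤ n, W ≤ F (n - j) := by
      intro j hj
      induction j with
      | zero => simp [hFn]
      | succ j ih =>
        have ih := ih (by omega)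
        have hlt : n - (j + 1) < n := by omega
        have heq : n - (j + 1) + 1 = n - j := by omega
        have hC : C ≤ F (n - (j + 1)) := by
          refine Submodule.span_le.2 ?_
          rintro _ ⟨g, g', w, hw, rfl⟩
          exact hFc _ hlt w (heq ▸ ih hw) g g'
        intro w hw
        have : w = a • (N • w) + (p : ℤ) • (b • w) := by
          rw [smul_smul, smul_smul, ← add_smul, mul_comm (p : ℤ) b, hab, one_smul]
        rw [this]
        exact add_mem (Submodule.smul_mem _ _ (hC (hN w hw)))
          (hF0i _ (by omega) ((hF0 _).2 ⟨_, rfl⟩))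
    refine hne (eq_bot_of_prime_divisible W hp fun w hw => ?_)
    have hw0 := hdesc n le_rfl hw
    rw [Nat.sub_self] at hw0
    obtain ⟨y, rfl⟩ := (hF0 _).1 hw0
    exact ⟨y, hsat p y (by exact_mod_cast hp.ne_zero) hw, rfl⟩
  have : Nontrivial W := (Submodule.nontrivial_iff_ne_bot).2 hne
  let b := Module.Free.chooseBasis ℤ W
  have hι : Nonempty (Module.Free.ChooseBasisIndex ℤ W) := b.index_nonempty
  -- The matrix of `ρ g` on `W` satisfies the hypothesis of `exists_int_eigenvalue`: by the
  -- filtration, (φ^p - φ)^n maps W into pM, and by purity into pW.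
  have heig : ∀ g : G, ∃ a : ℤ, (a = 1 ∨ a = -1) ∧ ∃ w ∈ W, w ≠ 0 ∧ ρ g w = a • w := by
    intro g
    let φ : G → Module.End ℤ W := fun g => (ρ g).restrict (hinv g)
    have hφ : ∀ g w, ((φ g w : W) : M) = ρ g w := fun _ _ => rfl
    have hφp : ∀ (p : ℕ) w, ((φ g ^ p) w : W) = (ρ g ^ p) (w : M) := by
      intro p w
      induction p with
      | zero => rfl
      | succ p ih => rw [pow_succ', pow_succ', Module.End.mul_apply, Module.End.mul_apply, hφ, ih]
    obtain ⟨a, ha, v, hv0, hv⟩ := exists_int_eigenvalue (LinearMap.toMatrixAlgEquiv b (φ g))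
      (LinearMap.toMatrixAlgEquiv b (φ g⁻¹)) (by
        rw [← map_mul]
        have : φ g⁻¹ * φ g = 1 := by
          ext w
          rw [Module.End.mul_apply, hφ, hφ, ← Module.End.mul_apply, ← map_mul, inv_mul_cancel,
            map_one]
          rfl
        rw [this, map_one]) (by
        intro p hp
        obtain ⟨n, F, hF0, hFn, hmono, -, hFp⟩ := h p hp
        have hdesc : ∀ j ≤ n, ∀ w : W, (((φ g ^ p - φ g) ^ j) w : W) ∈ (F (n - j)).comap
            W.subtype := by
          intro j hj
          induction j with
          | zero => simp [hFn]
          | succ j ih =>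
            intro w
            have ih := ih (by omega) w
            have hlt : n - (j + 1) < n := by omega
            have heq : n - (j + 1) + 1 = n - j := by omega
            rw [pow_succ', Module.End.mul_apply, LinearMap.sub_apply, Submodule.mem_comap,
              Submodule.subtype_apply, AddSubgroupClass.coe_sub, hφ, hφp]
            exact hFp _ hlt _ (heq ▸ ih) g
        have hdiv : ∀ w : W, ∃ y : W, ((φ g ^ p - φ g) ^ n) w = (p : ℤ) • y := by
          intro w
          have h1 := hdesc n le_rfl w
          rw [Nat.sub_self] at h1
          obtain ⟨y, hy⟩ := (hF0 _).1 h1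
          change (((φ g ^ p - φ g) ^ n) w : M) = _ at hy
          refine ⟨⟨y, hsat p y (by exact_mod_cast hp.ne_zero) ?_⟩, Subtype.ext hy⟩
          rw [← hy]
          exact Subtype.mem _
        choose y hy using hdiv
        refine ⟨n, Matrix.of fun i j => b.repr (y (b j)) i, ?_⟩
        rw [← map_pow, ← map_sub, ← map_pow]
        ext i j
        rw [LinearMap.toMatrixAlgEquiv_apply, hy]
        simp)
    have hv' : Matrix.mulVec (LinearMap.toMatrixAlgEquiv b (φ g)) (b.repr (b.equivFun.symm v)) =
        b.repr (φ g (b.equivFun.symm v)) := LinearMap.toMatrix_mulVec_repr b b _ _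
    refine ⟨a, ha, b.equivFun.symm v, Subtype.mem _, ?_, ?_⟩
    · exact fun h0 => hv0 (b.equivFun.symm.map_eq_zero_iff.1 (Subtype.ext h0))
    · have h1 : φ g (b.equivFun.symm v) = a • b.equivFun.symm v := by
        apply b.equivFun.injective
        rw [map_smul, LinearEquiv.apply_symm_apply, ← hv]
        have h2 : (b.repr (b.equivFun.symm v) : _ → ℤ) = v := by
          rw [← Module.Basis.equivFun_apply, LinearEquiv.apply_symm_apply]
        rw [h2] at hv'
        rw [hv', Module.Basis.equivFun_apply]
      rw [← hφ, h1]
      rfl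
  obtain ⟨v, hv, hv0⟩ := Submodule.exists_mem_ne_zero_of_ne_bot hne
  refine ⟨v, hv0, fun g => ?_⟩
  obtain ⟨a, ha, w, hw, hw0, hgw⟩ := heig g
  -- By commutativity this eigenspace is invariant under the whole group, so it contains a nonzero
  -- multiple of `v`, and `v` itself because M is torsion-free. Hence every nonzero vector of `W` is
  -- a common eigenvector.
  let U : Submodule ℤ M := W ⊓ LinearMap.ker (ρ g - a • LinearMap.id)
  have hU : ∀ x, x ∈ U ↔ x ∈ W ∧ ρ g x = a • x := by
    intro x
    rw [Submodule.mem_inf, LinearMap.mem_ker, LinearMap.sub_apply, sub_eq_zero]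
    rfl
  obtain ⟨k, hk, hkv⟩ := hess U inf_le_left (by
    intro g' x hx
    rw [hU] at hx ⊢
    refine ⟨hinv _ _ hx.1, ?_⟩
    rw [hcomm g g' x hx.1, hx.2, map_smul]) (by
    intro h0
    have : w ∈ U := (hU w).2 ⟨hw, hgw⟩
    rw [h0] at this
    exact hw0 this) v hv
  have h1 := ((hU _).1 hkv).2
  rw [map_smul, smul_comm] at h1
  have h2 : ρ g v = a • v := smul_right_injective M hk h1
  rcases ha with rfl | rfl
  · left; simpa using h2
  · right; simpa using h2

end CommonEigenvector

end

/-! ### Elementary theory of skew braces and their ideals -/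

section

namespace SkewBrace

variable {B : Type u} [SkewBrace B]

theorem lam_add (a b c : B) : lam a (b + c) = lam a b + lam a c := by
  simp only [lam, mul_add_eq, sub_eq_add_neg, add_assoc]

theorem lam_zero_right (a : B) : lam a 0 = 0 := by simp [lam, mul_zero']

theorem lam_zero_left (b : B) : lam 0 b = b := by rw [← one_eq_zero, lam_one]

/-- The additive endomorphism `λ_a`. -/
def lamHom (a : B) : B →+ B where
  toFun := lam a
  map_zero' := lam_zero_right a
  map_add' := lam_add a

theorem lam_neg (a b : B) : lam a (-b) = -lam a b := (lamHom a).map_neg b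

theorem lam_zsmul (a : B) (k : ℤ) (b : B) : lam a (k • b) = k • lam a b := (lamHom a).map_zsmul k b

theorem lam_nsmul (a : B) (k : ℕ) (b : B) : lam a (k • b) = k • lam a b := (lamHom a).map_nsmul k b

theorem lam_inv_lam (a b : B) : lam a⁻¹ (lam a b) = b := by
  rw [← lam_mul, inv_mul_cancel, lam_one]

theorem lam_lam_inv (a b : B) : lam a (lam a⁻¹ b) = b := by
  rw [← lam_mul, mul_inv_cancel, lam_one]

theorem inv_eq_neg_lam (a : B) : a⁻¹ = -lam a⁻¹ a := by
  have h : a⁻¹ + lam a⁻¹ a = 0 := by rw [← mul_eq, inv_mul_cancel, one_eq_zero]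
  exact eq_neg_of_add_eq_zero_left h

theorem lam_inv_self (a : B) : lam a a⁻¹ = -a := by
  rw [inv_eq_neg_lam, lam_neg, lam_lam_inv]

/-- A multiplicative conjugate is an additive conjugate of λ_b(a) plus λ_b of an element -c +
λ_a(c). This makes multiplicative normality a consequence of the three conditions in `ofAdd`. -/
theorem mul_mul_inv_eq (b a : B) :
    b * a * b⁻¹ = b + lam b a - b + lam b (-b⁻¹ + lam a b⁻¹) := by
  rw [lam_add, lam_neg, lam_inv_self, mul_assoc, mul_eq b, mul_eq a, lam_add, ← lam_mul]
  simp [sub_eq_add_neg, add_assoc]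

/-- The action of `(B, *)` on `(B, +)` by `λ`. -/
def lamAct (B : Type u) [SkewBrace B] : B →* Equiv.Perm B where
  toFun a := ⟨lam a, lam a⁻¹, lam_inv_lam a, lam_lam_inv a⟩
  map_one' := Equiv.ext lam_one
  map_mul' a b := Equiv.ext (lam_mul a b)

theorem mul_eq_add_of_mem_socle {a : B} (ha : a ∈ socle B) (b : B) : a * b = a + b := by
  rw [mul_eq, ha.1]

/-- Converts λ into multiplicative conjugation; since Ker λ is normal, this gives the λ-invariance
of the socle. -/
theorem lam_eq_conj_of_mem_socle {a : B} (ha : a ∈ socle B) (b : B) : lam b a = b * a * b⁻¹ := by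
  rw [mul_assoc, mul_eq_add_of_mem_socle ha, ha.2, mul_add_eq, mul_inv_cancel, one_eq_zero,
    zero_sub, lam]

end SkewBrace

namespace BraceHom

open SkewBrace

variable {A : Type u} {B : Type v} [SkewBrace A] [SkewBrace B] (f : BraceHom A B)

/-- The underlying additive homomorphism. -/
def toAdd : A →+ B := AddMonoidHom.mk' f.toFun f.map_add'

theorem map_zero : f.toFun 0 = 0 := f.toAdd.map_zero

theorem map_one : f.toFun 1 = 1 := by rw [one_eq_zero, one_eq_zero, f.map_zero]

/-- The underlying multiplicative homomorphism. -/
def toMul : A →* B := MonoidHom.mk' f.toFun f.map_mul'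

theorem map_neg (a : A) : f.toFun (-a) = -f.toFun a := f.toAdd.map_neg a

theorem map_sub (a b : A) : f.toFun (a - b) = f.toFun a - f.toFun b := f.toAdd.map_sub a b

theorem map_zsmul (k : ℤ) (a : A) : f.toFun (k • a) = k • f.toFun a := f.toAdd.map_zsmul k a

theorem map_nsmul (k : ℕ) (a : A) : f.toFun (k • a) = k • f.toFun a := f.toAdd.map_nsmul k a

theorem map_inv (a : A) : f.toFun a⁻¹ = (f.toFun a)⁻¹ := f.toMul.map_inv a

theorem map_lam (a b : A) : f.toFun (lam a b) = lam (f.toFun a) (f.toFun b) := by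
  simp only [lam, f.map_add', f.map_neg, f.map_mul']

theorem map_eval {X : Type*} (b : X → A) (w : BWord X) :
    f.toFun (w.eval b) = w.eval (fun x => f.toFun (b x)) := by
  induction w with
  | empty => exact f.map_zero
  | of x => rfl
  | add w₁ w₂ h₁ h₂ => simp only [BWord.eval, f.map_add', h₁, h₂]
  | mul w₁ w₂ h₁ h₂ => simp only [BWord.eval, f.map_mul', h₁, h₂]
  | neg w h => simp only [BWord.eval, f.map_neg, h]
  | inv w h => simp only [BWord.eval, f.map_inv, h]

end BraceHom

namespace BraceIdeal

open SkewBrace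

variable {A : Type v} [SkewBrace A] {B : Type u} [SkewBrace B]

theorem mem_carrier {I : BraceIdeal B} {x : B} : x ∈ I.carrier ↔ x ∈ I := Iff.rfl

@[ext]
theorem ext {I J : BraceIdeal B} (h : ∀ x, x ∈ I ↔ x ∈ J) : I = J := by
  have h' : I.toAddSubgroup = J.toAddSubgroup := AddSubgroup.ext h
  cases I
  cases J
  simp only at h'
  subst h'
  rfl

/-- An additive subgroup which is normal, `λ`-invariant, and whose elements act trivially modulo
it, is an ideal. -/
def ofAdd (T : AddSubgroup B) (hl : ∀ b, ∀ t ∈ T, lam b t ∈ T) (hc : ∀ b, ∀ t ∈ T, b + t - b ∈ T)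
    (hs : ∀ b, ∀ t ∈ T, -b + lam t b ∈ T) : BraceIdeal B where
  toAddSubgroup := T
  one_mem' := by rw [one_eq_zero]; exact T.zero_mem
  mul_mem' {a b} ha hb := by rw [mul_eq]; exact T.add_mem ha (hl a b hb)
  inv_mem' {a} ha := by rw [inv_eq_neg_lam]; exact T.neg_mem (hl _ _ ha)
  lam_mem' b a ha := hl b a ha
  add_conj_mem' b a ha := hc b a ha
  mul_conj_mem' b a ha := by
    rw [mul_mul_inv_eq]
    exact T.add_mem (hc _ _ (hl _ _ ha)) (hl _ _ (hs _ _ ha))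

/-- The zero ideal. -/
def zero (B : Type u) [SkewBrace B] : BraceIdeal B :=
  ofAdd ⊥ (fun b t ht => by rw [AddSubgroup.mem_bot] at *; rw [ht, lam_zero_right])
    (fun b t ht => by rw [AddSubgroup.mem_bot] at *; simp [ht])
    (fun b t ht => by rw [AddSubgroup.mem_bot] at *; rw [ht, lam_zero_left, neg_add_cancel])

theorem mem_zero {x : B} : x ∈ zero B ↔ x = 0 := Iff.rfl

/-- The socle, as an ideal. -/
def socle (B : Type u) [SkewBrace B] : BraceIdeal B :=
  ofAdd
    { carrier := SkewBrace.socle B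
      zero_mem' := ⟨lam_zero_left, fun b => by simp⟩
      add_mem' := by
        intro a b ha hb
        refine ⟨fun c => ?_, fun c => ?_⟩
        · rw [← mul_eq_add_of_mem_socle ha, lam_mul, hb.1, ha.1]
        · rw [add_assoc, hb.2, ← add_assoc, ha.2, add_assoc]
      neg_mem' := by
        intro a ha
        -- Once the negative is known to be the multiplicative inverse, λ_{-a} is the inverse of the
        -- identity λ_a.
        have h : -a = a⁻¹ := by
          rw [eq_inv_iff_mul_eq_one, mul_eq, one_eq_zero]
          have h2 : (-a) = a⁻¹ := by
            rw [← mul_right_inj a, mul_eq_add_of_mem_socle ha, mul_inv_cancel, one_eq_zero,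
              add_neg_cancel]
          have h3 : lam (-a) a = a := by
            conv_lhs => rw [h2]
            nth_rw 2 [← ha.1 a]
            rw [lam_inv_lam]
          rw [h3, neg_add_cancel]
        refine ⟨fun b => ?_, fun b => ?_⟩
        · rw [h]
          nth_rw 1 [← ha.1 b]
          rw [lam_inv_lam]
        · rw [neg_add_eq_iff_eq_add, ← add_assoc, ha.2, add_neg_cancel_right] }
    (fun b a (ha : a ∈ SkewBrace.socle B) => by
      refine ⟨fun c => ?_, fun c => ?_⟩
      · rw [lam_eq_conj_of_mem_socle ha, lam_mul, lam_mul, ha.1, lam_lam_inv]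
      · have := congrArg (lam b) (ha.2 (lam b⁻¹ c))
        rwa [lam_add, lam_add, lam_lam_inv] at this)
    (fun b a (ha : a ∈ SkewBrace.socle B) => by
      rw [← ha.2, add_sub_cancel_right]; exact ha)
    (fun b a (ha : a ∈ SkewBrace.socle B) => by
      rw [ha.1, neg_add_cancel]
      exact ⟨lam_zero_left, fun b => by simp⟩)

/-- The preimage of an ideal. -/
def comap (f : BraceHom A B) (K : BraceIdeal B) : BraceIdeal A where
  toAddSubgroup := K.toAddSubgroup.comap f.toAdd
  one_mem' := by
    change f.toFun 1 ∈ K.carrier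
    rw [f.map_one]; exact K.one_mem'
  mul_mem' {a b} ha hb := by
    change f.toFun _ ∈ K.carrier
    rw [f.map_mul']; exact K.mul_mem' ha hb
  inv_mem' {a} ha := by
    change f.toFun _ ∈ K.carrier
    rw [f.map_inv]; exact K.inv_mem' ha
  lam_mem' b a ha := by
    change f.toFun _ ∈ K.carrier
    rw [f.map_lam]; exact K.lam_mem' _ ha
  add_conj_mem' b a ha := by
    change f.toFun _ ∈ K.carrier
    rw [f.map_sub, f.map_add']; exact K.add_conj_mem' _ ha
  mul_conj_mem' b a ha := by
    change f.toFun _ ∈ K.carrier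
    rw [f.map_mul', f.map_mul', f.map_inv]; exact K.mul_conj_mem' _ ha

/-- The image of an ideal under a surjective homomorphism. -/
def map (f : BraceHom A B) (hf : Function.Surjective f.toFun) (K : BraceIdeal A) :
    BraceIdeal B where
  toAddSubgroup := K.toAddSubgroup.map f.toAdd
  one_mem' := ⟨1, K.one_mem', f.map_one⟩
  mul_mem' := by
    rintro _ _ ⟨a, ha, rfl⟩ ⟨b, hb, rfl⟩
    exact ⟨a * b, K.mul_mem' ha hb, f.map_mul' a b⟩
  inv_mem' := by
    rintro _ ⟨a, ha, rfl⟩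
    exact ⟨a⁻¹, K.inv_mem' ha, f.map_inv a⟩
  lam_mem' := by
    rintro b _ ⟨a, ha, rfl⟩
    obtain ⟨b, rfl⟩ := hf b
    exact ⟨lam b a, K.lam_mem' b ha, f.map_lam b a⟩
  add_conj_mem' := by
    rintro b _ ⟨a, ha, rfl⟩
    obtain ⟨b, rfl⟩ := hf b
    exact ⟨b + a - b, K.add_conj_mem' b ha, by
      change f.toFun _ = f.toFun _ + f.toFun _ - f.toFun _
      rw [f.map_sub, f.map_add']⟩
  mul_conj_mem' := by
    rintro b _ ⟨a, ha, rfl⟩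
    obtain ⟨b, rfl⟩ := hf b
    exact ⟨b * a * b⁻¹, K.mul_conj_mem' b ha, by
      change f.toFun _ = f.toFun _ * f.toFun _ * (f.toFun _)⁻¹
      rw [f.map_mul', f.map_mul', f.map_inv]⟩

/-- The projection onto the quotient brace. -/
def projHom (I : BraceIdeal B) : BraceHom B I.Quot where
  toFun := I.proj
  map_add' := I.proj.map_add
  map_mul' := I.proj_mul

theorem proj_lam (I : BraceIdeal B) (a b : B) : I.proj (lam a b) = lam (I.proj a) (I.proj b) :=
  I.projHom.map_lam a b

theorem proj_eq_zero (I : BraceIdeal B) {x : B} : I.proj x = 0 ↔ x ∈ I := by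
  rw [eq_comm, ← map_zero I.proj, proj_eq, neg_zero, zero_add]
  rfl

theorem add_mem (I : BraceIdeal B) {x y : B} (hx : x ∈ I) (hy : y ∈ I) : x + y ∈ I :=
  I.toAddSubgroup.add_mem hx hy

theorem neg_mem (I : BraceIdeal B) {x : B} (hx : x ∈ I) : -x ∈ I := I.toAddSubgroup.neg_mem hx

theorem zsmul_mem (I : BraceIdeal B) {x : B} (hx : x ∈ I) (k : ℤ) : k • x ∈ I :=
  I.toAddSubgroup.zsmul_mem hx k

theorem star_mem (I : BraceIdeal B) {t : B} (ht : t ∈ I) (b : B) : -b + lam t b ∈ I := by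
  rw [← proj_eq_zero, map_add, map_neg, proj_lam, I.proj_eq_zero.2 ht, lam_zero_left,
    neg_add_cancel]

/-- The kernel of a homomorphism. -/
def ker (f : BraceHom A B) : BraceIdeal A := comap f (zero B)

theorem mem_ker {f : BraceHom A B} {x : A} : x ∈ ker f ↔ f.toFun x = 0 := Iff.rfl

theorem span_le {S : Set B} {I : BraceIdeal B} (h : ∀ x ∈ S, x ∈ I) {x : B} (hx : x ∈ span S) :
    x ∈ I := hx I h

theorem subset_span {S : Set B} {x : B} (hx : x ∈ S) : x ∈ span S := fun _ h => h hx

/-- The ideal of multiples of a socle element which spans a `λ`-invariant subgroup. -/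
def zmultiples {c : B} (hc : c ∈ SkewBrace.socle B)
    (hl : ∀ b, lam b c ∈ AddSubgroup.zmultiples c) (m : ℤ) : BraceIdeal B :=
  have hm : ∀ t ∈ AddSubgroup.zmultiples (m • c), t ∈ SkewBrace.socle B := by
    intro t ht
    obtain ⟨k, rfl⟩ := AddSubgroup.mem_zmultiples_iff.1 ht
    exact (socle B).zsmul_mem ((socle B).zsmul_mem hc m) k
  ofAdd (AddSubgroup.zmultiples (m • c))
    (fun b t ht => by
      obtain ⟨k, rfl⟩ := AddSubgroup.mem_zmultiples_iff.1 ht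
      obtain ⟨l, hl⟩ := AddSubgroup.mem_zmultiples_iff.1 (hl b)
      refine AddSubgroup.mem_zmultiples_iff.2 ⟨l * k, ?_⟩
      rw [lam_zsmul, lam_zsmul, ← hl, smul_smul, smul_smul, smul_smul]
      congr 1
      ring)
    (fun b t ht => by rw [← (hm t ht).2, add_sub_cancel_right]; exact ht)
    (fun b t ht => by
      rw [(hm t ht).1, neg_add_cancel]
      exact AddSubgroup.zero_mem _)

end BraceIdeal

end

/-! ### A relaxed form of supersolubility -/

section

namespace BraceIdeal

open SkewBrace

variable {B : Type u} [SkewBrace B]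

/-- The factor `J' / J` is cyclic, and lies in the socle of `B / J` or has order dividing a
prime. -/
def Step (J J' : BraceIdeal B) : Prop :=
  (∀ x ∈ J, x ∈ J') ∧ ∃ c ∈ J', (∀ x ∈ J', ∃ k : ℤ, J.proj x = k • J.proj c) ∧
    (J.proj c ∈ SkewBrace.socle J.Quot ∨ ∃ p : ℕ, p.Prime ∧ p • J.proj c = 0)

/-- The brace `B / J` is supersoluble. -/
inductive Up : BraceIdeal B → Prop
  | top (J) (h : ∀ x, x ∈ J) : Up J
  | step (J J') (h : Step J J') (h' : Up J') : Up J

/-- The condition on consecutive ideals in the definition of supersolubility. -/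
def SFactor (J J' : BraceIdeal B) : Prop :=
  J.carrier ⊆ J'.carrier ∧
    ((IsAddCyclic (J.factor J') ∧ Infinite (J.factor J') ∧
      (J.factor J' : Set J.Quot) ⊆ SkewBrace.socle J.Quot) ∨ (Nat.card (J.factor J')).Prime)

theorem mem_factor {J J' : BraceIdeal B} {x : J.Quot} :
    x ∈ J.factor J' ↔ ∃ y ∈ J', J.proj y = x := Iff.rfl

theorem SFactor.step {J J' : BraceIdeal B} (h : SFactor J J') : Step J J' := by
  obtain ⟨hle, h⟩ := h
  have hcyc : IsAddCyclic (J.factor J') := by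
    rcases h with h | h
    · exact h.1
    · have : Fact (Nat.card (J.factor J')).Prime := ⟨h⟩
      exact isAddCyclic_of_prime_card rfl
  obtain ⟨⟨g, hg⟩, hgen⟩ := hcyc.exists_generator
  obtain ⟨c, hc, rfl⟩ := mem_factor.1 hg
  refine ⟨hle, c, hc, fun x hx => ?_, ?_⟩
  · obtain ⟨k, hk⟩ := AddSubgroup.mem_zmultiples_iff.1 (hgen ⟨J.proj x, mem_factor.2 ⟨x, hx, rfl⟩⟩)
    exact ⟨k, (congrArg Subtype.val hk).symm⟩
  · rcases h with h | h
    · exact Or.inl (h.2.2 hg)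
    · refine Or.inr ⟨_, h, ?_⟩
      exact congrArg Subtype.val (card_nsmul_eq_zero' (x := (⟨J.proj c, hg⟩ : J.factor J')))

theorem factor_eq_zmultiples {J J' : BraceIdeal B} {c : B} (hc : c ∈ J')
    (hgen : ∀ x ∈ J', ∃ k : ℤ, J.proj x = k • J.proj c) :
    J.factor J' = AddSubgroup.zmultiples (J.proj c) := by
  ext x
  rw [mem_factor, AddSubgroup.mem_zmultiples_iff]
  constructor
  · rintro ⟨y, hy, rfl⟩
    obtain ⟨k, hk⟩ := hgen y hy
    exact ⟨k, hk.symm⟩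
  · rintro ⟨k, rfl⟩
    exact ⟨k • c, J'.zsmul_mem hc k, map_zsmul _ _ _⟩

theorem eq_or_sFactor_of_prime {J J' : BraceIdeal B} (hle : ∀ x ∈ J, x ∈ J') {c : B}
    (hc : c ∈ J') (hgen : ∀ x ∈ J', ∃ k : ℤ, J.proj x = k • J.proj c) {p : ℕ} (hp : p.Prime)
    (h : p • J.proj c = 0) : J = J' ∨ SFactor J J' := by
  rcases (Nat.dvd_prime hp).1 (addOrderOf_dvd_of_nsmul_eq_zero h) with h1 | h1
  · left
    rw [AddMonoid.addOrderOf_eq_one_iff] at h1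
    ext x
    refine ⟨hle x, fun hx => ?_⟩
    obtain ⟨k, hk⟩ := hgen x hx
    rw [← J.proj_eq_zero, hk, h1, smul_zero]
  · right
    refine ⟨hle, Or.inr ?_⟩
    rw [factor_eq_zmultiples hc hgen, Nat.card_zmultiples, h1]
    exact hp

open Relation

/-- Subgroups of a λ-invariant cyclic subgroup of the socle are ideals. With p the least prime
factor of m, the multiples of pc give an intermediate ideal `J₁`: the factor J₁/J is killed by m/p,
which permits induction, and J'/J₁ is killed by p. -/
theorem reflTransGen_of_socle (J : BraceIdeal B) (m : ℕ) (hm : 0 < m) :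
    ∀ J' : BraceIdeal B, (∀ x ∈ J, x ∈ J') → ∀ c ∈ J',
      (∀ x ∈ J', ∃ k : ℤ, J.proj x = k • J.proj c) → J.proj c ∈ SkewBrace.socle J.Quot →
      m • J.proj c = 0 → ReflTransGen SFactor J J' := by
  induction m using Nat.strong_induction_on with
  | _ m ih =>
  intro J' hle c hc hgen hsoc hmc
  rcases Nat.lt_or_ge 1 m with h1 | h1
  · set p := m.minFac with hp
    have hpp : p.Prime := Nat.minFac_prime h1.ne'
    have hl : ∀ b, lam b (J.proj c) ∈ AddSubgroup.zmultiples (J.proj c) := by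
      intro b
      obtain ⟨b, rfl⟩ := J.proj_surjective b
      obtain ⟨k, hk⟩ := hgen _ (J'.lam_mem' b hc)
      rw [← proj_lam, hk]
      exact AddSubgroup.zsmul_mem_zmultiples _ _
    let J₁ : BraceIdeal B := comap J.projHom (zmultiples hsoc hl p)
    have hJ₁ : ∀ x, x ∈ J₁ ↔ ∃ k : ℤ, J.proj x = k • J.proj (p • c) := by
      intro x
      change J.proj x ∈ AddSubgroup.zmultiples ((p : ℤ) • J.proj c) ↔ _
      rw [AddSubgroup.mem_zmultiples_iff, map_nsmul, natCast_zsmul]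
      simp only [eq_comm]
    have hle₁ : ∀ x ∈ J, x ∈ J₁ := fun x hx =>
      (hJ₁ x).2 ⟨0, by rw [zero_smul, J.proj_eq_zero.2 hx]⟩
    have hpc : p • c ∈ J₁ := (hJ₁ _).2 ⟨1, by rw [one_smul]⟩
    have hle₂ : ∀ x ∈ J₁, x ∈ J' := by
      intro x hx
      obtain ⟨k, hk⟩ := (hJ₁ x).1 hx
      rw [← map_zsmul, proj_eq] at hk
      have h2 : k • p • c ∈ J' := by
        rw [← natCast_zsmul]
        exact J'.zsmul_mem (J'.zsmul_mem hc _) _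
      have h3 := J'.add_mem h2 (J'.neg_mem (hle _ hk))
      simpa using h3
    have hdiv : p * (m / p) = m := Nat.mul_div_cancel' (Nat.minFac_dvd m)
    have hd0 : 0 < m / p := Nat.div_pos (Nat.minFac_le hm) hpp.pos
    have hstep := ih (m / p) (Nat.div_lt_self hm hpp.one_lt) hd0 J₁ hle₁ (p • c) hpc
      (fun x hx => (hJ₁ x).1 hx) (by
        rw [map_nsmul, ← natCast_zsmul]
        exact (socle J.Quot).zsmul_mem hsoc _) (by
        rw [map_nsmul, ← mul_nsmul, hdiv, hmc])
    have hgen₁ : ∀ x ∈ J', ∃ k : ℤ, J₁.proj x = k • J₁.proj c := by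
      intro x hx
      obtain ⟨k, hk⟩ := hgen x hx
      rw [← map_zsmul, proj_eq] at hk
      refine ⟨k, ?_⟩
      rw [← map_zsmul, proj_eq]
      exact hle₁ _ hk
    rcases eq_or_sFactor_of_prime hle₂ hc hgen₁ hpp
      (by rw [← map_nsmul, J₁.proj_eq_zero]; exact hpc) with h2 | h2
    · exact h2 ▸ hstep
    · exact hstep.tail h2
  · have hm1 : m = 1 := by omega
    rw [hm1, one_nsmul] at hmc
    have : J = J' := by
      ext x
      refine ⟨hle x, fun hx => ?_⟩
      obtain ⟨k, hk⟩ := hgen x hx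
      rw [← J.proj_eq_zero, hk, hmc, smul_zero]
    rw [this]

/-- `Step` also admits trivial factors and finite cyclic socle factors of composite order. The
former are dropped and the latter refined to factors of prime order. -/
theorem Step.reflTransGen {J J' : BraceIdeal B} (h : Step J J') : ReflTransGen SFactor J J' := by
  obtain ⟨hle, c, hc, hgen, hsoc | ⟨p, hp, hpc⟩⟩ := h
  · by_cases hfin : IsOfFinAddOrder (J.proj c)
    · obtain ⟨m, hm, hmc⟩ := isOfFinAddOrder_iff_nsmul_eq_zero.1 hfin
      exact reflTransGen_of_socle J m hm J' hle c hc hgen hsoc hmc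
    · refine ReflTransGen.single ⟨hle, Or.inl ?_⟩
      rw [factor_eq_zmultiples hc hgen]
      refine ⟨inferInstance, (infinite_zmultiples.2 hfin).to_subtype, ?_⟩
      rintro _ ⟨k, rfl⟩
      exact (socle J.Quot).zsmul_mem hsoc k
  · rcases eq_or_sFactor_of_prime hle hc hgen hp hpc with h | h
    · rw [h]
    · exact ReflTransGen.single h

theorem exists_chain_of_reflTransGen {α : Type*} {r : α → α → Prop} {a b : α}
    (h : ReflTransGen r a b) :
    ∃ (n : ℕ) (I : ℕ → α), I 0 = a ∧ I n = b ∧ ∀ i < n, r (I i) (I (i + 1)) := by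
  induction h using ReflTransGen.head_induction_on with
  | refl => exact ⟨0, fun _ => b, rfl, rfl, fun i hi => absurd hi (Nat.not_lt_zero i)⟩
  | @head x y h _ ih =>
    obtain ⟨n, I, h0, hn, hI⟩ := ih
    refine ⟨n + 1, fun i => Nat.casesOn i x I, rfl, hn, fun i hi => ?_⟩
    cases i with
    | zero => simpa [h0] using h
    | succ i => exact hI i (by omega)

theorem Up.reflTransGen {J : BraceIdeal B} (h : Up J) :
    ∃ J', (∀ x, x ∈ J') ∧ ReflTransGen SFactor J J' := by
  induction h with
  | top J h => exact ⟨J, h, ReflTransGen.refl⟩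
  | step J J' h _ ih =>
    obtain ⟨K, hK, hr⟩ := ih
    exact ⟨K, hK, h.reflTransGen.trans hr⟩

-- With `Up`, a chain is extended downwards by one step at a time, and degenerate steps need no
-- separate treatment. This matters for maximality arguments and for images of chains.
variable (B) in
theorem isSupersoluble_iff_up : IsSupersoluble B ↔ Up (zero B) := by
  constructor
  · rintro ⟨n, I, h0, hn, h⟩
    have h1 : ∀ j ≤ n, Up (I (n - j)) := by
      intro j hj
      induction j with
      | zero => exact Up.top _ fun x => by rw [← mem_carrier, Nat.sub_zero, hn]; trivial
      | succ j ih =>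
        refine Up.step _ _ ?_ (ih (by omega))
        have h2 := SFactor.step (h (n - (j + 1)) (by omega))
        rwa [show n - (j + 1) + 1 = n - j by omega] at h2
    have h2 := h1 n le_rfl
    rw [Nat.sub_self] at h2
    have h3 : I 0 = zero B := by
      ext x
      rw [← mem_carrier, h0]
      rfl
    rwa [h3] at h2
  · intro h
    obtain ⟨J, hJ, hr⟩ := h.reflTransGen
    obtain ⟨n, I, h0, hn, hI⟩ := exists_chain_of_reflTransGen hr
    exact ⟨n, I, by rw [h0]; rfl, by rw [hn]; exact Set.eq_univ_of_forall hJ, hI⟩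

end BraceIdeal

end

/-! ### Finite generation, and almost polycyclic chains in terms of elements -/

section

section FinitelyGenerated

variable {G Q : Type*} [AddGroup G] [AddGroup Q]

theorem AddSubgroup.FG.map_hom {H : AddSubgroup G} (hH : H.FG) (f : G →+ Q) : (H.map f).FG := by
  classical
  obtain ⟨S, rfl⟩ := hH
  exact ⟨S.image f, by rw [Finset.coe_image, AddMonoidHom.map_closure]⟩

theorem AddSubgroup.fg_of_finite {H : AddSubgroup G} (hH : (H : Set G).Finite) : H.FG :=
  ⟨hH.toFinset, by rw [Set.Finite.coe_toFinset, AddSubgroup.closure_eq]⟩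

theorem AddSubgroup.fg_of_ker_of_map (f : G →+ Q) {H : AddSubgroup G} (h₁ : (H ⊓ f.ker).FG)
    (h₂ : (H.map f).FG) : H.FG := by
  classical
  obtain ⟨S, hS⟩ := h₁
  obtain ⟨T, hT⟩ := h₂
  have hTH : ∀ t ∈ T, ∃ x ∈ H, f x = t := fun t ht => by
    have : t ∈ H.map f := hT ▸ AddSubgroup.subset_closure ht
    exact this
  choose! g hgH hg using hTH
  refine ⟨S ∪ T.image g, le_antisymm ?_ ?_⟩
  · rw [AddSubgroup.closure_le]
    intro x hx
    rcases Finset.mem_union.1 hx with hx | hx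
    · have : x ∈ H ⊓ f.ker := hS ▸ AddSubgroup.subset_closure hx
      exact this.1
    · obtain ⟨t, ht, rfl⟩ := Finset.mem_image.1 hx
      exact hgH t ht
  · intro x hx
    set K := AddSubgroup.closure ((S ∪ T.image g : Finset G) : Set G) with hK
    have hle : H ⊓ f.ker ≤ K := by
      rw [← hS]
      exact AddSubgroup.closure_mono (by simp)
    have hmap : H.map f ≤ (K ⊓ H).map f := by
      rw [← hT, AddSubgroup.closure_le]
      intro t ht
      refine ⟨g t, ⟨AddSubgroup.subset_closure ?_, hgH t ht⟩, hg t ht⟩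
      exact Finset.mem_union_right _ (Finset.mem_image_of_mem g ht)
    obtain ⟨y, ⟨hyK, hyH⟩, hy⟩ := hmap ⟨x, hx, rfl⟩
    have h3 : -y + x ∈ H ⊓ f.ker := by
      refine AddSubgroup.mem_inf.2 ⟨H.add_mem (H.neg_mem hyH) hx, AddMonoidHom.mem_ker.2 ?_⟩
      rw [map_add, map_neg, hy, neg_add_cancel]
    have := K.add_mem hyK (hle h3)
    rwa [add_neg_cancel_left] at this

/-- The commutative group structure on a subgroup with commuting elements. -/
abbrev AddSubgroup.addCommGroupOfComm (F : AddSubgroup Q)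
    (hc : ∀ x ∈ F, ∀ y ∈ F, x + y = y + x) : AddCommGroup F :=
  { (inferInstance : AddGroup F) with add_comm := fun x y => Subtype.ext (hc x x.2 y y.2) }

theorem AddSubgroup.moduleFinite_of_fg {F : AddSubgroup Q} (hF : F.FG)
    (hc : ∀ x ∈ F, ∀ y ∈ F, x + y = y + x) :
    let := F.addCommGroupOfComm hc
    Module.Finite ℤ F := by
  intro
  rw [Module.Finite.iff_addGroup_fg]
  exact (AddGroup.fg_iff_addSubgroup_fg F).2 hF

theorem AddSubgroup.fg_of_le {F H : AddSubgroup Q} (hF : F.FG)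
    (hc : ∀ x ∈ F, ∀ y ∈ F, x + y = y + x) (hH : H ≤ F) : H.FG := by
  let := F.addCommGroupOfComm hc
  have : Module.Finite ℤ F := AddSubgroup.moduleFinite_of_fg hF hc
  have h1 : (AddSubgroup.toIntSubmodule (H.addSubgroupOf F)).FG := IsNoetherian.noetherian _
  rw [Submodule.fg_iff_addSubgroup_fg] at h1
  have h2 := AddSubgroup.FG.map_hom h1 F.subtype
  rwa [AddSubgroup.toIntSubmodule_toAddSubgroup, AddSubgroup.addSubgroupOf_map_subtype,
    inf_eq_left.2 hH] at h2

theorem wellFoundedGT_of_forall_fg (h : ∀ H : AddSubgroup G, H.FG) :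
    WellFoundedGT (AddSubgroup G) := by
  rw [wellFoundedGT_iff_monotone_chain_condition]
  intro a
  obtain ⟨S, hS⟩ := h (⨆ n, a n)
  have hdir : Directed (· ≤ ·) a := a.monotone.directed_le
  have hmem : ∀ x ∈ S, ∃ n, x ∈ a n := fun x hx => by
    have : x ∈ ⨆ n, a n := hS ▸ AddSubgroup.subset_closure hx
    exact (AddSubgroup.mem_iSup_of_directed hdir).1 this
  choose! f hf using hmem
  refine ⟨S.sup f, fun m hm => le_antisymm (a.monotone hm) ?_⟩
  refine (le_iSup a m).trans ?_
  rw [← hS, AddSubgroup.closure_le]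
  exact fun x hx => a.monotone (Finset.le_sup hx) (hf x hx)

end FinitelyGenerated

open SkewBrace BraceIdeal

variable {B : Type u} [SkewBrace B]

/-- Along the chain, H is an extension of a subgroup of `I i` by a subgroup of the factor, and the
latter is finite or lies in a finitely generated abelian group. -/
theorem SkewBrace.IsAlmostPolycyclic.forall_fg (hB : IsAlmostPolycyclic B) (H : AddSubgroup B) :
    H.FG := by
  obtain ⟨n, I, h0, hn, h⟩ := hB
  have key : ∀ i ≤ n, ∀ H : AddSubgroup B, H ≤ (I i).toAddSubgroup → H.FG := by
    intro i hi
    induction i with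
    | zero =>
      intro H hH
      refine AddSubgroup.fg_of_finite ((Set.finite_singleton 0).subset ?_)
      rw [← h0]
      exact hH
    | succ i ih =>
      intro H hH
      have hmap : H.map (I i).proj ≤ (I i).factor (I (i + 1)) := AddSubgroup.map_mono hH
      refine AddSubgroup.fg_of_ker_of_map (I i).proj (ih (by omega) _ ?_) ?_
      · rintro x ⟨-, hx⟩
        exact (I i).proj_eq_zero.1 hx
      · rcases (h i (by omega)).2 with hfin | ⟨hfg, hsoc⟩
        · exact AddSubgroup.fg_of_finite ((Set.toFinite _).subset hmap)
        · exact AddSubgroup.fg_of_le hfg (fun x hx y _ => (hsoc hx).2 y) hmap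
  refine key n le_rfl H fun x _ => ?_
  have : x ∈ (I n).carrier := by rw [hn]; trivial
  exact this

/-- A chain of ideals witnessing that a brace is almost polycyclic, described by elements. -/
def PolyChain (B : Type u) [SkewBrace B] : Prop :=
  ∃ (n : ℕ) (I : ℕ → BraceIdeal B), (∀ x ∈ I 0, x = 0) ∧ (∀ x, x ∈ I n) ∧
    ∀ i < n, (∀ x ∈ I i, x ∈ I (i + 1)) ∧
      ((∃ s : Set B, s.Finite ∧ ∀ x ∈ I (i + 1), ∃ y ∈ s, -y + x ∈ I i) ∨
        ∀ x ∈ I (i + 1), ∀ b, -b + lam x b ∈ I i ∧ x + b - x - b ∈ I i)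

theorem SkewBrace.IsAlmostPolycyclic.polyChain (hB : IsAlmostPolycyclic B) : PolyChain B := by
  obtain ⟨n, I, h0, hn, h⟩ := hB
  refine ⟨n, I, fun x hx => ?_, fun x => ?_, fun i hi => ⟨fun x hx => (h i hi).1 hx, ?_⟩⟩
  · have : x ∈ (I 0).carrier := hx
    rwa [h0] at this
  · have : x ∈ (I n).carrier := by rw [hn]; trivial
    exact this
  · rcases (h i hi).2 with hfin | ⟨-, hsoc⟩
    · left
      let g := Function.surjInv (I i).proj_surjective
      have hg : ∀ y, (I i).proj (g y) = y := Function.surjInv_eq _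
      refine ⟨g '' ((I i).factor (I (i + 1)) : Set (I i).Quot), (Set.toFinite _).image g,
        fun x hx => ⟨g ((I i).proj x), ⟨_, ⟨x, hx, rfl⟩, rfl⟩, ?_⟩⟩
      exact (I i).proj_eq.1 (hg _)
    · right
      intro x hx b
      have hs := hsoc ⟨x, hx, rfl⟩
      constructor
      · rw [← proj_eq_zero, map_add, map_neg, proj_lam, hs.1, neg_add_cancel]
      · rw [← proj_eq_zero, map_sub, map_sub, map_add, hs.2, add_sub_cancel_right, sub_self]

/-- Conditions on elements pass to images directly, without comparing quotients of quotients. Finite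
generation, which `PolyChain` omits, is supplied separately by `forall_fg`. -/
theorem PolyChain.map {D : Type v} [SkewBrace D] (hB : PolyChain B) (f : BraceHom B D)
    (hf : Function.Surjective f.toFun) : PolyChain D := by
  obtain ⟨n, I, h0, hn, h⟩ := hB
  refine ⟨n, fun i => (I i).map f hf, ?_, ?_, fun i hi => ⟨?_, ?_⟩⟩
  · rintro _ ⟨x, hx, rfl⟩
    rw [h0 x hx]
    exact f.map_zero
  · intro y
    obtain ⟨x, rfl⟩ := hf y
    exact ⟨x, hn x, rfl⟩
  · rintro _ ⟨x, hx, rfl⟩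
    exact ⟨x, (h i hi).1 x hx, rfl⟩
  · rcases (h i hi).2 with ⟨s, hs, hsx⟩ | hc
    · left
      refine ⟨f.toFun '' s, hs.image _, ?_⟩
      rintro _ ⟨x, hx, rfl⟩
      obtain ⟨y, hy, hyx⟩ := hsx x hx
      refine ⟨_, ⟨y, hy, rfl⟩, -y + x, hyx, ?_⟩
      exact (f.map_add' _ _).trans (by rw [f.map_neg]; rfl)
    · right
      rintro _ ⟨x, hx, rfl⟩ b
      obtain ⟨b, rfl⟩ := hf b
      refine ⟨⟨_, (hc x hx b).1, ?_⟩, ⟨_, (hc x hx b).2, ?_⟩⟩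
      · exact (f.map_add' _ _).trans (by rw [f.map_neg, f.map_lam]; rfl)
      · exact (f.map_sub _ _).trans (by rw [f.map_sub, f.map_add']; rfl)

end

/-! ### Elements of infinite order in the socle -/

section

open SkewBrace BraceIdeal

section SocleElements

variable {D : Type u} [SkewBrace D]

theorem pow_eq_nsmul_of_lam {z : D} (hz : ∀ b, lam z b = b) (k : ℕ) : z ^ k = k • z := by
  induction k with
  | zero => rw [pow_zero, zero_nsmul, one_eq_zero]
  | succ k ih => rw [pow_succ', ih, mul_eq, hz, succ_nsmul']

theorem lam_pow_of_lam {z : D} (hz : ∀ b, lam z b = b) (k : ℕ) (b : D) : lam (z ^ k) b = b := by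
  induction k with
  | zero => rw [pow_zero, lam_one]
  | succ k ih => rw [pow_succ', lam_mul, ih, hz]

theorem exists_pow_forall_mem_fixed {E : Type*} {p : E → Prop} [Finite {x // p x}]
    (σ : Equiv.Perm E)
    (hσ : ∀ x, p (σ x) ↔ p x) : ∃ e : ℕ, 0 < e ∧ ∀ x, p x → (σ ^ e) x = x := by
  obtain ⟨e, he, h⟩ := isOfFinOrder_iff_pow_eq_one.1 (isOfFinOrder_of_finite (σ.subtypePerm hσ))
  refine ⟨e, he, fun x hx => ?_⟩
  rw [Equiv.Perm.subtypePerm_pow] at h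
  have := congrArg (fun τ => ((τ ⟨x, hx⟩ : {x // p x}) : E)) h
  exact this

/-- The image of X in D/N is in the socle, so λ_x and conjugation by x move elements only by errors
in the finite ideal N. A power of x acts trivially on N; then its errors add up under iteration and
are killed by m = |N|. The same argument for additive conjugation yields a central multiple. The
result is a nonzero multiple of x modulo N, hence of infinite order. -/
theorem exists_mem_socle_of_infinite {N X : BraceIdeal D} (hN : Finite {x // x ∈ N})
    (hX : ∀ x ∈ X, ∀ b, -b + lam x b ∈ N ∧ x + b - x - b ∈ N)
    {x : D} (hx : x ∈ X) (hinf : ∀ k : ℕ, 0 < k → k • x ∉ N) :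
    ∃ v ∈ SkewBrace.socle D, ∀ k : ℕ, 0 < k → k • v ≠ 0 := by
  have hcard : 0 < Nat.card {x // x ∈ N} :=
    Nat.card_pos_iff.2 ⟨⟨⟨0, N.toAddSubgroup.zero_mem⟩⟩, hN⟩
  set m := Nat.card {x // x ∈ N} with hm
  have hmN : ∀ y ∈ N, m • y = 0 := by
    intro y hy
    have := card_nsmul_eq_zero' (x := (⟨y, hy⟩ : N.toAddSubgroup))
    exact congrArg Subtype.val this
  have hXpow : ∀ y ∈ X, ∀ k : ℕ, y ^ k ∈ X := by
    intro y hy k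
    induction k with
    | zero => rw [pow_zero]; exact X.one_mem'
    | succ k ih => rw [pow_succ]; exact X.mul_mem' ih hy
  -- `e` is an exponent for the permutation of the finite set N induced by λ_x.
  obtain ⟨e, he, hxe⟩ := exists_pow_forall_mem_fixed (p := (· ∈ N)) (lamAct D x) (by
    intro y
    refine ⟨fun h => ?_, fun h => N.lam_mem' x h⟩
    have h2 : lam x⁻¹ (lam x y) ∈ N := N.lam_mem' x⁻¹ h
    rwa [lam_inv_lam] at h2)
  rw [← map_pow] at hxe
  set y := x ^ e with hy
  have hyX : y ∈ X := hXpow x hx e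
  have hyfix : ∀ n ∈ N, lam y n = n := hxe
  -- The error -b + λ_y(b) lies in N and is fixed by λ_y, so it is added once at each iteration.
  have hypow : ∀ (k : ℕ) b, lam (y ^ k) b = b + k • (-b + lam y b) := by
    intro k b
    induction k with
    | zero => rw [pow_zero, lam_one, zero_nsmul, add_zero]
    | succ k ih =>
      have hmem := (hX y hyX b).1
      rw [pow_succ', lam_mul, ih, lam_add, lam_nsmul, hyfix _ hmem, succ_nsmul', ← add_assoc b,
        add_neg_cancel_left]
  set z := y ^ m with hz
  have hzX : z ∈ X := hXpow y hyX m
  have hzlam : ∀ b, lam z b = b := fun b => by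
    rw [hypow, hmN _ (hX y hyX b).1, add_zero]
  let σ : Equiv.Perm D := ⟨fun n => z + n - z, fun n => -z + n + z,
    fun n => by simp [sub_eq_add_neg, add_assoc], fun n => by simp [sub_eq_add_neg, add_assoc]⟩
  obtain ⟨e', he', hze⟩ := exists_pow_forall_mem_fixed (p := (· ∈ N)) σ (by
      intro n
      refine ⟨fun h => ?_, fun h => ?_⟩
      · have h2 := N.add_conj_mem' (-z) (a := z + n - z) h
        simp only [sub_eq_add_neg, add_assoc, neg_neg, neg_add_cancel, add_zero,
          neg_add_cancel_left] at h2
        exact h2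
      · exact N.add_conj_mem' z h)
  have hconj : ∀ (k : ℕ) n, (σ ^ k) n =
      k • z + n - k • z := by
    intro k n
    induction k with
    | zero => simp
    | succ k ih =>
      rw [pow_succ', Equiv.Perm.mul_apply, ih]
      change z + _ - z = _
      rw [succ_nsmul']
      simp only [sub_eq_add_neg, neg_add_rev, add_assoc]
  set w := e' • z with hw
  have hwX : w ∈ X := X.toAddSubgroup.nsmul_mem hzX e'
  have hwfix : ∀ n ∈ N, w + n = n + w := by
    intro n hn
    have := hze n hn
    rw [hconj, sub_eq_iff_eq_add] at this
    exact this
  -- Additive counterpart: the commutator of w and b lies in N, hence commutes with w, so the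
  -- commutator of kw and b is its k-th multiple.
  have hwk : ∀ (k : ℕ) b, k • w + b = k • (w + b - w - b) + b + k • w := by
    intro k b
    induction k with
    | zero => simp
    | succ k ih =>
      have hc := (hX w hwX b).2
      set c := w + b - w - b with hcdef
      have hwb : w + b = c + b + w := by rw [hcdef]; simp [sub_eq_add_neg, add_assoc]
      have hkc : w + k • c = k • c + w := hwfix _ (N.toAddSubgroup.nsmul_mem hc k)
      calc (k + 1) • w + b = w + (k • w + b) := by rw [succ_nsmul', add_assoc]
        _ = (w + k • c) + b + k • w := by rw [ih]; simp only [add_assoc]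
        _ = k • c + (w + b) + k • w := by rw [hkc]; simp only [add_assoc]
        _ = (k • c + c) + b + (w + k • w) := by rw [hwb]; simp only [add_assoc]
        _ = _ := by rw [← succ_nsmul, ← succ_nsmul']
  -- Since λ_z is trivial, multiples of z are its powers, and these again have trivial λ.
  have hv : m • w = z ^ (m * e') := by
    rw [pow_eq_nsmul_of_lam hzlam, hw, ← mul_nsmul, mul_comm]
  refine ⟨m • w, ⟨fun b => ?_, fun b => ?_⟩, fun k hk h0 => ?_⟩
  · rw [hv, lam_pow_of_lam hzlam]
  · rw [hwk, hmN _ (hX w hwX b).2, zero_add]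
  · have hxl : ∀ b, lam (N.proj x) b = b := by
      intro b
      obtain ⟨b, rfl⟩ := N.proj_surjective b
      rw [← proj_lam, eq_comm, proj_eq]
      exact (hX x hx b).1
    have hprojpow : ∀ (a : D) (j : ℕ), N.proj (a ^ j) = N.proj a ^ j :=
      fun a j => map_pow N.projHom.toMul a j
    -- Modulo N the map λ_x is trivial, so all powers taken on the way become multiples of x.
    have h1 : N.proj (k • m • w) = N.proj ((k * (m * e') * m * e) • x) := by
      rw [hv, hz, hy, ← pow_mul, ← pow_mul, map_nsmul, map_nsmul, hprojpow,
        pow_eq_nsmul_of_lam hxl, ← mul_nsmul]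
      congr 1
      ring
    rw [h0, map_zero, eq_comm, proj_eq_zero] at h1
    exact hinf _ (by positivity) h1

/-- An infinite almost polycyclic brace has an element of infinite order in its socle. -/
theorem PolyChain.exists_mem_socle (hD : PolyChain D) (hfg : ∀ H : AddSubgroup D, H.FG)
    (hinf : Infinite D) : ∃ v ∈ SkewBrace.socle D, ∀ k : ℕ, 0 < k → k • v ≠ 0 := by
  classical
  obtain ⟨n, I, h0, hn, h⟩ := hD
  have hex : ∃ i, ¬ {x | x ∈ I i}.Finite :=
    ⟨n, fun hf => Set.infinite_univ (hf.subset fun x _ => hn x)⟩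
  -- At the first infinite ideal of the chain the factor below it is infinite, hence of socle type
  -- over a finite ideal.
  obtain ⟨i, hi, hmin⟩ : ∃ i, ¬ {x | x ∈ I i}.Finite ∧ ∀ j < i, {x | x ∈ I j}.Finite :=
    ⟨Nat.find hex, Nat.find_spec hex, fun j hj => not_not.1 (Nat.find_min hex hj)⟩
  have hin : i ≤ n := by
    by_contra hcon
    exact Set.infinite_univ ((hmin n (by omega)).subset fun x _ => hn x)
  cases i with
  | zero => exact absurd ((Set.finite_singleton 0).subset h0) hi
  | succ i =>
    have hNfin := hmin i (Nat.lt_succ_self i)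
    obtain ⟨-, ⟨s, hs, hsx⟩ | hX⟩ := h i (by omega)
    · refine absurd (((hs.prod hNfin).image fun t => t.1 + t.2).subset ?_) hi
      intro x hx
      obtain ⟨y, hy, hyx⟩ := hsx x hx
      exact ⟨(y, -y + x), ⟨hy, hyx⟩, add_neg_cancel_left y x⟩
    · by_cases hx : ∃ x ∈ I (i + 1), ∀ k : ℕ, 0 < k → k • x ∉ I i
      · obtain ⟨x, hx, hxk⟩ := hx
        exact exists_mem_socle_of_infinite hNfin hX hx hxk
      -- If every element were torsion modulo N, the factor would be a finitely generated abelian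
      -- torsion group, hence finite, and so would be `I (i + 1)`.
      · exfalso
        push Not at hx
        set N := I i
        set F := N.factor (I (i + 1)) with hF
        have hcomm : ∀ a ∈ F, ∀ b ∈ F, a + b = b + a := by
          rintro _ ⟨a, ha, rfl⟩ _ ⟨b, -, rfl⟩
          have := N.proj_eq_zero.2 (hX a ha b).2
          rw [map_sub, map_sub, map_add, sub_eq_zero, sub_eq_iff_eq_add] at this
          exact this
        have hFfg : F.FG := (hfg _).map_hom _
        let := F.addCommGroupOfComm hcomm
        have : Module.Finite ℤ F := AddSubgroup.moduleFinite_of_fg hFfg hcomm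
        have hFfin : Finite F := by
          refine Module.finite_of_fg_torsion F ?_
          rintro ⟨_, a, ha, rfl⟩
          obtain ⟨k, hk, hka⟩ := hx a ha
          refine ⟨⟨(k : ℤ), mem_nonZeroDivisors_of_ne_zero (by exact_mod_cast hk.ne')⟩, ?_⟩
          apply Subtype.ext
          change (k : ℤ) • N.proj a = 0
          rw [natCast_zsmul, ← map_nsmul, proj_eq_zero]
          exact hka
        let g := Function.surjInv N.proj_surjective
        have hg : ∀ y, N.proj (g y) = y := Function.surjInv_eq _
        have hs : (g '' (F : Set N.Quot)).Finite := (Set.toFinite _).image g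
        refine hi (((hs.prod hNfin).image fun t => t.1 + t.2).subset ?_)
        intro x hx
        refine ⟨(g (N.proj x), -g (N.proj x) + x), ⟨⟨_, ⟨x, hx, rfl⟩, rfl⟩, ?_⟩,
          add_neg_cancel_left _ x⟩
        exact N.proj_eq.1 (hg _)

end SocleElements

end

/-! ### Finite quotients that detect the failure of supersolubility -/

section

open SkewBrace BraceIdeal

namespace BraceIdeal

variable {B : Type u} [SkewBrace B]

/-- A `λ`-invariant additive subgroup of the socle, as an ideal. -/
def ofSocle (T : AddSubgroup B) (hT : ∀ t ∈ T, t ∈ SkewBrace.socle B)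
    (hl : ∀ b, ∀ t ∈ T, lam b t ∈ T) : BraceIdeal B :=
  ofAdd T hl (fun b t ht => by rw [← (hT t ht).2, add_sub_cancel_right]; exact ht)
    (fun b t ht => by rw [(hT t ht).1, neg_add_cancel]; exact T.zero_mem)

end BraceIdeal

section

variable {D : Type u} [SkewBrace D]

theorem exists_nsmul_torsion_eq_zero (M : Type*) [AddCommGroup M] [Module.Finite ℤ M] :
    ∃ t : ℤ, t ≠ 0 ∧ ∀ x : M, (∃ k : ℤ, k ≠ 0 ∧ k • x = 0) → t • x = 0 := by
  obtain ⟨t, ht, h⟩ := exists_smul_mem_of_fg (Submodule.torsion ℤ M) ⊥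
    (IsNoetherian.noetherian _) (by
      rintro x ⟨k, hk⟩
      exact ⟨k, nonZeroDivisors.coe_ne_zero k, hk⟩)
  refine ⟨t, ht, fun x ⟨k, hk, hx⟩ => h x ⟨⟨k, mem_nonZeroDivisors_of_ne_zero hk⟩, hx⟩⟩

/-- A brace whose additive subgroups are finitely generated, with an element of infinite order in
the socle, has a nonzero torsion-free ideal inside the socle. -/
theorem exists_torsionFree_ideal (hfg : ∀ H : AddSubgroup D, H.FG) {v : D}
    (hv : v ∈ SkewBrace.socle D) (hv0 : ∀ k : ℕ, 0 < k → k • v ≠ 0) :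
    ∃ A : BraceIdeal D, (∀ x ∈ A, x ∈ SkewBrace.socle D) ∧ (∃ x ∈ A, x ≠ 0) ∧
      ∀ x ∈ A, ∀ k : ℤ, k ≠ 0 → k • x = 0 → x = 0 := by
  let S := (BraceIdeal.socle D).toAddSubgroup
  have hc : ∀ x ∈ S, ∀ y ∈ S, x + y = y + x := fun x hx y _ => hx.2 y
  let := S.addCommGroupOfComm hc
  have : Module.Finite ℤ S := AddSubgroup.moduleFinite_of_fg (hfg S) hc
  obtain ⟨t, ht0, ht⟩ := exists_nsmul_torsion_eq_zero S
  have ht' : ∀ s ∈ S, ∀ k : ℤ, k ≠ 0 → k • s = 0 → t • s = 0 := fun s hs k hk h =>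
    congrArg Subtype.val (ht ⟨s, hs⟩ ⟨k, hk, Subtype.ext h⟩)
  -- Multiplication by `t` kills the torsion of the socle, so tS is torsion-free; it is nonzero
  -- because `v` has infinite order.
  let T : AddSubgroup D :=
    { carrier := {x | ∃ s ∈ S, x = t • s}
      zero_mem' := ⟨0, S.zero_mem, (smul_zero t).symm⟩
      add_mem' := by
        rintro _ _ ⟨x, hx, rfl⟩ ⟨y, hy, rfl⟩
        exact ⟨x + y, S.add_mem hx hy, (AddCommute.zsmul_add (hc x hx y hy) t).symm⟩
      neg_mem' := by
        rintro _ ⟨x, hx, rfl⟩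
        exact ⟨-x, S.neg_mem hx, (zsmul_neg x t).symm⟩ }
  refine ⟨ofSocle T ?_ ?_, ?_, ⟨t • v, ⟨v, hv, rfl⟩, ?_⟩, ?_⟩
  · rintro _ ⟨s, hs, rfl⟩
    exact S.zsmul_mem hs t
  · rintro b _ ⟨s, hs, rfl⟩
    exact ⟨lam b s, (BraceIdeal.socle D).lam_mem' b hs, lam_zsmul b t s⟩
  · rintro _ ⟨s, hs, rfl⟩
    exact S.zsmul_mem hs t
  · intro h
    refine hv0 t.natAbs (Int.natAbs_pos.2 ht0) ?_
    rcases Int.natAbs_eq t with h2 | h2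
    · rwa [h2, natCast_zsmul] at h
    · rwa [h2, neg_zsmul, natCast_zsmul, neg_eq_zero] at h
  · rintro _ ⟨s, hs, rfl⟩ k hk h
    refine ht' s hs (k * t) (mul_ne_zero hk ht0) ?_
    rw [mul_smul]
    exact h

end

section Action

variable {D : Type u} [SkewBrace D] (A : BraceIdeal D)
  (hA : ∀ x ∈ A, ∀ y ∈ A, x + y = y + x)

/-- The action of `(D, *)` on a commutative ideal, by `λ`. -/
def idealAction : letI := A.toAddSubgroup.addCommGroupOfComm hA
    D →* Module.End ℤ A.toAddSubgroup :=
  letI := A.toAddSubgroup.addCommGroupOfComm hA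
  { toFun := fun g => AddMonoidHom.toIntLinearMap
      (AddMonoidHom.mk' (fun x => ⟨lam g x, A.lam_mem' g x.2⟩)
        fun x y => Subtype.ext (lam_add g x y))
    map_one' := by
      ext x
      exact lam_one (x : D)
    map_mul' := fun g h => by
      ext x
      exact lam_mul g h (x : D) }

end Action

section Maximal

variable {B : Type u} [SkewBrace B]

open BraceIdeal

/-- The part of the ideal `A` of `B / J` that is covered by the ideal `I` of `B`. -/
def coveredPart (J : BraceIdeal B) (A : BraceIdeal J.Quot)
    (hA : ∀ x ∈ A, ∀ y ∈ A, x + y = y + x) (I : BraceIdeal B) :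
    letI := A.toAddSubgroup.addCommGroupOfComm hA
    Submodule ℤ A.toAddSubgroup :=
  letI := A.toAddSubgroup.addCommGroupOfComm hA
  AddSubgroup.toIntSubmodule
    ((I.toAddSubgroup.map J.proj).addSubgroupOf A.toAddSubgroup)

theorem mem_coveredPart {J : BraceIdeal B} {A : BraceIdeal J.Quot}
    {hA : ∀ x ∈ A, ∀ y ∈ A, x + y = y + x} {I : BraceIdeal B} {a : A.toAddSubgroup} :
    a ∈ coveredPart J A hA I ↔ ∃ x ∈ I, J.proj x = a := Iff.rfl

/-- Endomorphisms of a cyclic group commute. -/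
theorem BraceIdeal.Step.lam_comm {I I' : BraceIdeal B} (h : Step I I') {x : B} (hx : x ∈ I')
    (b b' : B) : lam b (lam b' x) - lam b' (lam b x) ∈ I := by
  obtain ⟨-, c, hc, hgen, -⟩ := h
  obtain ⟨k, hk⟩ := hgen x hx
  obtain ⟨l, hl⟩ := hgen _ (I'.lam_mem' b hc)
  obtain ⟨l', hl'⟩ := hgen _ (I'.lam_mem' b' hc)
  rw [proj_lam] at hl hl'
  rw [← proj_eq_zero, map_sub, proj_lam, proj_lam, proj_lam, proj_lam, hk]
  simp only [lam_zsmul, hl, hl']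
  rw [sub_eq_zero, smul_comm l' l]

/-- On the cyclic factor λ_b is multiplication by an integer l, and l^p ≡ l modulo p by Fermat,
while p kills x modulo I. -/
theorem BraceIdeal.Step.lam_pow_sub {I I' : BraceIdeal B} (h : Step I I') {x : B} (hx : x ∈ I')
    (b : B) {p : ℕ} (hp : p.Prime) (hpx : p • x ∈ I) : lam (b ^ p) x - lam b x ∈ I := by
  obtain ⟨-, c, hc, hgen, -⟩ := h
  obtain ⟨k, hk⟩ := hgen x hx
  obtain ⟨l, hl⟩ := hgen _ (I'.lam_mem' b hc)
  rw [proj_lam] at hl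
  have hpow : ∀ j : ℕ, lam (I.proj b ^ j) (I.proj c) = l ^ j • I.proj c := by
    intro j
    induction j with
    | zero => rw [pow_zero, lam_one, pow_zero, one_smul]
    | succ j ih => rw [pow_succ, lam_mul, hl, lam_zsmul, ih, smul_smul, pow_succ']
  have hbp : I.proj (b ^ p) = I.proj b ^ p := map_pow I.projHom.toMul b p
  obtain ⟨q, hq⟩ : (p : ℤ) ∣ l ^ p - l := by
    have : Fact p.Prime := ⟨hp⟩
    rw [← ZMod.intCast_zmod_eq_zero_iff_dvd]
    push_cast
    rw [ZMod.pow_card, sub_self]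
  have hpc : (p : ℤ) • k • I.proj c = 0 := by
    rw [← hk, natCast_zsmul, ← map_nsmul, proj_eq_zero]
    exact hpx
  rw [← proj_eq_zero, map_sub, proj_lam, proj_lam, hk, lam_zsmul, lam_zsmul, hbp, hpow, hl,
    smul_smul, smul_smul, sub_eq_add_neg, ← sub_zsmul, ← mul_sub, hq,
    show k * (p * q) = q * (p * k) by ring, mul_smul, mul_smul, hpc, smul_zero]

/-- A maximal ideal with nonsupersoluble quotient has finite index in an almost polycyclic
brace. -/
theorem finite_quot_of_maximal (hB : IsAlmostPolycyclic B) (J : BraceIdeal B) (hJ : ¬ Up J)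
    (hmax : ∀ J' : BraceIdeal B, (∀ x ∈ J, x ∈ J') → (∃ x ∈ J', x ∉ J) → Up J') :
    Finite J.Quot := by
  by_contra hfin
  have hinf : Infinite J.Quot := not_finite_iff_infinite.1 hfin
  have hfg : ∀ H : AddSubgroup J.Quot, H.FG := by
    intro H
    have := (hB.forall_fg (H.comap J.proj)).map_hom J.proj
    rwa [AddSubgroup.map_comap_eq_self_of_surjective J.proj_surjective] at this
  obtain ⟨v, hv, hv0⟩ := (hB.polyChain.map J.projHom J.proj_surjective).exists_mem_socle hfg hinf
  obtain ⟨A, hAs, ⟨a₀, ha₀, ha₀0⟩, htf⟩ := exists_torsionFree_ideal hfg hv hv0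
  have hA : ∀ x ∈ A, ∀ y ∈ A, x + y = y + x := fun x hx y _ => (hAs x hx).2 y
  let := A.toAddSubgroup.addCommGroupOfComm hA
  have : Module.Finite ℤ A.toAddSubgroup := AddSubgroup.moduleFinite_of_fg (hfg _) hA
  have : Module.IsTorsionFree ℤ A.toAddSubgroup := by
    rw [Module.isTorsionFree_iff_smul_eq_zero]
    intro k x h
    by_cases hk : k = 0
    · exact Or.inl hk
    · exact Or.inr (Subtype.ext (htf x x.2 k hk (congrArg Subtype.val h)))
  have : Nontrivial A.toAddSubgroup :=
    ⟨⟨a₀, ha₀⟩, 0, fun h => ha₀0 (congrArg Subtype.val h)⟩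
  -- Maximality of J in terms of B/J: the quotient by any nonzero ideal is supersoluble.
  have hbig : ∀ K : BraceIdeal J.Quot, (∃ y ∈ K, y ≠ 0) → Up (comap J.projHom K) := by
    rintro K ⟨y, hy, hy0⟩
    obtain ⟨x, rfl⟩ := J.proj_surjective y
    refine hmax _ (fun z hz => ?_) ⟨x, hy, fun hx => hy0 (J.proj_eq_zero.2 hx)⟩
    change J.proj z ∈ K
    rw [J.proj_eq_zero.2 hz]
    exact K.toAddSubgroup.zero_mem
  obtain ⟨w, hw0, hw⟩ := exists_common_eigenvector (idealAction A hA) (by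
    intro p hp
    -- pA, nonzero because A is torsion-free.
    let T : AddSubgroup J.Quot :=
      { carrier := {x | ∃ s ∈ A, x = (p : ℤ) • s}
        zero_mem' := ⟨0, A.toAddSubgroup.zero_mem, (smul_zero _).symm⟩
        add_mem' := by
          rintro _ _ ⟨x, hx, rfl⟩ ⟨y, hy, rfl⟩
          exact ⟨x + y, A.add_mem hx hy, (AddCommute.zsmul_add (hA x hx y hy) _).symm⟩
        neg_mem' := by
          rintro _ ⟨x, hx, rfl⟩
          exact ⟨-x, A.neg_mem hx, (zsmul_neg x _).symm⟩ }
    have hTA : ∀ t ∈ T, t ∈ A := by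
      rintro _ ⟨s, hs, rfl⟩
      exact A.zsmul_mem hs _
    let K : BraceIdeal J.Quot := ofSocle T (fun t ht => hAs t (hTA t ht)) (by
      rintro b _ ⟨s, hs, rfl⟩
      exact ⟨lam b s, A.lam_mem' b hs, lam_zsmul b _ s⟩)
    have hp0 : (p : ℤ) ≠ 0 := by exact_mod_cast hp.ne_zero
    have hK : Up (comap J.projHom K) :=
      hbig K ⟨(p : ℤ) • a₀, ⟨a₀, ha₀, rfl⟩, fun h => ha₀0 (htf a₀ ha₀ p hp0 h)⟩
    -- A chain from the preimage of pA up to B, mapped to B/J and intersected with A, filters A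
    -- above pA.
    have key : ∀ I : BraceIdeal B, Up I → (∀ x ∈ comap J.projHom K, x ∈ I) →
        ∃ (n : ℕ) (F : ℕ → Submodule ℤ A.toAddSubgroup), F 0 = coveredPart J A hA I ∧ F n = ⊤ ∧
          (∀ i < n, F i ≤ F (i + 1)) ∧
          (∀ i < n, ∀ x ∈ F (i + 1), ∀ g g' : J.Quot, idealAction A hA g (idealAction A hA g' x) -
            idealAction A hA g' (idealAction A hA g x) ∈ F i) ∧
          ∀ i < n, ∀ x ∈ F (i + 1), ∀ g : J.Quot,
            (idealAction A hA g ^ p) x - idealAction A hA g x ∈ F i := by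
      intro I hI
      induction hI with
      | top I h =>
        intro _
        refine ⟨0, fun _ => ⊤, ?_, rfl, fun i hi => absurd hi (Nat.not_lt_zero i),
          fun i hi => absurd hi (Nat.not_lt_zero i), fun i hi => absurd hi (Nat.not_lt_zero i)⟩
        rw [eq_comm, eq_top_iff]
        intro a _
        obtain ⟨x, hx⟩ := J.proj_surjective (a : J.Quot)
        exact mem_coveredPart.2 ⟨x, h x, hx⟩
      | step I I' hstep _ ih =>
        intro hKI
        obtain ⟨n, F, h0, hn, hmono, hcomm, hfrob⟩ := ih fun x hx => hstep.1 x (hKI x hx)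
        refine ⟨n + 1, fun i => Nat.casesOn i (coveredPart J A hA I) F, rfl, hn, ?_, ?_, ?_⟩
        · intro i hi
          cases i with
          | zero =>
            change coveredPart J A hA I ≤ F 0
            rw [h0]
            rintro a ⟨x, hx, hxa⟩
            exact mem_coveredPart.2 ⟨x, hstep.1 x hx, hxa⟩
          | succ i => exact hmono i (by omega)
        · intro i hi a ha g g'
          cases i with
          | zero =>
            change a ∈ F 0 at ha
            rw [h0] at ha
            obtain ⟨x, hx, hxa⟩ := mem_coveredPart.1 ha
            obtain ⟨b, rfl⟩ := J.proj_surjective g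
            obtain ⟨b', rfl⟩ := J.proj_surjective g'
            refine mem_coveredPart.2 ⟨_, BraceIdeal.Step.lam_comm hstep hx b b', ?_⟩
            rw [map_sub, proj_lam, proj_lam, proj_lam, proj_lam, hxa]
            rfl
          | succ i => exact hcomm i (by omega) a ha g g'
        · intro i hi a ha g
          cases i with
          | zero =>
            change a ∈ F 0 at ha
            rw [h0] at ha
            obtain ⟨x, hx, hxa⟩ := mem_coveredPart.1 ha
            obtain ⟨b, rfl⟩ := J.proj_surjective g
            -- The image of x lies in A, so px lies over pA, hence in I.
            refine mem_coveredPart.2 ⟨_, BraceIdeal.Step.lam_pow_sub hstep hx b hp (hKI _ ?_), ?_⟩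
            · refine ⟨a, a.2, ?_⟩
              change J.proj (p • x) = _
              rw [map_nsmul, hxa, natCast_zsmul]
            · have hbp : J.proj (b ^ p) = J.proj b ^ p := map_pow J.projHom.toMul b p
              rw [map_sub, proj_lam, proj_lam, hxa, hbp, ← MonoidHom.map_pow]
              rfl
          | succ i => exact hfrob i (by omega) a ha g
    obtain ⟨n, F, h0, hn, h1, h2, h3⟩ := key _ hK fun x hx => hx
    refine ⟨n, F, fun a => ?_, hn, h1, h2, h3⟩
    rw [h0, mem_coveredPart]
    constructor
    · rintro ⟨x, ⟨s, hs, hxs⟩, hxa⟩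
      refine ⟨⟨s, hs⟩, Subtype.ext ?_⟩
      rw [← hxa]
      exact hxs
    · rintro ⟨y, rfl⟩
      obtain ⟨x, hx⟩ := J.proj_surjective ((p : ℤ) • (y : J.Quot))
      exact ⟨x, ⟨y, y.2, hx⟩, hx⟩)
  have hw' : ∀ b, lam b (w : J.Quot) = w ∨ lam b (w : J.Quot) = -w := by
    intro b
    rcases hw b with h | h
    · exact Or.inl (congrArg Subtype.val h)
    · exact Or.inr (congrArg Subtype.val h)
  have hwl : ∀ b, lam b (w : J.Quot) ∈ AddSubgroup.zmultiples (w : J.Quot) := by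
    intro b
    rcases hw' b with h | h <;> rw [h]
    · exact AddSubgroup.mem_zmultiples _
    · exact AddSubgroup.neg_mem _ (AddSubgroup.mem_zmultiples _)
  -- The multiples of the eigenvector form a cyclic socle ideal; as the quotient by it is
  -- supersoluble, so is B/J.
  let K : BraceIdeal J.Quot := ofSocle (AddSubgroup.zmultiples (w : J.Quot)) (by
      rintro _ ⟨k, rfl⟩
      exact (BraceIdeal.socle _).zsmul_mem (hAs _ w.2) k) (by
      rintro b _ ⟨k, rfl⟩
      change lam b (k • (w : J.Quot)) ∈ _
      rw [lam_zsmul]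
      exact AddSubgroup.zsmul_mem _ (hwl b) k)
  have hwK : (w : J.Quot) ∈ K := AddSubgroup.mem_zmultiples (w : J.Quot)
  refine hJ (Up.step J (comap J.projHom K) ⟨fun x hx => ?_, ?_⟩
    (hbig K ⟨w, hwK, fun h => hw0 (Subtype.ext h)⟩))
  · change J.proj x ∈ K
    rw [J.proj_eq_zero.2 hx]
    exact K.toAddSubgroup.zero_mem
  · obtain ⟨c, hc⟩ := J.proj_surjective (w : J.Quot)
    refine ⟨c, ?_, ?_, Or.inl (hc ▸ hAs _ w.2)⟩
    · change J.proj c ∈ K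
      rw [hc]; exact hwK
    · rintro x ⟨k, hk⟩
      exact ⟨k, by rw [hc]; exact hk.symm⟩

end Maximal

section Finite

variable {B : Type u} [SkewBrace B]

/-- No additive subgroup of prime order of the brace `Q` is an ideal. -/
def NoPrimeIdeal (Q : Type u) [SkewBrace Q] : Prop :=
  ∀ a : Q, a ≠ 0 → ∀ p : ℕ, p.Prime → p • a = 0 →
    ¬ ((∀ b, lam b a ∈ AddSubgroup.zmultiples a) ∧ (∀ b, b + a - b ∈ AddSubgroup.zmultiples a) ∧
      ∀ t ∈ AddSubgroup.zmultiples a, ∀ b, -b + lam t b ∈ AddSubgroup.zmultiples a)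

theorem exists_maximal_not_up (hB : IsAlmostPolycyclic B) (h : ¬ Up (zero B)) :
    ∃ J : BraceIdeal B, ¬ Up J ∧
      ∀ J' : BraceIdeal B, (∀ x ∈ J, x ∈ J') → (∃ x ∈ J', x ∉ J) → Up J' := by
  have := wellFoundedGT_of_forall_fg hB.forall_fg
  have hwf : WellFounded fun I I' : BraceIdeal B => I.toAddSubgroup > I'.toAddSubgroup :=
    InvImage.wf _ (wellFounded_gt (α := AddSubgroup B))
  obtain ⟨J, hJ, hm⟩ := hwf.has_min {J | ¬ Up J} ⟨_, h⟩
  refine ⟨J, hJ, fun J' hle ⟨x, hx, hx'⟩ => ?_⟩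
  by_contra hJ'
  exact hm J' hJ' (lt_of_le_not_ge (fun y hy => hle y hy) fun h => hx' (h hx))

/-- Take J maximal with B/J not supersoluble. An ideal of prime order in B/J would be one more step
below a supersoluble quotient. -/
theorem exists_finite_noPrimeIdeal (hB : IsAlmostPolycyclic B) (h : ¬ IsSupersoluble B) :
    ∃ J : BraceIdeal B, Finite J.Quot ∧ (∃ x : J.Quot, x ≠ 0) ∧ NoPrimeIdeal J.Quot := by
  rw [isSupersoluble_iff_up] at h
  obtain ⟨J, hJ, hmax⟩ := exists_maximal_not_up hB h
  refine ⟨J, finite_quot_of_maximal hB J hJ hmax, ?_, ?_⟩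
  · by_contra! h0
    exact hJ (Up.top J fun x => J.proj_eq_zero.1 (h0 _))
  · rintro a ha p hp hpa ⟨h1, h2, h3⟩
    let K : BraceIdeal J.Quot := ofAdd (AddSubgroup.zmultiples a)
      (by
        rintro b _ ⟨k, rfl⟩
        change lam b (k • a) ∈ _
        rw [lam_zsmul]
        exact AddSubgroup.zsmul_mem _ (h1 b) k)
      (by
        rintro b _ ⟨k, rfl⟩
        change b + k • a - b ∈ _
        have h := map_zsmul (AddMonoidHom.mk' (fun x : J.Quot => b + x - b)
          fun x y => by simp [sub_eq_add_neg, add_assoc]) k a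
        simp only [AddMonoidHom.mk'_apply] at h
        rw [h]
        exact AddSubgroup.zsmul_mem _ (h2 b) k)
      (fun b t ht => h3 t ht b)
    obtain ⟨c, rfl⟩ := J.proj_surjective a
    have hc : J.proj c ∈ K := AddSubgroup.mem_zmultiples _
    refine hJ (Up.step J (comap J.projHom K) ⟨fun x hx => ?_, c, hc, ?_, Or.inr ⟨p, hp, hpa⟩⟩ ?_)
    · change J.proj x ∈ K
      rw [J.proj_eq_zero.2 hx]
      exact K.toAddSubgroup.zero_mem
    · rintro x ⟨k, hk⟩
      exact ⟨k, hk.symm⟩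
    · refine hmax _ (fun x hx => ?_) ⟨c, hc, fun h => ha (J.proj_eq_zero.2 h)⟩
      change J.proj x ∈ K
      rw [J.proj_eq_zero.2 hx]
      exact K.toAddSubgroup.zero_mem

/-- The first ideal of a chain in B with nonzero image in Q has a cyclic image, generated by some d.
Either d has prime order, or it lies in the socle of Q, where a multiple of d of prime order
generates an ideal. -/
theorem not_isSupersoluble_of_noPrimeIdeal {Q : Type v} [SkewBrace Q] [Finite Q]
    (f : BraceHom B Q) (hf : Function.Surjective f.toFun) (hQ : ∃ x : Q, x ≠ 0)
    (hn : NoPrimeIdeal Q) : ¬ IsSupersoluble B := by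
  rw [isSupersoluble_iff_up]
  suffices h : ∀ J : BraceIdeal B, Up J → ¬ ∀ x ∈ J, f.toFun x = 0 from
    fun h' => h _ h' fun x hx => by rw [mem_zero.1 hx, f.map_zero]
  intro J hJ
  induction hJ with
  | top J h =>
    intro h'
    obtain ⟨y, hy⟩ := hQ
    obtain ⟨x, rfl⟩ := hf y
    exact hy (h' x (h x))
  | step J J' hs _ ih =>
    intro h'
    obtain ⟨hle, c, hc, hgen, hor⟩ := hs
    have hcongr : ∀ x y, J.proj x = J.proj y → f.toFun x = f.toFun y := by
      intro x y hxy
      have := h' _ (J.proj_eq.1 hxy)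
      rwa [f.map_add', f.map_neg, neg_add_eq_zero] at this
    have hgen' : ∀ x ∈ J', ∃ k : ℤ, f.toFun x = k • f.toFun c := by
      intro x hx
      obtain ⟨k, hk⟩ := hgen x hx
      rw [← map_zsmul] at hk
      exact ⟨k, by rw [hcongr _ _ hk, f.map_zsmul]⟩
    set d := f.toFun c with hd
    by_cases hd0 : d = 0
    · refine ih fun x hx => ?_
      obtain ⟨k, hk⟩ := hgen' x hx
      rw [hk, hd0, smul_zero]
    · let K := BraceIdeal.map f hf J'
      have hK : ∀ x ∈ K, x ∈ AddSubgroup.zmultiples d := by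
        rintro _ ⟨x, hx, rfl⟩
        obtain ⟨k, hk⟩ := hgen' x hx
        exact ⟨k, hk.symm⟩
      have hdK : d ∈ K := ⟨c, hc, rfl⟩
      have hzK : ∀ x ∈ AddSubgroup.zmultiples d, x ∈ K := by
        rintro _ ⟨k, rfl⟩
        exact K.zsmul_mem hdK k
      rcases hor with hsoc | ⟨p, hp, hpc⟩
      · have hds : d ∈ SkewBrace.socle Q := by
          refine ⟨fun b => ?_, fun b => ?_⟩
          · obtain ⟨b, rfl⟩ := hf b
            rw [hd, ← f.map_lam]
            refine hcongr _ _ ?_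
            rw [proj_lam]
            exact hsoc.1 _
          · obtain ⟨b, rfl⟩ := hf b
            rw [hd, ← f.map_add', ← f.map_add']
            refine hcongr _ _ ?_
            rw [map_add, map_add]
            exact hsoc.2 _
        have hm : addOrderOf d ≠ 1 := fun h => hd0 (AddMonoid.addOrderOf_eq_one_iff.1 h)
        have hm0 : 0 < addOrderOf d := addOrderOf_pos d
        set p := (addOrderOf d).minFac
        have hp : p.Prime := Nat.minFac_prime hm
        -- The order of d is pq, so qd has order p.
        obtain ⟨q, hq⟩ : p ∣ addOrderOf d := Nat.minFac_dvd _
        have hsz : ∀ t ∈ AddSubgroup.zmultiples (q • d), t ∈ SkewBrace.socle Q := by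
          rintro _ ⟨k, rfl⟩
          rw [← natCast_zsmul]
          exact (BraceIdeal.socle Q).zsmul_mem ((BraceIdeal.socle Q).zsmul_mem hds _) _
        refine hn (q • d) (fun h => ?_) p hp ?_ ⟨fun b => ?_, fun b => ?_, fun t ht b => ?_⟩
        · have h1 := Nat.le_of_dvd (Nat.pos_of_ne_zero ?_) (addOrderOf_dvd_of_nsmul_eq_zero h)
          · have := hp.two_le
            nlinarith
          · rintro rfl
            omega
        · rw [← mul_nsmul', ← hq, addOrderOf_nsmul_eq_zero]
        · obtain ⟨k, hk⟩ := hK _ (K.lam_mem' b hdK)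
          refine ⟨k, ?_⟩
          change k • q • d = _
          change k • d = _ at hk
          rw [lam_nsmul, ← hk, ← natCast_zsmul, ← natCast_zsmul, smul_comm]
        · rw [← (hsz _ (AddSubgroup.mem_zmultiples _)).2, add_sub_cancel_right]
          exact AddSubgroup.mem_zmultiples _
        · rw [(hsz t ht).1, neg_add_cancel]
          exact AddSubgroup.zero_mem _
      · refine hn d hd0 p hp ?_ ⟨fun b => hK _ (K.lam_mem' b hdK),
          fun b => hK _ (K.add_conj_mem' b hdK), fun t ht b => hK _ (K.star_mem (hzK t ht) b)⟩
        rw [← map_nsmul] at hpc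
        rw [← f.map_nsmul, h' _ (J.proj_eq_zero.1 hpc)]

end Finite

end

/-! ### Recursively generated sets and semidecidable predicates -/

section

open Encodable Denumerable

section Gen

variable {α σ : Type*}

/-- The `n`-th element of the closure of `d a` under the operations `step a t`. -/
def genVal (d : α → σ) (step : α → ℕ → σ → σ → σ) (a : α) : ℕ → σ
  | 0 => d a
  | n + 1 =>
    have _h : n.unpair.2.unpair.1 < n + 1 :=
      Nat.lt_succ_of_le ((Nat.unpair_left_le _).trans (Nat.unpair_right_le _))
    have _h : n.unpair.2.unpair.2 < n + 1 :=
      Nat.lt_succ_of_le ((Nat.unpair_right_le _).trans (Nat.unpair_right_le _))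
    step a n.unpair.1 (genVal d step a n.unpair.2.unpair.1) (genVal d step a n.unpair.2.unpair.2)

/-- The closure of `d a` under the operations `step a t`. -/
inductive Gen (d : α → σ) (step : α → ℕ → σ → σ → σ) (a : α) : σ → Prop
  | base : Gen d step a (d a)
  | step (t : ℕ) {u v : σ} (hu : Gen d step a u) (hv : Gen d step a v) :
    Gen d step a (step a t u v)

/-- The index n + 1 codes a rule number and two earlier indices by `Nat.pair`, so each derivation
tree has an index. -/
theorem gen_iff {d : α → σ} {step : α → ℕ → σ → σ → σ} {a : α} {s : σ} :
    Gen d step a s ↔ ∃ n, genVal d step a n = s := by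
  constructor
  · intro h
    induction h with
    | base => exact ⟨0, by rw [genVal]⟩
    | step t _ _ ih ih' =>
      obtain ⟨m, rfl⟩ := ih
      obtain ⟨n, rfl⟩ := ih'
      exact ⟨Nat.pair t (Nat.pair m n) + 1, by rw [genVal]; simp⟩
  · rintro ⟨n, rfl⟩
    induction n using Nat.strong_induction_on with
    | _ n ih =>
      cases n with
      | zero => rw [genVal]; exact Gen.base
      | succ n =>
        rw [genVal]
        exact Gen.step _
          (ih _ (Nat.lt_succ_of_le ((Nat.unpair_left_le _).trans (Nat.unpair_right_le _))))
          (ih _ (Nat.lt_succ_of_le ((Nat.unpair_right_le _).trans (Nat.unpair_right_le _))))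

end Gen

section PrimrecComp

variable {α β γ σ : Type*} [Primcodable α] [Primcodable β] [Primcodable γ] [Primcodable σ]

attribute [fun_prop] Primrec

namespace Primrec

@[fun_prop]
theorem fun_id : Primrec fun a : α => a := Primrec.id

@[fun_prop]
theorem fun_const (x : σ) : Primrec fun _ : α => x := Primrec.const x

@[fun_prop]
theorem fun_comp {f : β → σ} {g : α → β} (hf : Primrec f) (hg : Primrec g) :
    Primrec fun a => f (g a) := hf.comp hg

@[fun_prop]
theorem fun_fst {f : α → β × γ} (hf : Primrec f) : Primrec fun a => (f a).1 := fst.comp hf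

@[fun_prop]
theorem fun_snd {f : α → β × γ} (hf : Primrec f) : Primrec fun a => (f a).2 := snd.comp hf

@[fun_prop]
theorem fun_pair {f : α → β} {g : α → γ} (hf : Primrec f) (hg : Primrec g) :
    Primrec fun a => (f a, g a) := hf.pair hg

@[fun_prop]
theorem fun_add {f g : α → ℕ} (hf : Primrec f) (hg : Primrec g) :
    Primrec fun a => f a + g a := nat_add.comp hf hg

@[fun_prop]
theorem fun_mul {f g : α → ℕ} (hf : Primrec f) (hg : Primrec g) :
    Primrec fun a => f a * g a := nat_mul.comp hf hg

@[fun_prop]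
theorem fun_mod {f g : α → ℕ} (hf : Primrec f) (hg : Primrec g) :
    Primrec fun a => f a % g a := nat_mod.comp hf hg

@[fun_prop]
theorem fun_natPair {f g : α → ℕ} (hf : Primrec f) (hg : Primrec g) :
    Primrec fun a => Nat.pair (f a) (g a) := Primrec₂.natPair.comp hf hg

@[fun_prop]
theorem fun_unpair {f : α → ℕ} (hf : Primrec f) : Primrec fun a => (f a).unpair :=
  unpair.comp hf

@[fun_prop]
theorem fun_ofNat (τ : Type*) [Denumerable τ] {f : α → ℕ} (hf : Primrec f) :
    Primrec fun a => ofNat τ (f a) := (Primrec.ofNat τ).comp hf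

@[fun_prop]
theorem fun_encode {f : α → β} (hf : Primrec f) : Primrec fun a => encode (f a) :=
  Primrec.encode.comp hf

@[fun_prop]
theorem fun_cons {f : α → β} {g : α → List β} (hf : Primrec f) (hg : Primrec g) :
    Primrec fun a => f a :: g a := list_cons.comp hf hg

@[fun_prop]
theorem fun_getD {f : α → List β} {g : α → ℕ} {d : α → β} (hf : Primrec f) (hg : Primrec g)
    (hd : Primrec d) : Primrec fun a => (f a).getD (g a) (d a) := by
  simp only [List.getD_eq_getElem?_getD]
  exact option_getD.comp (list_getElem?.comp hf hg) hd

@[fun_prop]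
theorem fun_take {f : α → ℕ} {g : α → List β} (hf : Primrec f) (hg : Primrec g) :
    Primrec fun a => (g a).take (f a) := list_take.comp hf hg

@[fun_prop]
theorem fun_length {f : α → List β} (hf : Primrec f) : Primrec fun a => (f a).length :=
  list_length.comp hf

@[fun_prop]
theorem fun_cond {c : α → Bool} {f g : α → β} (hc : Primrec c) (hf : Primrec f)
    (hg : Primrec g) : Primrec fun a => bif c a then f a else g a := cond hc hf hg

@[fun_prop]
theorem fun_beq [DecidableEq β] {f g : α → β} (hf : Primrec f) (hg : Primrec g) :
    Primrec fun a => f a == g a := Primrec.beq.comp hf hg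

end Primrec

/-- A predicate which is the projection of a primitive recursive relation. -/
def Semidecidable (p : α → Prop) : Prop :=
  ∃ q : α → ℕ → Prop, PrimrecRel q ∧ ∀ a, p a ↔ ∃ n, q a n

theorem PrimrecPred.semidecidable {p : α → Prop} (hp : PrimrecPred p) : Semidecidable p :=
  ⟨fun a _ => p a, hp.comp Primrec.fst, fun _ => ⟨fun h => ⟨0, h⟩, fun ⟨_, h⟩ => h⟩⟩

namespace Semidecidable

theorem of_iff {p q : α → Prop} (hp : Semidecidable p) (h : ∀ a, q a ↔ p a) :
    Semidecidable q := by
  obtain ⟨r, hr, h'⟩ := hp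
  exact ⟨r, hr, fun a => (h a).trans (h' a)⟩

theorem comp {p : β → Prop} (hp : Semidecidable p) {f : α → β} (hf : Primrec f) :
    Semidecidable fun a => p (f a) := by
  obtain ⟨r, hr, h⟩ := hp
  exact ⟨fun a => r (f a), PrimrecRel.comp hr (by fun_prop) Primrec.snd, fun a => h (f a)⟩

theorem eq [DecidableEq β] {f g : α → β} (hf : Primrec f) (hg : Primrec g) :
    Semidecidable fun a => f a = g a :=
  (Primrec.eq.comp hf hg).semidecidable

theorem ne [DecidableEq β] {f g : α → β} (hf : Primrec f) (hg : Primrec g) :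
    Semidecidable fun a => f a ≠ g a :=
  (Primrec.eq.comp hf hg).not.semidecidable

theorem lt {f g : α → ℕ} (hf : Primrec f) (hg : Primrec g) :
    Semidecidable fun a => f a < g a :=
  (Primrec.nat_lt.comp hf hg).semidecidable

theorem ex {β : Type*} [Denumerable β] {p : α → β → Prop}
    (hp : Semidecidable fun s : α × β => p s.1 s.2) : Semidecidable fun a => ∃ b, p a b := by
  obtain ⟨r, hr, h⟩ := hp
  refine ⟨fun a n => r (a, ofNat β n.unpair.1) n.unpair.2,
    PrimrecRel.comp hr (by fun_prop) (by fun_prop), fun a => ?_⟩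
  constructor
  · rintro ⟨b, hb⟩
    obtain ⟨n, hn⟩ := (h (a, b)).1 hb
    exact ⟨Nat.pair (encode b) n, by simpa using hn⟩
  · rintro ⟨n, hn⟩
    exact ⟨_, (h (a, _)).2 ⟨_, hn⟩⟩

theorem and {p q : α → Prop} (hp : Semidecidable p) (hq : Semidecidable q) :
    Semidecidable fun a => p a ∧ q a := by
  obtain ⟨r, hr, h⟩ := hp
  obtain ⟨s, hs, h'⟩ := hq
  refine ⟨fun a n => r a n.unpair.1 ∧ s a n.unpair.2,
    (PrimrecRel.comp hr (by fun_prop) (by fun_prop)).and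
    (PrimrecRel.comp hs (by fun_prop) (by fun_prop)), fun a => ?_⟩
  refine (and_congr (h a) (h' a)).trans ?_
  constructor
  · rintro ⟨⟨m, hm⟩, n, hn⟩
    exact ⟨Nat.pair m n, by simpa using ⟨hm, hn⟩⟩
  · rintro ⟨n, hn⟩
    exact ⟨⟨_, hn.1⟩, _, hn.2⟩

theorem or {p q : α → Prop} (hp : Semidecidable p) (hq : Semidecidable q) :
    Semidecidable fun a => p a ∨ q a := by
  obtain ⟨r, hr, h⟩ := hp
  obtain ⟨s, hs, h'⟩ := hq
  refine ⟨fun a n => r a n ∨ s a n, PrimrecPred.or hr hs, fun a => ?_⟩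
  exact (or_congr (h a) (h' a)).trans exists_or.symm

/-- Finitely many witnesses have a common bound, so a single unbounded search for that bound
suffices. -/
theorem forall_lt {p : α → ℕ → Prop} {f : α → ℕ} (hf : Primrec f)
    (hp : Semidecidable fun s : α × ℕ => p s.1 s.2) :
    Semidecidable fun a => ∀ i < f a, p a i := by
  obtain ⟨r, hr, h⟩ := hp
  have h1 : PrimrecRel fun (n : ℕ) (s : α × ℕ) => r s n :=
    PrimrecRel.comp hr Primrec.snd Primrec.fst
  have h2 : PrimrecRel fun (i : ℕ) (s : α × ℕ) => ∃ n ∈ List.range s.2, r (s.1, i) n :=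
    h1.exists_mem_list.comp (Primrec.list_range.comp (by fun_prop)) (by fun_prop)
  refine ⟨fun a m => ∀ i ∈ List.range (f a), ∃ n ∈ List.range m, r (a, i) n,
    h2.forall_mem_list.comp (Primrec.list_range.comp (by fun_prop)) Primrec.id, fun a => ?_⟩
  simp only [List.mem_range]
  constructor
  · intro ha
    choose! g hg using fun i hi => (h (a, i)).1 (ha i hi)
    refine ⟨(Finset.range (f a)).sup g + 1, fun i hi => ⟨g i, Nat.lt_succ_of_le ?_, hg i hi⟩⟩
    exact Finset.le_sup (f := g) (Finset.mem_range.2 hi)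
  · rintro ⟨m, hm⟩ i hi
    obtain ⟨n, -, hn⟩ := hm i hi
    exact (h (a, i)).2 ⟨n, hn⟩

end Semidecidable

/-- Course-of-values recursion: the two premises are looked up in the list of earlier values. -/
theorem primrec_genVal {d : α → σ} {step : α → ℕ → σ → σ → σ} (hd : Primrec d)
    (hs : Primrec fun s : α × ℕ × σ × σ => step s.1 s.2.1 s.2.2.1 s.2.2.2) :
    Primrec₂ (genVal d step) := by
  refine Primrec.nat_strong_rec _ (g := fun a l => some (l.length.casesOn (d a) fun n =>
    step a n.unpair.1 (l.getD n.unpair.2.unpair.1 (d a)) (l.getD n.unpair.2.unpair.2 (d a)))) ?_ ?_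
  · refine Primrec.option_some.comp (Primrec.nat_casesOn (Primrec.list_length.comp Primrec.snd)
      (by fun_prop) ?_)
    exact hs.comp (f := fun s => step s.1 s.2.1 s.2.2.1 s.2.2.2) (g := fun s : (α × List σ) × ℕ =>
      (s.1.1, s.2.unpair.1, s.1.2.getD s.2.unpair.2.unpair.1 (d s.1.1),
        s.1.2.getD s.2.unpair.2.unpair.2 (d s.1.1))) (by fun_prop)
  · intro a n
    cases n with
    | zero => simp [genVal]
    | succ n =>
      have h1 : n.unpair.2.unpair.1 < n + 1 :=
        Nat.lt_succ_of_le ((Nat.unpair_left_le _).trans (Nat.unpair_right_le _))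
      have h2 : n.unpair.2.unpair.2 < n + 1 :=
        Nat.lt_succ_of_le ((Nat.unpair_right_le _).trans (Nat.unpair_right_le _))
      rw [genVal]
      simp [h1, h2]

theorem semidecidable_gen [DecidableEq σ] {d : α → σ} {step : α → ℕ → σ → σ → σ} (hd : Primrec d)
    (hs : Primrec fun s : α × ℕ × σ × σ => step s.1 s.2.1 s.2.2.1 s.2.2.2) :
    Semidecidable fun s : α × σ => Gen d step s.1 s.2 := by
  refine ⟨fun s n => genVal d step s.1 n = s.2, ?_, fun s => gen_iff⟩
  exact Primrec.eq.comp ((primrec_genVal hd hs).comp (Primrec.fst.comp Primrec.fst) Primrec.snd)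
    (Primrec.snd.comp Primrec.fst)

end PrimrecComp

end

/-! ### Derivable equality in a presented brace -/

section

open Encodable Denumerable

namespace BWord

instance : DecidableEq (BWord ℕ) := Encodable.decidableEqOfEncodable _

section

variable {α : Type*} [Primcodable α] {f g : α → BWord ℕ}

@[fun_prop]
theorem primrec_of {f : α → ℕ} (hf : Primrec f) : Primrec fun a => BWord.of (f a) :=
  Primrec.encode_iff.1 (show Primrec fun a => 5 * f a + 1 by fun_prop)

@[fun_prop]
theorem primrec_add (hf : Primrec f) (hg : Primrec g) : Primrec fun a => (f a).add (g a) :=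
  Primrec.encode_iff.1
    (show Primrec fun a => 5 * Nat.pair (encode (f a)) (encode (g a)) + 2 by fun_prop)

@[fun_prop]
theorem primrec_mul (hf : Primrec f) (hg : Primrec g) : Primrec fun a => (f a).mul (g a) :=
  Primrec.encode_iff.1
    (show Primrec fun a => 5 * Nat.pair (encode (f a)) (encode (g a)) + 3 by fun_prop)

@[fun_prop]
theorem primrec_neg (hf : Primrec f) : Primrec fun a => (f a).neg :=
  Primrec.encode_iff.1 (show Primrec fun a => 5 * encode (f a) + 4 by fun_prop)

@[fun_prop]
theorem primrec_inv (hf : Primrec f) : Primrec fun a => (f a).inv :=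
  Primrec.encode_iff.1 (show Primrec fun a => 5 * encode (f a) + 5 by fun_prop)

end

/-- The rules of equational derivations between `b`-words, for the presentation with code `P`: the
rule is selected by `t.1`, its premises are `p` and `q`. -/
def derivStep (P : ℕ × List (BWord ℕ)) (t : ℕ × BWord ℕ × BWord ℕ × BWord ℕ)
    (p q : BWord ℕ × BWord ℕ) : BWord ℕ × BWord ℕ :=
  [(t.2.1, t.2.1),
    (p.2, p.1),
    bif p.2 == q.1 then (p.1, q.2) else (empty, empty),
    (add p.1 q.1, add p.2 q.2),
    (mul p.1 q.1, mul p.2 q.2),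
    (neg p.1, neg p.2),
    (inv p.1, inv p.2),
    (add (add t.2.1 t.2.2.1) t.2.2.2, add t.2.1 (add t.2.2.1 t.2.2.2)),
    (add empty t.2.1, t.2.1),
    (add (neg t.2.1) t.2.1, empty),
    (mul (mul t.2.1 t.2.2.1) t.2.2.2, mul t.2.1 (mul t.2.2.1 t.2.2.2)),
    (mul empty t.2.1, t.2.1),
    (mul (inv t.2.1) t.2.1, empty),
    (mul t.2.1 (add t.2.2.1 t.2.2.2),
      add (add (mul t.2.1 t.2.2.1) (neg t.2.1)) (mul t.2.1 t.2.2.2)),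
    (P.2.getD (encode t.2.1) empty, empty),
    (of (P.1 + encode t.2.1), empty)].getD t.1 (empty, empty)

/-- Equality of two `b`-words is derivable from the relations of the presentation with code `P`. -/
def Deriv (P : ℕ × List (BWord ℕ)) (v w : BWord ℕ) : Prop :=
  Gen (fun _ => (empty, empty)) (fun P t => derivStep P (ofNat _ t)) P (v, w)

theorem semidecidable_deriv :
    Semidecidable fun s : (ℕ × List (BWord ℕ)) × BWord ℕ × BWord ℕ => Deriv s.1 s.2.1 s.2.2 := by
  refine semidecidable_gen (by fun_prop) ?_
  unfold derivStep
  fun_prop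

namespace Deriv

variable {P : ℕ × List (BWord ℕ)} {a a' b b' c : BWord ℕ}

theorem of_step (t : ℕ × BWord ℕ × BWord ℕ × BWord ℕ) (ha : Deriv P a a') (hb : Deriv P b b')
    {s : BWord ℕ × BWord ℕ} (hs : derivStep P t (a, a') (b, b') = s) : Deriv P s.1 s.2 := by
  have h := Gen.step (encode t) ha hb
  rw [ofNat_encode, hs] at h
  exact h

theorem empty_empty : Deriv P empty empty := Gen.base

theorem of_step₀ (t : ℕ × BWord ℕ × BWord ℕ × BWord ℕ) {s : BWord ℕ × BWord ℕ}
    (hs : derivStep P t (empty, empty) (empty, empty) = s) : Deriv P s.1 s.2 :=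
  of_step t empty_empty empty_empty hs

theorem refl (a : BWord ℕ) : Deriv P a a := of_step₀ (0, a, a, a) rfl

theorem symm (h : Deriv P a b) : Deriv P b a := of_step (1, a, a, a) h h rfl

theorem trans (h : Deriv P a b) (h' : Deriv P b c) : Deriv P a c :=
  of_step (2, a, a, a) h h' (s := (a, c)) (by simp [derivStep])

theorem of_relators (h : a ∈ P.2) : Deriv P a empty := by
  obtain ⟨i, hi, rfl⟩ := List.getElem_of_mem h
  refine of_step₀ (14, ofNat _ i, empty, empty) (s := (P.2[i], empty)) ?_
  simp [derivStep, hi]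

theorem of_of_le {i : ℕ} (h : P.1 ≤ i) : Deriv P (of i) empty := by
  refine of_step₀ (15, ofNat _ (i - P.1), empty, empty) (s := (of i, empty)) ?_
  simp [derivStep, h]

/-- Soundness of the rules. Rule numbers out of range, relator indices out of range and mismatched
transitivity premises yield only the trivial equality of empty words. -/
theorem eval_eq {B : Type v} [SkewBrace B] {x : ℕ → B} (hR : ∀ w ∈ P.2, w.eval x = 0)
    (hx : ∀ i, P.1 ≤ i → x i = 0) (h : Deriv P a b) : a.eval x = b.eval x := by
  suffices hs : ∀ s : BWord ℕ × BWord ℕ,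
      Gen (fun _ => (empty, empty)) (fun P t => derivStep P (ofNat _ t)) P s →
      s.1.eval x = s.2.eval x from hs _ h
  intro s hs
  induction hs with
  | base => rfl
  | step t _ _ ih ih' =>
    rename_i p q _ _
    obtain ⟨n, x₁, x₂, x₃⟩ := ofNat (ℕ × BWord ℕ × BWord ℕ × BWord ℕ) t
    rcases Nat.lt_or_ge n 16 with hn | hn
    · interval_cases n
      · rfl
      all_goals simp only [derivStep, List.getD_cons_zero, List.getD_cons_succ]
      · exact ih.symm
      · by_cases hpq : p.2 = q.1
        · simp [hpq, ih, ih']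
        · rw [beq_false_of_ne hpq]
          rfl
      · exact congrArg₂ (· + ·) ih ih'
      · exact congrArg₂ (· * ·) ih ih'
      · exact congrArg (- ·) ih
      · exact congrArg (·⁻¹) ih
      · exact FreeBrace.eval_eq_of_rel x (.add_assoc _ _ _)
      · exact FreeBrace.eval_eq_of_rel x (.zero_add _)
      · exact FreeBrace.eval_eq_of_rel x (.neg_add_cancel _)
      · exact FreeBrace.eval_eq_of_rel x (.mul_assoc _ _ _)
      · exact FreeBrace.eval_eq_of_rel x (.one_mul _)
      · exact FreeBrace.eval_eq_of_rel x (.inv_mul_cancel _)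
      · exact FreeBrace.eval_eq_of_rel x (.brace _ _ _)
      · rw [List.getD_eq_getElem?_getD]
        rcases lt_or_ge (encode x₁) P.2.length with h | h
        · rw [List.getElem?_eq_getElem h]
          exact hR _ (List.getElem_mem h)
        · rw [List.getElem?_eq_none h]
          rfl
      · exact hx _ (Nat.le_add_right _ _)
    · rw [derivStep, List.getD_eq_default]
      exact hn

/-- Derivable equality is a congruence. -/
def setoid (P : ℕ × List (BWord ℕ)) : Setoid (BWord ℕ) := ⟨Deriv P, refl, symm, trans⟩

end Deriv

/-- The skew brace of `b`-words modulo derivable equality. -/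
def Presented (P : ℕ × List (BWord ℕ)) : Type := Quotient (Deriv.setoid P)

namespace Presented

variable {P : ℕ × List (BWord ℕ)}

/-- The class of a `b`-word. -/
def mk (w : BWord ℕ) : Presented P := Quotient.mk _ w

instance : Add (Presented P) := ⟨Quotient.map₂ .add fun _ _ h _ _ h' =>
  Deriv.of_step (3, empty, empty, empty) h h' rfl⟩
instance : Mul (Presented P) := ⟨Quotient.map₂ .mul fun _ _ h _ _ h' =>
  Deriv.of_step (4, empty, empty, empty) h h' rfl⟩
instance : Neg (Presented P) := ⟨Quotient.map .neg fun _ _ h =>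
  Deriv.of_step (5, empty, empty, empty) h h rfl⟩
instance : Inv (Presented P) := ⟨Quotient.map .inv fun _ _ h =>
  Deriv.of_step (6, empty, empty, empty) h h rfl⟩
instance : Zero (Presented P) := ⟨mk .empty⟩
instance : One (Presented P) := ⟨mk .empty⟩

instance : SkewBrace (Presented P) where
  toAddGroup := AddGroup.ofLeftAxioms
    (by rintro ⟨a⟩ ⟨b⟩ ⟨c⟩; exact Quotient.sound (Deriv.of_step₀ (7, a, b, c) rfl))
    (by rintro ⟨a⟩; exact Quotient.sound (Deriv.of_step₀ (8, a, a, a) rfl))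
    (by rintro ⟨a⟩; exact Quotient.sound (Deriv.of_step₀ (9, a, a, a) rfl))
  toGroup := Group.ofLeftAxioms
    (by rintro ⟨a⟩ ⟨b⟩ ⟨c⟩; exact Quotient.sound (Deriv.of_step₀ (10, a, b, c) rfl))
    (by rintro ⟨a⟩; exact Quotient.sound (Deriv.of_step₀ (11, a, a, a) rfl))
    (by rintro ⟨a⟩; exact Quotient.sound (Deriv.of_step₀ (12, a, a, a) rfl))
  mul_add_eq := by
    rintro ⟨a⟩ ⟨b⟩ ⟨c⟩
    exact Quotient.sound (Deriv.of_step₀ (13, a, b, c) rfl)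

theorem eval_mk (w : BWord ℕ) : w.eval (fun i => (mk (of i) : Presented P)) = mk w := by
  induction w with
  | empty => rfl
  | of => rfl
  | add _ _ h h' => rw [eval, h, h']; rfl
  | mul _ _ h h' => rw [eval, h, h']; rfl
  | neg _ h => rw [eval, h]; rfl
  | inv _ h => rw [eval, h]; rfl

end Presented

theorem eval_map {X Y : Type*} {B : Type*} [SkewBrace B] (f : X → Y) (b : Y → B) (w : BWord X) :
    (w.map f).eval b = w.eval (b ∘ f) := by
  induction w with
  | empty => rfl
  | of => rfl
  | add _ _ h h' => rw [map, eval, eval, h, h']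
  | mul _ _ h h' => rw [map, eval, eval, h, h']
  | neg _ h => rw [map, eval, eval, h]
  | inv _ h => rw [map, eval, eval, h]

end BWord

theorem FreeBrace.eval_mk {X : Type*} (w : BWord X) :
    w.eval (fun x => FreeBrace.mk (.of x)) = FreeBrace.mk w := by
  induction w with
  | empty => rfl
  | of => rfl
  | add _ _ h h' => rw [BWord.eval, h, h']; rfl
  | mul _ _ h h' => rw [BWord.eval, h, h']; rfl
  | neg _ h => rw [BWord.eval, h]; rfl
  | inv _ h => rw [BWord.eval, h]; rfl

namespace FiniteBracePresentation

variable (P : FiniteBracePresentation)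

/-- The generators of the free brace, followed by zeros. -/
def gen (i : ℕ) : FreeBrace (Fin P.n) := if h : i < P.n then FreeBrace.mk (.of ⟨i, h⟩) else 0

theorem eval_gen_map (w : BWord (Fin P.n)) : (w.map Fin.val).eval P.gen = FreeBrace.mk w := by
  rw [BWord.eval_map, ← FreeBrace.eval_mk]
  congr 1
  ext i
  simp [gen]

variable {P} {B : Type u} [SkewBrace B] {θ : BraceHom (FreeBrace (Fin P.n)) B}

/-- The generators of `B`, followed by zeros. -/
def genOf (θ : BraceHom (FreeBrace (Fin P.n)) B) (i : ℕ) : B := θ.toFun (P.gen i)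

theorem genOf_of_le {i : ℕ} (h : P.n ≤ i) : genOf θ i = 0 := by
  rw [genOf, gen, dif_neg (not_lt.2 h), θ.map_zero]

theorem IsPresentation.eval_relator (h : P.IsPresentation θ) {w : BWord ℕ}
    (hw : w ∈ P.code.2) : w.eval (genOf θ) = 0 := by
  obtain ⟨r, hr, rfl⟩ := List.mem_map.1 hw
  change (r.map Fin.val).eval (fun i => θ.toFun (P.gen i)) = 0
  rw [← θ.map_eval, eval_gen_map]
  have h2 : FreeBrace.mk r ∈ {x | θ.toFun x = 0} := by
    rw [h.2]
    exact BraceIdeal.subset_span ⟨r, hr, rfl⟩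
  exact h2

theorem IsPresentation.exists_eval (h : P.IsPresentation θ) (b : B) :
    ∃ w : BWord ℕ, w.eval (genOf θ) = b := by
  obtain ⟨⟨w⟩, rfl⟩ := h.1 b
  refine ⟨w.map Fin.val, ?_⟩
  change (w.map Fin.val).eval (fun i => θ.toFun (P.gen i)) = _
  rw [← θ.map_eval, eval_gen_map]
  rfl

/-- The lift of `c` to the free brace kills the relators, hence the ideal they generate, which is
the kernel of θ. Symbols beyond the generators are evaluated as zero on both sides. -/
theorem IsPresentation.eval_eq_of_eq (h : P.IsPresentation θ) {C : Type v} [SkewBrace C]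
    {c : ℕ → C} (hR : ∀ w ∈ P.code.2, w.eval c = 0) (hc : ∀ i, P.n ≤ i → c i = 0)
    {v w : BWord ℕ} (hvw : v.eval (genOf θ) = w.eval (genOf θ)) : v.eval c = w.eval c := by
  let ψ : BraceHom (FreeBrace (Fin P.n)) C := FreeBrace.lift fun i => c i
  have hψ : ∀ w : BWord ℕ, ψ.toFun (w.eval P.gen) = w.eval c := by
    intro w
    rw [ψ.map_eval]
    congr 1
    ext i
    unfold gen
    split_ifs with hi
    · rfl
    · rw [ψ.map_zero, hc i (not_lt.1 hi)]
  have hker : ∀ x, θ.toFun x = 0 → ψ.toFun x = 0 := by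
    intro x hx
    have hx' : x ∈ {x | θ.toFun x = 0} := hx
    rw [h.2] at hx'
    refine BraceIdeal.span_le (I := BraceIdeal.ker ψ) ?_ hx'
    rintro _ ⟨r, hr, rfl⟩
    rw [BraceIdeal.mem_ker, ← eval_gen_map, hψ]
    exact hR _ (List.mem_map.2 ⟨r, hr, rfl⟩)
  rw [← hψ, ← hψ, ← sub_eq_zero, ← ψ.map_sub]
  refine hker _ ?_
  rw [θ.map_sub, sub_eq_zero, θ.map_eval, θ.map_eval]
  exact hvw

/-- Completeness follows from the universal property applied to the brace of words modulo derivable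
equality, where the relators and the superfluous symbols vanish. -/
theorem IsPresentation.deriv_iff (h : P.IsPresentation θ) {v w : BWord ℕ} :
    BWord.Deriv P.code v w ↔ v.eval (genOf θ) = w.eval (genOf θ) := by
  constructor
  · exact BWord.Deriv.eval_eq (fun w hw => h.eval_relator hw) fun i hi => genOf_of_le hi
  · intro hvw
    have := h.eval_eq_of_eq (C := BWord.Presented P.code) (c := fun i => .mk (.of i))
      (fun w hw => by
        rw [BWord.Presented.eval_mk]
        exact Quotient.sound (BWord.Deriv.of_relators hw))
      (fun i hi => Quotient.sound (BWord.Deriv.of_of_le hi)) hvw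
    rw [BWord.Presented.eval_mk, BWord.Presented.eval_mk] at this
    exact Quotient.exact this

/-- A homomorphism out of a presented brace. -/
theorem IsPresentation.exists_hom (h : P.IsPresentation θ) {C : Type v} [SkewBrace C]
    {c : ℕ → C} (hR : ∀ w ∈ P.code.2, w.eval c = 0) (hc : ∀ i, P.n ≤ i → c i = 0) :
    ∃ f : BraceHom B C, ∀ w : BWord ℕ, f.toFun (w.eval (genOf θ)) = w.eval c := by
  choose g hg using h.exists_eval
  have hkey : ∀ (b : B) (w : BWord ℕ), w.eval (genOf θ) = b → (g b).eval c = w.eval c :=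
    fun b w hw => h.eval_eq_of_eq hR hc ((hg b).trans hw.symm)
  refine ⟨⟨fun b => (g b).eval c, fun a b => ?_, fun a b => ?_⟩, fun w => hkey _ _ rfl⟩
  · exact hkey _ ((g a).add (g b)) (by rw [BWord.eval, hg, hg])
  · exact hkey _ ((g a).mul (g b)) (by rw [BWord.eval, hg, hg])

end FiniteBracePresentation

end

/-! ### Chains of ideals verified on finitely many generators -/

section

section Additive

variable {G : Type*} [AddGroup G]

/-- The additive subgroup generated by `a 0, ..., a (i - 1)`. -/
def initSpan (a : ℕ → G) (i : ℕ) : AddSubgroup G := AddSubgroup.closure (a '' Set.Iio i)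

theorem mem_initSpan {a : ℕ → G} {i j : ℕ} (h : j < i) : a j ∈ initSpan a i :=
  AddSubgroup.subset_closure ⟨j, h, rfl⟩

theorem initSpan_le {a : ℕ → G} {i : ℕ} {H : AddSubgroup G} (h : ∀ j < i, a j ∈ H) :
    initSpan a i ≤ H := by
  rw [initSpan, AddSubgroup.closure_le]
  rintro _ ⟨j, hj, rfl⟩
  exact h j hj

theorem initSpan_mono (a : ℕ → G) {i i' : ℕ} (h : i ≤ i') : initSpan a i ≤ initSpan a i' :=
  initSpan_le fun _ hj => mem_initSpan (lt_of_lt_of_le hj h)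

theorem initSpan_zero (a : ℕ → G) : initSpan a 0 = ⊥ := by
  rw [eq_bot_iff]
  exact initSpan_le fun j hj => absurd hj (Nat.not_lt_zero j)

/-- The elements which normalize `T`. -/
def conjStab (T : AddSubgroup G) : AddSubgroup G where
  carrier := {g | ∀ t ∈ T, g + t - g ∈ T ∧ -g + t + g ∈ T}
  zero_mem' t ht := by simp [ht]
  add_mem' {g h} hg hh t ht := by
    refine ⟨?_, ?_⟩
    · have := (hg _ (hh t ht).1).1
      simpa [sub_eq_add_neg, add_assoc] using this
    · have := (hh _ (hg t ht).2).2
      simpa [sub_eq_add_neg, add_assoc] using this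
  neg_mem' {g} hg t ht := by
    refine ⟨?_, ?_⟩
    · simpa [sub_eq_add_neg] using (hg t ht).2
    · simpa [sub_eq_add_neg] using (hg t ht).1

/-- Multiples of a and a + s lie in the same coset of T. Only a is known to normalize T, so this is
proved by induction rather than in a quotient group. -/
theorem neg_zsmul_add_zsmul_mem {T : AddSubgroup G} {a s : G} (ha : a ∈ conjStab T) (hs : s ∈ T)
    (k : ℤ) : -(k • a) + k • (a + s) ∈ T := by
  induction k with
  | zero => simp
  | succ k ih =>
    have h := T.add_mem (ha _ ih).2 hs
    have e : -(((k : ℤ) + 1) • a) + ((k : ℤ) + 1) • (a + s) =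
        -a + (-((k : ℤ) • a) + (k : ℤ) • (a + s)) + a + s := by
      rw [add_zsmul, add_zsmul, one_zsmul, one_zsmul, neg_add_rev]
      simp only [add_assoc]
    rwa [e]
  | pred k ih =>
    have h := (ha _ (T.sub_mem ih hs)).1
    have e : -((-(k : ℤ) - 1) • a) + (-(k : ℤ) - 1) • (a + s) =
        a + (-((-(k : ℤ)) • a) + (-(k : ℤ)) • (a + s) - s) - a := by
      have e1 : (-(k : ℤ) - 1) • a = (-(k : ℤ)) • a + -a := by
        rw [sub_eq_add_neg, add_zsmul, neg_one_zsmul]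
      have e2 : (-(k : ℤ) - 1) • (a + s) = (-(k : ℤ)) • (a + s) + -(a + s) := by
        rw [sub_eq_add_neg, add_zsmul, neg_one_zsmul]
      rw [e1, e2, neg_add_rev, neg_neg, neg_add_rev]
      simp only [add_assoc, sub_eq_add_neg]
    rwa [e]

/-- Since `a i` normalizes the previous span, sums of a multiple of `a i` and an element of that
span form a subgroup. -/
theorem exists_zsmul_add_of_mem_initSpan {a : ℕ → G} {i : ℕ} (ha : a i ∈ conjStab (initSpan a i))
    {x : G} (hx : x ∈ initSpan a (i + 1)) : ∃ k : ℤ, ∃ t ∈ initSpan a i, x = k • a i + t := by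
  let H : AddSubgroup G :=
    { carrier := {x | ∃ k : ℤ, ∃ t ∈ initSpan a i, x = k • a i + t}
      zero_mem' := ⟨0, 0, zero_mem _, by simp⟩
      add_mem' := by
        rintro _ _ ⟨k, t, ht, rfl⟩ ⟨l, s, hs, rfl⟩
        have h := ((conjStab _).zsmul_mem ha l t ht).2
        refine ⟨k + l, _, add_mem h hs, ?_⟩
        simp [add_zsmul, add_assoc]
      neg_mem' := by
        rintro _ ⟨k, t, ht, rfl⟩
        have h := ((conjStab _).zsmul_mem ha k _ (neg_mem ht)).1
        refine ⟨-k, _, h, ?_⟩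
        simp [sub_eq_add_neg, add_assoc] }
  refine initSpan_le (H := H) (fun j hj => ?_) hx
  rcases Nat.lt_succ_iff_lt_or_eq.1 hj with h | rfl
  · exact ⟨0, a j, mem_initSpan h, by simp⟩
  · exact ⟨1, 0, zero_mem _, by simp⟩

end Additive

open SkewBrace

variable {B : Type u} [SkewBrace B]

/-- The first `n` terms of `a` generate, one after the other, a chain of ideals of `B` whose factors
lie in the socle (`p i = 0`) or have order dividing the prime `p i`. -/
structure IdealChain (a : ℕ → B) (p : ℕ → ℕ) (n : ℕ) : Prop where
  lam_mem : ∀ j < n, ∀ k < p j + 2, ∀ i < n, lam (k • a j) (a i) ∈ initSpan a (i + 1)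
  lam_inv_mem : ∀ j < n, ∀ k < p j + 2, ∀ i < n, lam (k • a j)⁻¹ (a i) ∈ initSpan a (i + 1)
  add_conj_mem : ∀ j < n, ∀ i < n, a j + a i - a j ∈ initSpan a (i + 1)
  neg_conj_mem : ∀ j < n, ∀ i < n, -a j + a i + a j ∈ initSpan a (i + 1)
  star_mem : ∀ j < n, ∀ k < p j + 2, ∀ i < n, -a i + lam (k • a j) (a i) ∈ initSpan a (j + 1)
  factor : ∀ i < n, (p i = 0 ∧ ∀ j < n, -a j + lam (a i) (a j) ∈ initSpan a i ∧
    a i + a j - a i - a j ∈ initSpan a i) ∨ (p i).Prime ∧ p i • a i ∈ initSpan a i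

namespace IdealChain

variable {a : ℕ → B} {p : ℕ → ℕ} {n : ℕ}

theorem mem_conjStab (h : IdealChain a p n) {i j : ℕ} (hi : i ≤ n) (hj : j < n) :
    a j ∈ conjStab (initSpan a i) := by
  intro t ht
  constructor
  · have hle : initSpan a i ≤ (initSpan a i).comap (AddMonoidHom.mk' (fun x => a j + x - a j)
        fun x y => by simp [sub_eq_add_neg, add_assoc]) :=
      initSpan_le fun l hl => initSpan_mono a hl (h.add_conj_mem j hj l (hl.trans_le hi))
    exact hle ht
  · have hle : initSpan a i ≤ (initSpan a i).comap (AddMonoidHom.mk' (fun x => -a j + x + a j)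
        fun x y => by simp [add_assoc]) :=
      initSpan_le fun l hl => initSpan_mono a hl (h.neg_conj_mem j hj l (hl.trans_le hi))
    exact hle ht

theorem initSpan_le_conjStab (h : IdealChain a p n) {i : ℕ} (hi : i ≤ n) :
    initSpan a n ≤ conjStab (initSpan a i) :=
  initSpan_le fun _ hj => h.mem_conjStab hi hj

/-- The multiplicative subgroup generated by the small multiples of `a 0, ..., a (i - 1)`. -/
def mulSpan (a : ℕ → B) (p : ℕ → ℕ) (i : ℕ) : Subgroup B :=
  Subgroup.closure {g | ∃ j < i, ∃ k < p j + 2, g = k • a j}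

theorem nsmul_mem_mulSpan {i j k : ℕ} (hj : j < i) (hk : k < p j + 2) :
    k • a j ∈ mulSpan a p i := Subgroup.subset_closure ⟨j, hj, k, hk, rfl⟩

theorem mulSpan_mono {i i' : ℕ} (hi : i ≤ i') : mulSpan a p i ≤ mulSpan a p i' :=
  Subgroup.closure_mono fun _ ⟨j, hj, hx⟩ => ⟨j, hj.trans_le hi, hx⟩

/-- The elements g for which λ_g and its inverse both preserve the span form a multiplicative
subgroup. The conditions on inverses are needed because an injective map of an infinite group into
itself need not be onto. -/
theorem lam_mem_of_mem_mulSpan (h : IdealChain a p n) {i : ℕ} (hi : i ≤ n) {g : B}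
    (hg : g ∈ mulSpan a p n) :
    ∀ t ∈ initSpan a i, lam g t ∈ initSpan a i := by
  let H : Subgroup B :=
    { carrier := {g | ∀ t ∈ initSpan a i, lam g t ∈ initSpan a i ∧ lam g⁻¹ t ∈ initSpan a i}
      one_mem' := fun t ht => by rw [inv_one, lam_one]; exact ⟨ht, ht⟩
      mul_mem' := fun {g g'} hg hg' t ht => by
        rw [mul_inv_rev, lam_mul, lam_mul]
        exact ⟨(hg _ (hg' t ht).1).1, (hg' _ (hg t ht).2).2⟩
      inv_mem' := fun {g} hg t ht => by
        rw [inv_inv]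
        exact (hg t ht).symm }
  have hH : mulSpan a p n ≤ H := by
    refine (Subgroup.closure_le _).2 ?_
    rintro _ ⟨j, hj, k, hk, rfl⟩ t ht
    constructor
    · have hle : initSpan a i ≤ (initSpan a i).comap (lamHom (k • a j)) :=
        initSpan_le fun l hl => initSpan_mono a hl (h.lam_mem j hj k hk l (hl.trans_le hi))
      exact hle ht
    · have hle : initSpan a i ≤ (initSpan a i).comap (lamHom (k • a j)⁻¹) :=
        initSpan_le fun l hl => initSpan_mono a hl (h.lam_inv_mem j hj k hk l (hl.trans_le hi))
      exact hle ht
  exact fun t ht => (hH hg t ht).1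

/-- g + t is the product of g and λ_{g⁻¹}(t), and the second factor stays in the smaller span. -/
theorem add_mem_mulSpan (h : IdealChain a p n) {i i' : ℕ} (hi : i ≤ i') (hi' : i' ≤ n)
    (ih : ∀ t ∈ initSpan a i, t ∈ mulSpan a p i) {g t : B} (hg : g ∈ mulSpan a p i')
    (ht : t ∈ initSpan a i) : g + t ∈ mulSpan a p i' := by
  rw [add_eq]
  refine mul_mem hg (mulSpan_mono hi (ih _ ?_))
  exact h.lam_mem_of_mem_mulSpan (hi.trans hi') (mulSpan_mono hi' (inv_mem hg)) t ht

/-- Induction along the chain; an element of the next span is k • a i + t. In the socle case k • a i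
is reached by multiplying by `a i` or its inverse, up to errors in the previous span; in the prime
case k is reduced modulo p. The bound `p j + 2` on the multiples provides `a j` itself when `p j =
0`, and all residues otherwise. -/
theorem mem_mulSpan (h : IdealChain a p n) {i : ℕ} (hi : i ≤ n) :
    ∀ t ∈ initSpan a i, t ∈ mulSpan a p i := by
  induction i with
  | zero =>
    intro t ht
    rw [initSpan_zero, AddSubgroup.mem_bot] at ht
    rw [ht, ← one_eq_zero]
    exact one_mem _
  | succ i ih =>
    specialize ih (by omega)
    have hin : i < n := hi
    intro x hx
    have hconj := h.mem_conjStab hin.le hin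
    obtain ⟨k, t, ht, rfl⟩ := exists_zsmul_add_of_mem_initSpan hconj hx
    rcases h.factor i hin with ⟨-, hf⟩ | ⟨hp, hpa⟩
    · refine h.add_mem_mulSpan (Nat.le_succ i) hi ih ?_ ht
      have ha : a i ∈ mulSpan a p (i + 1) := by
        have := nsmul_mem_mulSpan (a := a) (p := p) (k := 1) (Nat.lt_succ_self i) (by omega)
        rwa [one_nsmul] at this
      -- The socle condition with j = i: λ_{a i} sends a i to a i + s with s in the previous span.
      set s := -a i + lam (a i) (a i) with hs
      have hsT : s ∈ initSpan a i := (hf i hin).1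
      have hlam : lam (a i) (a i) = a i + s := by rw [hs, add_neg_cancel_left]
      have hlam' : lam (a i)⁻¹ (a i) = a i + -lam (a i)⁻¹ s := by
        rw [eq_add_neg_iff_add_eq, ← lam_add, ← hlam, lam_inv_lam]
      have hsT' : -lam (a i)⁻¹ s ∈ initSpan a i :=
        neg_mem (h.lam_mem_of_mem_mulSpan hin.le (mulSpan_mono hi (inv_mem ha)) s hsT)
      set s' := -lam (a i)⁻¹ s
      -- Membership in the multiplicative span depends only on the left coset modulo the previous
      -- additive span.
      have key : ∀ g y : B, g ∈ mulSpan a p (i + 1) → -y + g ∈ initSpan a i →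
          y ∈ mulSpan a p (i + 1) := by
        intro g y hg hy
        have h2 := h.add_mem_mulSpan (Nat.le_succ i) hi ih hg (neg_mem hy)
        rwa [neg_add_rev, neg_neg, add_neg_cancel_left] at h2
      clear hx
      induction k with
      | zero =>
        rw [zero_zsmul, ← one_eq_zero]
        exact one_mem _
      | succ k ihk =>
        refine key _ _ (mul_mem ha ihk) ?_
        rw [mul_eq, lam_zsmul, hlam, add_comm (k : ℤ) 1, add_zsmul, one_zsmul, neg_add_rev,
          add_assoc, neg_add_cancel_left]
        exact neg_zsmul_add_zsmul_mem hconj hsT _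
      | pred k ihk =>
        refine key _ _ (mul_mem (inv_mem ha) ihk) ?_
        have hinv : (a i)⁻¹ = -(a i + s') := by rw [inv_eq_neg_lam, hlam']
        have hsub : (-(k : ℤ) - 1) • (a i + s') = -(a i + s') + -(k : ℤ) • (a i + s') := by
          rw [← neg_one_zsmul (a i + s'), ← add_zsmul, sub_eq_neg_add]
        rw [mul_eq, lam_zsmul, hlam', hinv, ← hsub]
        exact neg_zsmul_add_zsmul_mem hconj hsT' _
    · have hp0 : (0 : ℤ) < p i := by exact_mod_cast hp.pos
      have hk := Int.emod_add_mul_ediv k (p i)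
      have h0 := Int.emod_nonneg k hp0.ne'
      have h1 := Int.emod_lt_of_pos k hp0
      obtain ⟨r, hr⟩ := Int.eq_ofNat_of_zero_le h0
      -- Division with remainder: the quotient contributes a multiple of p i • a i, which lies in
      -- the previous span.
      have hka : k • a i = r • a i + (k / (p i : ℤ)) • p i • a i := by
        conv_lhs => rw [← hk, add_zsmul, mul_comm, mul_zsmul, natCast_zsmul, hr]
        rw [natCast_zsmul]
      rw [hka, add_assoc]
      refine h.add_mem_mulSpan (Nat.le_succ i) hi ih
        (nsmul_mem_mulSpan (Nat.lt_succ_self i) (by omega)) ?_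
      exact add_mem (zsmul_mem hpa _) ht

theorem mem_initSpan_of_mem_mulSpan (h : IdealChain a p n) {g : B} (hg : g ∈ mulSpan a p n) :
    g ∈ initSpan a n := by
  let H : Subgroup B :=
    { carrier := {g | g ∈ mulSpan a p n ∧ g ∈ initSpan a n}
      one_mem' := ⟨one_mem _, by rw [one_eq_zero]; exact zero_mem _⟩
      mul_mem' := fun {x y} hx hy => ⟨mul_mem hx.1 hy.1, by
        rw [mul_eq]
        exact add_mem hx.2 (h.lam_mem_of_mem_mulSpan le_rfl hx.1 _ hy.2)⟩
      inv_mem' := fun {x} hx => ⟨inv_mem hx.1, by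
        rw [inv_eq_neg_lam]
        exact neg_mem (h.lam_mem_of_mem_mulSpan le_rfl (inv_mem hx.1) _ hx.2)⟩ }
  have hle : mulSpan a p n ≤ H := by
    refine (Subgroup.closure_le _).2 ?_
    rintro _ ⟨j, hj, k, hk, rfl⟩
    exact ⟨nsmul_mem_mulSpan hj hk, nsmul_mem (mem_initSpan hj) k⟩
  exact (hle hg).2

theorem mem_mulSpan_iff (h : IdealChain a p n) {g : B} : g ∈ mulSpan a p n ↔ g ∈ initSpan a n :=
  ⟨h.mem_initSpan_of_mem_mulSpan, h.mem_mulSpan le_rfl g⟩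

/-- The ideals of the chain. -/
def ideal (h : IdealChain a p n) (hB : ∀ b, b ∈ initSpan a n)
    (i : ℕ) (hi : i ≤ n) : BraceIdeal B :=
  have hl : ∀ b, ∀ t ∈ initSpan a i, lam b t ∈ initSpan a i := fun b =>
    h.lam_mem_of_mem_mulSpan hi (h.mem_mulSpan_iff.2 (hB b))
  have hc : ∀ b, ∀ t ∈ initSpan a i, b + t - b ∈ initSpan a i := fun b t ht =>
    (h.initSpan_le_conjStab hi (hB b) t ht).1
  BraceIdeal.ofAdd (initSpan a i) hl hc (by
    -- Elements acting trivially modulo the span form a multiplicative subgroup, so generators of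
    -- `mulSpan` suffice.
    let H : Subgroup B :=
      { carrier := {g | ∀ b, -b + lam g b ∈ initSpan a i}
        one_mem' := fun b => by rw [lam_one, neg_add_cancel]; exact zero_mem _
        mul_mem' := fun {x y} hx hy b => by
          have := add_mem (hy b) (hx (lam y b))
          rwa [add_assoc, add_neg_cancel_left, ← lam_mul] at this
        inv_mem' := fun {x} hx b => by
          have := neg_mem (hx (lam x⁻¹ b))
          rwa [lam_lam_inv, neg_add_rev, neg_neg] at this }
    have hle : mulSpan a p i ≤ H := by
      refine (Subgroup.closure_le _).2 ?_
      rintro _ ⟨j, hj, k, hk, rfl⟩ b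
      -- For fixed g, the b with -b + λ_g(b) in the span form an additive subgroup because the span
      -- is normal, so b may be taken among the `a l`.
      let K : AddSubgroup B :=
        { carrier := {b | -b + lam (k • a j) b ∈ initSpan a i}
          zero_mem' := by
            change -(0 : B) + lam (k • a j) 0 ∈ initSpan a i
            rw [lam_zero_right, neg_zero, zero_add]
            exact zero_mem _
          add_mem' := fun {x y} hx hy => by
            have := add_mem (hc (-y) _ hx) hy
            change -(x + y) + lam (k • a j) (x + y) ∈ initSpan a i
            rw [lam_add, neg_add_rev]
            simpa [sub_eq_add_neg, add_assoc] using this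
          neg_mem' := fun {x} hx => by
            have := hc x _ (neg_mem hx)
            change - -x + lam (k • a j) (-x) ∈ initSpan a i
            rw [lam_neg]
            simpa [sub_eq_add_neg, add_assoc] using this }
      have hK : initSpan a n ≤ K := initSpan_le fun l hl =>
        initSpan_mono a hj (h.star_mem j (hj.trans_le hi) k hk l hl)
      exact hK (hB b)
    exact fun b t ht => hle (h.mem_mulSpan hi t ht) b)

theorem mem_ideal (h : IdealChain a p n) (hB : ∀ b, b ∈ initSpan a n)
    {i : ℕ} (hi : i ≤ n) {x : B} : x ∈ h.ideal hB i hi ↔ x ∈ initSpan a i := Iff.rfl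

theorem step (h : IdealChain a p n) (hB : ∀ b, b ∈ initSpan a n) (i : ℕ) (hi : i < n) :
    BraceIdeal.Step (h.ideal hB i hi.le) (h.ideal hB (i + 1) hi) := by
  refine ⟨fun x hx => initSpan_mono a (Nat.le_succ i) hx, a i, mem_initSpan (Nat.lt_succ_self i),
    fun x hx => ?_, ?_⟩
  · obtain ⟨k, t, ht, rfl⟩ :=
      exists_zsmul_add_of_mem_initSpan (h.mem_conjStab hi.le hi) ((h.mem_ideal hB _).1 hx)
    refine ⟨k, ?_⟩
    rw [map_add, map_zsmul, (BraceIdeal.proj_eq_zero _).2 ((h.mem_ideal hB hi.le).2 ht), add_zero]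
  · set J := h.ideal hB i hi.le
    rcases h.factor i hi with ⟨-, hf⟩ | ⟨hp, hpa⟩
    · left
      refine ⟨fun b => ?_, fun b => ?_⟩
      · obtain ⟨b, rfl⟩ := J.proj_surjective b
        have hle : initSpan a n ≤
            ((lamHom (J.proj (a i))).comp J.proj).eqLocus J.proj := initSpan_le fun j hj => by
          change lam (J.proj (a i)) (J.proj (a j)) = J.proj (a j)
          rw [← BraceIdeal.proj_lam, eq_comm, J.proj_eq]
          exact (hf j hj).1
        exact hle (hB b)
      · obtain ⟨b, rfl⟩ := J.proj_surjective b
        have hle : initSpan a n ≤ (AddSubgroup.centralizer {J.proj (a i)}).comap J.proj :=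
          initSpan_le fun j hj => by
            rw [AddSubgroup.mem_comap, AddSubgroup.mem_centralizer_singleton_iff]
            have h2 : J.proj (a i + a j - a i - a j) = 0 := J.proj_eq_zero.2 (hf j hj).2
            rw [map_sub, map_sub, map_add, sub_eq_zero, sub_eq_iff_eq_add] at h2
            exact h2.symm
        have h2 := hle (hB b)
        rw [AddSubgroup.mem_comap, AddSubgroup.mem_centralizer_singleton_iff] at h2
        exact h2.symm
    · right
      refine ⟨p i, hp, ?_⟩
      rw [← map_nsmul]
      exact J.proj_eq_zero.2 hpa

/-- Braces with a chain of ideals as above are supersoluble. -/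
theorem isSupersoluble (h : IdealChain a p n) (hB : ∀ b, b ∈ initSpan a n) : IsSupersoluble B := by
  rw [BraceIdeal.isSupersoluble_iff_up]
  have key : ∀ j (hj : j ≤ n), BraceIdeal.Up (h.ideal hB (n - j) (Nat.sub_le n j)) := by
    intro j hj
    induction j with
    | zero => exact BraceIdeal.Up.top _ hB
    | succ j ih =>
      have h1 := h.step hB (n - (j + 1)) (by omega)
      have h2 := ih (by omega)
      have e : n - (j + 1) + 1 = n - j := by omega
      simp only [e] at h1
      exact BraceIdeal.Up.step _ _ h1 h2
  have h1 := key n le_rfl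
  have h2 : h.ideal hB (n - n) (Nat.sub_le n n) = BraceIdeal.zero B := by
    ext x
    rw [mem_ideal, Nat.sub_self, initSpan_zero]
    rfl
  rwa [h2] at h1

end IdealChain

theorem BraceIdeal.Up.exists_chain {J : BraceIdeal B} (h : BraceIdeal.Up J) :
    ∃ (n : ℕ) (I : ℕ → BraceIdeal B), I 0 = J ∧ (∀ x, x ∈ I n) ∧
      ∀ i < n, BraceIdeal.Step (I i) (I (i + 1)) := by
  induction h with
  | top J h => exact ⟨0, fun _ => J, rfl, h, fun i hi => absurd hi (Nat.not_lt_zero i)⟩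
  | step J J' h _ ih =>
    obtain ⟨n, I, h0, hn, hI⟩ := ih
    refine ⟨n + 1, fun i => Nat.casesOn i J I, rfl, hn, fun i hi => ?_⟩
    cases i with
    | zero => simpa [h0] using h
    | succ i => exact hI i (by omega)

/-- The `a i` are generators of the successive cyclic factors. Beyond the chain both sequences are
zero, in agreement with the default values of finite lists. -/
theorem SkewBrace.IsSupersoluble.exists_idealChain (h : IsSupersoluble B) :
    ∃ (a : ℕ → B) (p : ℕ → ℕ) (n : ℕ), IdealChain a p n ∧ (∀ b, b ∈ initSpan a n) ∧
      ∀ i, n ≤ i → a i = 0 ∧ p i = 0 := by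
  rw [BraceIdeal.isSupersoluble_iff_up] at h
  obtain ⟨n, I, h0, hn, hI⟩ := h.exists_chain
  have hI' : ∀ i, ∃ (c : B) (p : ℕ), (n ≤ i → c = 0 ∧ p = 0) ∧ (i < n →
      (∀ x ∈ I i, x ∈ I (i + 1)) ∧ c ∈ I (i + 1) ∧
      (∀ x ∈ I (i + 1), ∃ k : ℤ, (I i).proj x = k • (I i).proj c) ∧
      ((p = 0 ∧ (I i).proj c ∈ SkewBrace.socle (I i).Quot) ∨
        p.Prime ∧ p • (I i).proj c = 0)) := by
    intro i
    by_cases hi : i < n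
    · obtain ⟨hle, c, hc, hgen, h | ⟨p, hp, h⟩⟩ := hI i hi
      · exact ⟨c, 0, fun h => absurd hi h.not_gt, fun _ => ⟨hle, hc, hgen, Or.inl ⟨rfl, h⟩⟩⟩
      · exact ⟨c, p, fun h => absurd hi h.not_gt, fun _ => ⟨hle, hc, hgen, Or.inr ⟨hp, h⟩⟩⟩
    · exact ⟨0, 0, fun _ => ⟨rfl, rfl⟩, fun h => absurd h hi⟩
  choose a p hap0 hap using hI'
  have hspan : ∀ i ≤ n, ∀ x, x ∈ initSpan a i ↔ x ∈ I i := by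
    intro i
    induction i with
    | zero =>
      intro _ x
      rw [initSpan_zero, h0]
      rfl
    | succ i ih =>
      intro hi x
      specialize ih (by omega)
      obtain ⟨hle, hc, hgen, -⟩ := hap i hi
      constructor
      · have h1 : initSpan a (i + 1) ≤ (I (i + 1)).toAddSubgroup := by
          refine initSpan_le fun j hj => ?_
          rcases Nat.lt_succ_iff_lt_or_eq.1 hj with h | rfl
          · exact hle _ ((ih _).1 (mem_initSpan h))
          · exact hc
        exact fun hx => h1 hx
      · intro hx
        obtain ⟨k, hk⟩ := hgen x hx
        rw [eq_comm, ← map_zsmul, (I i).proj_eq] at hk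
        have h1 := add_mem (zsmul_mem (mem_initSpan (a := a) (Nat.lt_succ_self i)) k)
          (initSpan_mono a (Nat.le_succ i) ((ih _).2 hk))
        rwa [add_neg_cancel_left] at h1
  have ha : ∀ i < n, a i ∈ I (i + 1) := fun i hi => (hap i hi).2.1
  refine ⟨a, p, n, ⟨?_, ?_, ?_, ?_, ?_, ?_⟩, fun b => (hspan n le_rfl b).2 (hn b), hap0⟩
  · exact fun j _ k _ i hi => (hspan _ hi _).2 ((I (i + 1)).lam_mem' _ (ha i hi))
  · exact fun j _ k _ i hi => (hspan _ hi _).2 ((I (i + 1)).lam_mem' _ (ha i hi))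
  · exact fun j _ i hi => (hspan _ hi _).2 ((I (i + 1)).add_conj_mem' _ (ha i hi))
  · intro j _ i hi
    have := (I (i + 1)).add_conj_mem' (-a j) (ha i hi)
    rw [sub_neg_eq_add] at this
    exact (hspan _ hi _).2 this
  · intro j hj k _ i _
    refine (hspan _ hj _).2 ((I (j + 1)).star_mem ?_ _)
    exact (I (j + 1)).toAddSubgroup.nsmul_mem (ha j hj) k
  · intro i hi
    rcases (hap i hi).2.2.2 with ⟨hp, hs⟩ | ⟨hp, hpa⟩
    · refine Or.inl ⟨hp, fun j _ => ⟨?_, ?_⟩⟩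
      · rw [hspan i hi.le, ← BraceIdeal.mem_carrier, ← (I i).proj_eq, BraceIdeal.proj_lam, hs.1]
      · rw [hspan i hi.le, ← BraceIdeal.proj_eq_zero, map_sub, map_sub, map_add, hs.2,
          add_sub_cancel_right, sub_self]
    · refine Or.inr ⟨hp, ?_⟩
      rw [hspan i hi.le, ← BraceIdeal.proj_eq_zero, map_nsmul, hpa]

/-- The full span is at once an additive and a multiplicative subgroup, hence closed under all
operations of words. -/
theorem IdealChain.eval_mem {a : ℕ → B} {p : ℕ → ℕ} {n : ℕ} (h : IdealChain a p n) {x : ℕ → B}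
    (hx : ∀ i, x i ∈ initSpan a n) (w : BWord ℕ) : w.eval x ∈ initSpan a n := by
  induction w with
  | empty => exact zero_mem _
  | of i => exact hx i
  | add v w hv hw => exact add_mem hv hw
  | mul v w hv hw =>
    rw [← h.mem_mulSpan_iff] at *
    exact mul_mem hv hw
  | neg w hw => exact neg_mem hw
  | inv w hw =>
    rw [← h.mem_mulSpan_iff] at *
    exact inv_mem hw

end

/-! ### Certificates of supersolubility -/

section

open Encodable Denumerable FiniteBracePresentation

section

variable {α β σ : Type*} [Primcodable α] [Primcodable β] [Primcodable σ]

theorem Primrec.fun_foldr {f : α → List β} {g : α → σ} {h : α → β → σ → σ} (hf : Primrec f)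
    (hg : Primrec g) (hh : Primrec fun s : α × β × σ => h s.1 s.2.1 s.2.2) :
    Primrec fun a => (f a).foldr (h a) (g a) :=
  Primrec.list_foldr (h := fun a s => h a s.1 s.2) hf hg hh

theorem semidecidable_prime : Semidecidable Nat.Prime := by
  refine Semidecidable.of_iff (p := fun p => 1 < p ∧ ∀ m < p, p % m ≠ 0 ∨ m = 1) ?_ ?_
  · refine .and (.lt (by fun_prop) (by fun_prop)) (.forall_lt (by fun_prop) (.or ?_ ?_))
    · exact .ne (by fun_prop) (by fun_prop)
    · exact .eq (by fun_prop) (by fun_prop)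
  · intro p
    rw [Nat.prime_def_lt]
    refine and_congr Iff.rfl (forall₂_congr fun m _ => ?_)
    rw [Nat.dvd_iff_mod_eq_zero, imp_iff_not_or]

end

namespace BWord

/-- The sum of the words `± A[j]` listed in `c`. -/
def comb (A : List (BWord ℕ)) (c : List (ℕ × ℕ)) : BWord ℕ :=
  c.foldr (fun e w => add (bif e.1 == 0 then A.getD e.2 empty else neg (A.getD e.2 empty)) w) empty

/-- The `k`-th multiple of a word. -/
def nmul (k : ℕ) (w : BWord ℕ) : BWord ℕ := k.rec empty fun _ v => add v w

/-- The word for `λ_v(w)`. -/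
def lamW (v w : BWord ℕ) : BWord ℕ := add (neg v) (mul v w)

section

variable {α : Type*} [Primcodable α]

@[fun_prop]
theorem primrec_comb {f : α → List (BWord ℕ)} {g : α → List (ℕ × ℕ)} (hf : Primrec f)
    (hg : Primrec g) : Primrec fun a => comb (f a) (g a) :=
  Primrec.fun_foldr hg (by fun_prop) (by fun_prop)

@[fun_prop]
theorem primrec_nmul {f : α → ℕ} {g : α → BWord ℕ} (hf : Primrec f) (hg : Primrec g) :
    Primrec fun a => nmul (f a) (g a) :=
  Primrec.nat_rec' (h := fun a s => add s.2 (g a)) hf (by fun_prop)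
    (show Primrec fun s : α × ℕ × BWord ℕ => add s.2.2 (g s.1) by fun_prop)

@[fun_prop]
theorem primrec_lamW {f g : α → BWord ℕ} (hf : Primrec f) (hg : Primrec g) :
    Primrec fun a => lamW (f a) (g a) := by
  unfold lamW
  fun_prop

end

section

variable {B : Type u} [SkewBrace B] (x : ℕ → B)

theorem eval_nmul (k : ℕ) (w : BWord ℕ) : (nmul k w).eval x = k • w.eval x := by
  induction k with
  | zero => rw [zero_nsmul]; rfl
  | succ k ih => rw [succ_nsmul, ← ih]; rfl

theorem eval_lamW (v w : BWord ℕ) : (lamW v w).eval x = SkewBrace.lam (v.eval x) (w.eval x) := rfl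

theorem eval_comb_append (A : List (BWord ℕ)) (c d : List (ℕ × ℕ)) :
    (comb A (c ++ d)).eval x = (comb A c).eval x + (comb A d).eval x := by
  induction c with
  | nil => exact (zero_add _).symm
  | cons e c ih =>
    change (add _ (comb A (c ++ d))).eval x = (add _ (comb A c)).eval x + _
    rw [eval, eval, ih, add_assoc]

theorem mem_closure_iff_exists_comb (A : List (BWord ℕ)) (b : B) :
    b ∈ AddSubgroup.closure (Set.range fun j => (A.getD j empty).eval x) ↔
      ∃ c, (comb A c).eval x = b := by
  constructor
  · let H : AddSubgroup B :=
      { carrier := {b | ∃ c, (comb A c).eval x = b}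
        zero_mem' := ⟨[], rfl⟩
        add_mem' := by
          rintro _ _ ⟨c, rfl⟩ ⟨d, rfl⟩
          exact ⟨c ++ d, eval_comb_append x A c d⟩
        neg_mem' := by
          rintro _ ⟨c, rfl⟩
          induction c with
          | nil => exact ⟨[], neg_zero.symm⟩
          | cons e c ih =>
            obtain ⟨d, hd⟩ := ih
            refine ⟨d ++ [(bif e.1 == 0 then 1 else 0, e.2)], ?_⟩
            change _ = -(add _ (comb A c)).eval x
            rw [eval_comb_append, eval, neg_add_rev, hd]
            congr 1
            change (add _ empty).eval x = _
            cases e.1 == 0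
            · exact (add_zero _).trans (neg_neg _).symm
            · exact add_zero _ }
    intro hb
    have hle : AddSubgroup.closure (Set.range fun j => (A.getD j empty).eval x) ≤ H := by
      rw [AddSubgroup.closure_le]
      rintro _ ⟨j, rfl⟩
      exact ⟨[(0, j)], add_zero _⟩
    exact hle hb
  · rintro ⟨c, rfl⟩
    induction c with
    | nil => exact zero_mem _
    | cons e c ih =>
      refine add_mem ?_ ih
      have h : (A.getD e.2 empty).eval x ∈
        AddSubgroup.closure (Set.range fun j => (A.getD j empty).eval x) :=
        AddSubgroup.subset_closure ⟨e.2, rfl⟩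
      cases e.1 == 0
      · exact neg_mem h
      · exact h

/-- Beyond the truncation the default word is empty and evaluates to 0, so it adds nothing to the
span. -/
theorem closure_take (A : List (BWord ℕ)) (i : ℕ) :
    AddSubgroup.closure (Set.range fun j => ((A.take i).getD j empty).eval x) =
      initSpan (fun j => (A.getD j empty).eval x) i := by
  apply le_antisymm
  · rw [AddSubgroup.closure_le]
    rintro _ ⟨j, rfl⟩
    rcases lt_or_ge j i with h | h
    · have h2 := mem_initSpan (a := fun j => (A.getD j empty).eval x) h
      simpa [List.getD_eq_getElem?_getD, List.getElem?_take_of_lt h] using h2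
    · beta_reduce
      rw [List.getD_eq_default]
      · exact zero_mem _
      · exact (List.length_take_le _ _).trans h
  · refine initSpan_le fun j hj => AddSubgroup.subset_closure ⟨j, ?_⟩
    simp [List.getD_eq_getElem?_getD, List.getElem?_take_of_lt hj]

end

/-- In the brace with code `P`, the word `w` represents an element of the additive subgroup
generated by the list `A`. -/
def InSpan (P : ℕ × List (BWord ℕ)) (A : List (BWord ℕ)) (w : BWord ℕ) : Prop :=
  ∃ c, Deriv P (comb A c) w

theorem semidecidable_inSpan {α : Type*} [Primcodable α] {f : α → ℕ × List (BWord ℕ)}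
    {g : α → List (BWord ℕ)} {h : α → BWord ℕ} (hf : Primrec f) (hg : Primrec g)
    (hh : Primrec h) : Semidecidable fun a => InSpan (f a) (g a) (h a) :=
  .ex (semidecidable_deriv.comp
    (f := fun s : α × List (ℕ × ℕ) => (f s.1, comb (g s.1) s.2, h s.1)) (by fun_prop))

theorem inSpan_iff {P : FiniteBracePresentation} {B : Type u} [SkewBrace B]
    {θ : BraceHom (FreeBrace (Fin P.n)) B} (hθ : P.IsPresentation θ) (A : List (BWord ℕ)) (i : ℕ)
    (w : BWord ℕ) : InSpan P.code (A.take i) w ↔ w.eval (genOf θ) ∈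
      initSpan (fun j => (A.getD j empty).eval (genOf θ)) i := by
  rw [← closure_take, mem_closure_iff_exists_comb, InSpan]
  simp only [hθ.deriv_iff]

/-- The lists `A` and `p` describe a chain of ideals of the brace with code `P`. -/
def PosCert (P : ℕ × List (BWord ℕ)) (A : List (BWord ℕ)) (p : List ℕ) : Prop :=
  (∀ j < A.length, ∀ k < p.getD j 0 + 2, ∀ i < A.length,
    InSpan P (A.take (i + 1)) (lamW (nmul k (A.getD j empty)) (A.getD i empty)) ∧
    InSpan P (A.take (i + 1)) (lamW (inv (nmul k (A.getD j empty))) (A.getD i empty)) ∧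
    InSpan P (A.take (i + 1))
      (add (add (A.getD j empty) (A.getD i empty)) (neg (A.getD j empty))) ∧
    InSpan P (A.take (i + 1))
      (add (add (neg (A.getD j empty)) (A.getD i empty)) (A.getD j empty)) ∧
    InSpan P (A.take (j + 1))
      (add (neg (A.getD i empty)) (lamW (nmul k (A.getD j empty)) (A.getD i empty)))) ∧
  (∀ i < A.length, (p.getD i 0 = 0 ∧ ∀ j < A.length,
      InSpan P (A.take i) (add (neg (A.getD j empty)) (lamW (A.getD i empty) (A.getD j empty))) ∧
      InSpan P (A.take i) (add (add (add (A.getD i empty) (A.getD j empty))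
        (neg (A.getD i empty))) (neg (A.getD j empty)))) ∨
    (p.getD i 0).Prime ∧ InSpan P (A.take i) (nmul (p.getD i 0) (A.getD i empty))) ∧
  ∀ s < P.1, InSpan P (A.take A.length) (of s)

theorem semidecidable_posCert :
    Semidecidable fun P : ℕ × List (BWord ℕ) => ∃ A p, PosCert P A p := by
  refine .ex (.ex (.and ?_ (.and ?_ ?_)))
  · refine .forall_lt (by fun_prop) (.forall_lt (by fun_prop) (.forall_lt (by fun_prop) ?_))
    refine .and ?_ (.and ?_ (.and ?_ (.and ?_ ?_))) <;>
    exact semidecidable_inSpan (by fun_prop) (by fun_prop) (by fun_prop)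
  · refine .forall_lt (by fun_prop) (.or (.and (.eq (by fun_prop) (by fun_prop))
      (.forall_lt (by fun_prop) (.and ?_ ?_))) (.and (semidecidable_prime.comp (by fun_prop)) ?_))
    all_goals exact semidecidable_inSpan (by fun_prop) (by fun_prop) (by fun_prop)
  · exact .forall_lt (by fun_prop)
      (semidecidable_inSpan (by fun_prop) (by fun_prop) (by fun_prop))

/-- A certificate is an `IdealChain` for the values of the listed words, with membership expressed
by derivable equality. Its last clause places the generators of B in the span, and `eval_mem` then
places everything there. -/
theorem exists_posCert_iff {P : FiniteBracePresentation} {B : Type u} [SkewBrace B]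
    {θ : BraceHom (FreeBrace (Fin P.n)) B} (hθ : P.IsPresentation θ) :
    (∃ A p, PosCert P.code A p) ↔ SkewBrace.IsSupersoluble B := by
  have key : ∀ A p, PosCert P.code A p ↔
      IdealChain (fun j => (A.getD j empty).eval (genOf θ)) (fun j => p.getD j 0) A.length ∧
      ∀ b : B, b ∈ initSpan (fun j => (A.getD j empty).eval (genOf θ)) A.length := by
    intro A p
    simp only [PosCert, inSpan_iff hθ, eval_lamW, eval, eval_nmul]
    constructor
    · rintro ⟨h1, h2, h3⟩
      have h : IdealChain (fun j => (A.getD j empty).eval (genOf θ)) (fun j => p.getD j 0)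
          A.length := by
        -- The conjugation conditions do not involve k and are read off at k = 0, which is always
        -- below the bound.
        refine ⟨fun j hj k hk i hi => (h1 j hj k hk i hi).1,
          fun j hj k hk i hi => (h1 j hj k hk i hi).2.1, fun j hj i hi => ?_,
          fun j hj i hi => (h1 j hj 0 (by omega) i hi).2.2.2.1,
          fun j hj k hk i hi => (h1 j hj k hk i hi).2.2.2.2, fun i hi => ?_⟩
        · rw [sub_eq_add_neg]
          exact (h1 j hj 0 (by omega) i hi).2.2.1
        · simp only [sub_eq_add_neg]
          exact h2 i hi
      refine ⟨h, fun b => ?_⟩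
      obtain ⟨w, rfl⟩ := hθ.exists_eval b
      refine h.eval_mem (fun i => ?_) w
      rcases lt_or_ge i P.n with hi | hi
      · exact h3 i hi
      · rw [genOf_of_le hi]
        exact zero_mem _
    · rintro ⟨h, hB⟩
      refine ⟨fun j hj k hk i hi => ⟨h.lam_mem j hj k hk i hi, h.lam_inv_mem j hj k hk i hi, ?_,
        h.neg_conj_mem j hj i hi, h.star_mem j hj k hk i hi⟩, ?_, fun s _ => hB _⟩
      · rw [← sub_eq_add_neg]
        exact h.add_conj_mem j hj i hi
      · simp only [← sub_eq_add_neg]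
        exact h.factor
  simp only [key]
  constructor
  · rintro ⟨A, p, h, hB⟩
    exact h.isSupersoluble hB
  · intro hB
    obtain ⟨a, p, n, h, hB, h0⟩ := hB.exists_idealChain
    choose w hw using fun i => hθ.exists_eval (a i)
    refine ⟨List.ofFn fun i : Fin n => w i, List.ofFn fun i : Fin n => p i, ?_⟩
    -- The lists reproduce the sequences at every index, since past the end both sides are zero.
    have e1 : (fun j => ((List.ofFn fun i : Fin n => w i).getD j empty).eval (genOf θ)) = a := by
      ext j
      rcases lt_or_ge j n with hj | hj
      · simp [List.getD_eq_getElem?_getD, hj, hw]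
      · rw [List.getD_eq_default _ _ (by simpa using hj), (h0 j hj).1]
        rfl
    have e2 : (fun j => (List.ofFn fun i : Fin n => p i).getD j 0) = p := by
      ext j
      rcases lt_or_ge j n with hj | hj
      · simp [List.getD_eq_getElem?_getD, hj]
      · rw [List.getD_eq_default _ _ (by simpa using hj), (h0 j hj).2]
    rw [e1, e2, List.length_ofFn]
    exact ⟨h, hB⟩

end BWord

end

/-! ### Finite quotients given by operation tables -/

section

open Encodable Denumerable SkewBrace

section NoPrimeIdeal

variable {Q : Type u} [SkewBrace Q]

theorem AddSubgroup.mem_zmultiples_iff_exists_lt {G : Type*} [AddGroup G] [Finite G] {a b : G}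
    {N : ℕ} (hN : Nat.card G ≤ N) : b ∈ AddSubgroup.zmultiples a ↔ ∃ k < N, k • a = b := by
  classical
  constructor
  · intro h
    rw [mem_zmultiples_iff_mem_range_addOrderOf, Finset.mem_image] at h
    obtain ⟨k, hk, h⟩ := h
    exact ⟨k, (Finset.mem_range.1 hk).trans_le (_root_.addOrderOf_le_card.trans hN), h⟩
  · rintro ⟨k, -, rfl⟩
    exact AddSubgroup.nsmul_mem_zmultiples _ _

/-- A form of `NoPrimeIdeal` for braces with at most `N` elements, with bounded quantifiers. -/
def NoPrimeIdealBelow (Q : Type u) [SkewBrace Q] (N : ℕ) : Prop :=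
  ∀ a : Q, a = 0 ∨ (∃ k : ℕ, k • a ≠ 0 ∧ ∀ j < N, j • k • a ≠ a) ∨
    (∃ b, ∀ k < N, k • a ≠ lam b a) ∨ (∃ b, ∀ k < N, k • a ≠ b + a + -b) ∨
    ∃ b, ∃ t : ℕ, ∀ k < N, k • a ≠ -b + lam (t • a) b

/-- A nonzero element a fails to have prime order exactly when some nonzero multiple of a does not
generate a. This replaces primality by a search for a multiple. -/
theorem noPrimeIdealBelow_iff [Finite Q] {N : ℕ} (hN : Nat.card Q ≤ N) :
    NoPrimeIdealBelow Q N ↔ NoPrimeIdeal Q := by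
  have key : ∀ a b : Q, (∀ k < N, k • a ≠ b) ↔ b ∉ AddSubgroup.zmultiples a := by
    intro a b
    rw [AddSubgroup.mem_zmultiples_iff_exists_lt hN]
    push Not
    rfl
  simp only [NoPrimeIdealBelow, key, ← sub_eq_add_neg]
  constructor
  · rintro h a ha p hp hpa ⟨h1, h2, h3⟩
    rcases h a with h | ⟨k, hk, h⟩ | ⟨b, h⟩ | ⟨b, h⟩ | ⟨b, t, h⟩
    · exact ha h
    · have hpk : Nat.Coprime p k := by
        rw [hp.coprime_iff_not_dvd]
        rintro ⟨q, rfl⟩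
        exact hk (by rw [mul_nsmul, hpa, smul_zero])
      refine h (AddSubgroup.mem_zmultiples_iff.2 ⟨Nat.gcdB p k, ?_⟩)
      have hb := Nat.gcd_eq_gcd_ab p k
      rw [hpk.gcd_eq_one] at hb
      have h4 : a = ((1 : ℕ) : ℤ) • a := by simp
      conv_rhs => rw [h4, hb, add_zsmul, mul_comm, mul_zsmul, natCast_zsmul, hpa, smul_zero,
        zero_add, mul_comm, mul_zsmul, natCast_zsmul]
    · exact h (h1 b)
    · exact h (h2 b)
    · exact h (h3 _ (AddSubgroup.nsmul_mem_zmultiples _ _) b)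
  · intro h a
    by_cases ha : a = 0
    · exact Or.inl ha
    right
    have h1 : addOrderOf a ≠ 1 := fun h => ha (AddMonoid.addOrderOf_eq_one_iff.1 h)
    have h0 : 0 < addOrderOf a := addOrderOf_pos a
    by_cases hp : (addOrderOf a).Prime
    · right
      have h2 := h a ha _ hp (addOrderOf_nsmul_eq_zero a)
      by_contra! h3
      refine h2 ⟨h3.1, h3.2.1, fun t ht b => ?_⟩
      obtain ⟨k, -, rfl⟩ := (AddSubgroup.mem_zmultiples_iff_exists_lt hN).1 ht
      exact h3.2.2 b k
    · left
      have hpp := Nat.minFac_prime h1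
      set p := (addOrderOf a).minFac with hp'
      obtain ⟨q, hq⟩ : p ∣ addOrderOf a := Nat.minFac_dvd _
      -- For composite order pq, the multiple pa is nonzero and does not generate a: a = jpa would
      -- give qa = 0 with q smaller than the order.
      refine ⟨p, fun h4 => ?_, fun h4 => ?_⟩
      · have h5 := Nat.le_of_dvd hpp.pos (addOrderOf_dvd_of_nsmul_eq_zero h4)
        have h6 := Nat.minFac_le h0
        exact hp ((le_antisymm h5 h6) ▸ hpp)
      · obtain ⟨j, hj⟩ := AddSubgroup.mem_zmultiples_iff.1 h4
        have hqa : q • a = 0 := by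
          have h6 : ((q : ℤ) * (j * (p : ℤ))) • a = 0 := by
            rw [show (q : ℤ) * (j * (p : ℤ)) = j * ((p * q : ℕ) : ℤ) by push_cast; ring, mul_zsmul,
              natCast_zsmul, ← hq, addOrderOf_nsmul_eq_zero, smul_zero]
          rwa [mul_zsmul, mul_zsmul, natCast_zsmul a p, hj, natCast_zsmul] at h6
        have hq0 : 0 < q := by
          rcases Nat.eq_zero_or_pos q with h6 | h6
          · rw [h6, mul_zero] at hq
            omega
          · exact h6
        have h5 := Nat.le_of_dvd hq0 (addOrderOf_dvd_of_nsmul_eq_zero hqa)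
        have := hpp.two_le
        nlinarith

end NoPrimeIdeal

/-- Operation tables on the set of numbers `≤ D.1`, for addition, multiplication and the two
inverses, and a list of elements. -/
abbrev Table : Type := ℕ × List ℕ × List ℕ × List ℕ × List ℕ × List ℕ

namespace Table

variable (D : Table)

/-- Addition according to the table. -/
def tadd (a b : ℕ) : ℕ := D.2.1.getD (Nat.pair a b) 0 % (D.1 + 1)

/-- Multiplication according to the table. -/
def tmul (a b : ℕ) : ℕ := D.2.2.1.getD (Nat.pair a b) 0 % (D.1 + 1)

/-- Negatives according to the table. -/
def tneg (a : ℕ) : ℕ := D.2.2.2.1.getD a 0 % (D.1 + 1)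

/-- Inverses according to the table. -/
def tinv (a : ℕ) : ℕ := D.2.2.2.2.1.getD a 0 % (D.1 + 1)

/-- The first `n` listed elements, followed by zeros. -/
def tgen (n i : ℕ) : ℕ := (D.2.2.2.2.2.take n).getD i 0 % (D.1 + 1)

/-- The map `λ` according to the table. -/
def tlam (a b : ℕ) : ℕ := D.tadd (D.tneg a) (D.tmul a b)

/-- Multiples according to the table. -/
def tnsmul (k a : ℕ) : ℕ := k.rec 0 fun _ b => D.tadd b a

section

variable {α : Type*} [Primcodable α] {d : α → Table} {f g : α → ℕ}

@[fun_prop]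
theorem primrec_tadd (hd : Primrec d) (hf : Primrec f) (hg : Primrec g) :
    Primrec fun a => (d a).tadd (f a) (g a) := by
  unfold tadd
  fun_prop

@[fun_prop]
theorem primrec_tmul (hd : Primrec d) (hf : Primrec f) (hg : Primrec g) :
    Primrec fun a => (d a).tmul (f a) (g a) := by
  unfold tmul
  fun_prop

@[fun_prop]
theorem primrec_tneg (hd : Primrec d) (hf : Primrec f) :
    Primrec fun a => (d a).tneg (f a) := by
  unfold tneg
  fun_prop

@[fun_prop]
theorem primrec_tinv (hd : Primrec d) (hf : Primrec f) :
    Primrec fun a => (d a).tinv (f a) := by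
  unfold tinv
  fun_prop

@[fun_prop]
theorem primrec_tgen (hd : Primrec d) (hf : Primrec f) (hg : Primrec g) :
    Primrec fun a => (d a).tgen (f a) (g a) := by
  unfold tgen
  fun_prop

@[fun_prop]
theorem primrec_tlam (hd : Primrec d) (hf : Primrec f) (hg : Primrec g) :
    Primrec fun a => (d a).tlam (f a) (g a) := by
  unfold tlam
  fun_prop

@[fun_prop]
theorem primrec_tnsmul (hd : Primrec d) (hf : Primrec f) (hg : Primrec g) :
    Primrec fun a => (d a).tnsmul (f a) (g a) :=
  Primrec.nat_rec' (h := fun a s => (d a).tadd s.2 (g a)) hf (by fun_prop)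
    (show Primrec fun s : α × ℕ × ℕ => (d s.1).tadd s.2.2 (g s.1) by fun_prop)

end

/-- The tables define a skew brace with zero element `0`. -/
def IsBrace : Prop :=
  ∀ a < D.1 + 1, ∀ b < D.1 + 1, ∀ c < D.1 + 1,
    D.tadd (D.tadd a b) c = D.tadd a (D.tadd b c) ∧ D.tadd 0 a = a ∧ D.tadd (D.tneg a) a = 0 ∧
    D.tmul (D.tmul a b) c = D.tmul a (D.tmul b c) ∧ D.tmul 0 a = a ∧ D.tmul (D.tinv a) a = 0 ∧
    D.tmul a (D.tadd b c) = D.tadd (D.tadd (D.tmul a b) (D.tneg a)) (D.tmul a c)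

theorem semidecidable_isBrace : Semidecidable IsBrace := by
  refine .forall_lt (by fun_prop) (.forall_lt (by fun_prop) (.forall_lt (by fun_prop) ?_))
  refine .and ?_ (.and ?_ (.and ?_ (.and ?_ (.and ?_ (.and ?_ ?_)))))
  all_goals exact .eq (by fun_prop) (by fun_prop)

/-- The rules for the evaluation of `b`-words in the brace with table `s.2` and `s.1` generators. -/
def valStep (s : ℕ × Table) (t : ℕ × ℕ) (p q : BWord ℕ × ℕ) : BWord ℕ × ℕ :=
  [(.of t.2, s.2.tgen s.1 t.2), (.add p.1 q.1, s.2.tadd p.2 q.2), (.mul p.1 q.1, s.2.tmul p.2 q.2),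
    (.neg p.1, s.2.tneg p.2), (.inv p.1, s.2.tinv p.2)].getD t.1 (.empty, 0)

/-- The word `w` evaluates to `a`. -/
def Val (s : ℕ × Table) (w : BWord ℕ) (a : ℕ) : Prop :=
  Gen (fun _ => (.empty, 0)) (fun s t => valStep s (ofNat _ t)) s (w, a)

theorem semidecidable_val {α : Type*} [Primcodable α] {f : α → ℕ × Table} {g : α → BWord ℕ}
    {h : α → ℕ} (hf : Primrec f) (hg : Primrec g) (hh : Primrec h) :
    Semidecidable fun a => Val (f a) (g a) (h a) := by
  have hv : Semidecidable fun s : (ℕ × Table) × BWord ℕ × ℕ =>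
      Gen (fun _ => (.empty, 0)) (fun s t => valStep s (ofNat _ t)) s.1 s.2 := by
    refine semidecidable_gen (by fun_prop) ?_
    unfold valStep
    fun_prop
  exact hv.comp (f := fun a => (f a, g a, h a)) (by fun_prop)

/-- The tables describe a nonzero quotient, without ideals of prime order, of the brace with
code `P`, provided that they describe a skew brace. -/
def IsQuotient (P : ℕ × List (BWord ℕ)) : Prop :=
  0 < D.1 ∧ (∀ i < P.2.length, Val (P.1, D) (P.2.getD i .empty) 0) ∧
  (∀ a < D.1 + 1, ∃ w, Val (P.1, D) w a) ∧
  ∀ a < D.1 + 1, a = 0 ∨ (∃ k, D.tnsmul k a ≠ 0 ∧ ∀ j < D.1 + 1, D.tnsmul j (D.tnsmul k a) ≠ a) ∨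
    (∃ b, b < D.1 + 1 ∧ ∀ k < D.1 + 1, D.tnsmul k a ≠ D.tlam b a) ∨
    (∃ b, b < D.1 + 1 ∧ ∀ k < D.1 + 1, D.tnsmul k a ≠ D.tadd (D.tadd b a) (D.tneg b)) ∨
    ∃ b, b < D.1 + 1 ∧ ∃ t, ∀ k < D.1 + 1, D.tnsmul k a ≠
      D.tadd (D.tneg b) (D.tlam (D.tnsmul t a) b)

theorem semidecidable_isQuotient :
    Semidecidable fun P : ℕ × List (BWord ℕ) => ∃ D : Table, IsBrace D ∧ IsQuotient D P := by
  refine .ex (.and (semidecidable_isBrace.comp (by fun_prop)) (.and ?_ (.and ?_ (.and ?_ ?_))))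
  · exact .lt (by fun_prop) (by fun_prop)
  · exact .forall_lt (by fun_prop) (semidecidable_val (by fun_prop) (by fun_prop) (by fun_prop))
  · exact .forall_lt (by fun_prop)
      (.ex (semidecidable_val (by fun_prop) (by fun_prop) (by fun_prop)))
  · refine .forall_lt (by fun_prop) (.or (.eq (by fun_prop) (by fun_prop))
      (.or ?_ (.or ?_ (.or ?_ ?_))))
    · exact .ex (.and (.ne (by fun_prop) (by fun_prop))
        (.forall_lt (by fun_prop) (.ne (by fun_prop) (by fun_prop))))
    · exact .ex (.and (.lt (by fun_prop) (by fun_prop))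
        (.forall_lt (by fun_prop) (.ne (by fun_prop) (by fun_prop))))
    · exact .ex (.and (.lt (by fun_prop) (by fun_prop))
        (.forall_lt (by fun_prop) (.ne (by fun_prop) (by fun_prop))))
    · exact .ex (.and (.lt (by fun_prop) (by fun_prop)) (.ex
        (.forall_lt (by fun_prop) (.ne (by fun_prop) (by fun_prop)))))

/-- The map `e` identifies the skew brace `Q` with the tables. -/
structure Represents (Q : Type u) [SkewBrace Q] (e : Q → ℕ) : Prop where
  inj : Function.Injective e
  lt : ∀ x, e x < D.1 + 1
  surj : ∀ a < D.1 + 1, ∃ x, e x = a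
  map_zero : e 0 = 0
  map_add : ∀ x y, e (x + y) = D.tadd (e x) (e y)
  map_mul : ∀ x y, e (x * y) = D.tmul (e x) (e y)
  map_neg : ∀ x, e (-x) = D.tneg (e x)
  map_inv : ∀ x, e x⁻¹ = D.tinv (e x)

namespace Represents

variable {D} {Q : Type u} [SkewBrace Q] {e : Q → ℕ}

theorem forall_lt (h : D.Represents Q e) {p : ℕ → Prop} :
    (∀ a < D.1 + 1, p a) ↔ ∀ x, p (e x) := by
  refine ⟨fun hp x => hp _ (h.lt x), fun hp a ha => ?_⟩
  obtain ⟨x, rfl⟩ := h.surj a ha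
  exact hp x

theorem exists_lt (h : D.Represents Q e) {p : ℕ → Prop} :
    (∃ a, a < D.1 + 1 ∧ p a) ↔ ∃ x, p (e x) := by
  constructor
  · rintro ⟨a, ha, hp⟩
    obtain ⟨x, rfl⟩ := h.surj a ha
    exact ⟨x, hp⟩
  · rintro ⟨x, hx⟩
    exact ⟨_, h.lt x, hx⟩

theorem map_nsmul (h : D.Represents Q e) (k : ℕ) (x : Q) : e (k • x) = D.tnsmul k (e x) := by
  induction k with
  | zero => rw [zero_nsmul, h.map_zero]; rfl
  | succ k ih => rw [succ_nsmul, h.map_add, ih]; rfl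

theorem map_lam (h : D.Represents Q e) (x y : Q) : e (lam x y) = D.tlam (e x) (e y) := by
  rw [lam, h.map_add, h.map_neg, h.map_mul]
  rfl

theorem bijective (h : D.Represents Q e) :
    Function.Bijective fun x => (⟨e x, h.lt x⟩ : Fin (D.1 + 1)) :=
  ⟨fun _ _ hxy => h.inj (Fin.ext_iff.1 hxy), fun ⟨a, ha⟩ => by
    obtain ⟨x, rfl⟩ := h.surj a ha
    exact ⟨x, rfl⟩⟩

theorem finite (h : D.Represents Q e) : Finite Q := Finite.of_injective _ h.bijective.1

theorem card_eq (h : D.Represents Q e) : Nat.card Q = D.1 + 1 := by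
  rw [Nat.card_eq_of_bijective _ h.bijective, Nat.card_fin]

/-- `Val` is the graph of evaluation, generated by rules like derivations are. Rules out of range
return the empty word with value 0. -/
theorem val_iff (h : D.Represents Q e) {n : ℕ} {x : ℕ → Q} (hx : ∀ i, e (x i) = D.tgen n i)
    {w : BWord ℕ} {a : ℕ} : Val (n, D) w a ↔ e (w.eval x) = a := by
  constructor
  · intro hw
    suffices hs : ∀ s : BWord ℕ × ℕ,
        Gen (fun _ => (.empty, 0)) (fun s t => valStep s (ofNat _ t)) (n, D) s →
        e (s.1.eval x) = s.2 from hs _ hw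
    intro s hs
    induction hs with
    | base => exact h.map_zero
    | step t _ _ ih ih' =>
      rename_i p q _ _
      obtain ⟨r, i⟩ := ofNat (ℕ × ℕ) t
      rcases Nat.lt_or_ge r 5 with hr | hr
      · interval_cases r
        · exact hx i
        · change e (_ + _) = D.tadd _ _
          rw [h.map_add, ih, ih']
        · change e (_ * _) = D.tmul _ _
          rw [h.map_mul, ih, ih']
        · change e (-_) = D.tneg _
          rw [h.map_neg, ih]
        · change e (_⁻¹) = D.tinv _
          rw [h.map_inv, ih]
      · rw [valStep, List.getD_eq_default]
        · exact h.map_zero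
        · exact hr
  · rintro rfl
    have step : ∀ (t : ℕ × ℕ) {v w : BWord ℕ} {a b : ℕ}, Val (n, D) v a → Val (n, D) w b →
        Val (n, D) (valStep (n, D) t (v, a) (w, b)).1 (valStep (n, D) t (v, a) (w, b)).2 := by
      intro t v w a b hv hw
      have := Gen.step (encode t) hv hw
      rwa [ofNat_encode] at this
    induction w with
    | empty =>
      change Val _ _ (e 0)
      rw [h.map_zero]
      exact Gen.base
    | of i =>
      have := step (0, i) (v := .empty) (w := .empty) (a := 0) (b := 0) Gen.base Gen.base
      change Val _ _ (e (x i))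
      rw [hx]
      exact this
    | add v w hv hw =>
      change Val _ _ (e (_ + _))
      rw [h.map_add]
      exact step (1, 0) hv hw
    | mul v w hv hw =>
      change Val _ _ (e (_ * _))
      rw [h.map_mul]
      exact step (2, 0) hv hw
    | neg w hw =>
      change Val _ _ (e (-_))
      rw [h.map_neg]
      exact step (3, 0) hw hw
    | inv w hw =>
      change Val _ _ (e (_⁻¹))
      rw [h.map_inv]
      exact step (4, 0) hw hw

/-- Transport along the numbering `e`; the condition `0 < D.1` says that there are at least two
elements. -/
theorem isQuotient_iff (h : D.Represents Q e) {P : ℕ × List (BWord ℕ)} {x : ℕ → Q}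
    (hx : ∀ i, e (x i) = D.tgen P.1 i) :
    D.IsQuotient P ↔ (∃ y : Q, y ≠ 0) ∧ (∀ w ∈ P.2, w.eval x = 0) ∧
      (∀ y, ∃ w : BWord ℕ, w.eval x = y) ∧ NoPrimeIdeal Q := by
  have := h.finite
  have e0 : ∀ y, e y = 0 ↔ y = 0 := fun y => by rw [← h.map_zero, h.inj.eq_iff]
  rw [IsQuotient, ← noPrimeIdealBelow_iff (N := D.1 + 1) h.card_eq.le, NoPrimeIdealBelow]
  refine and_congr ?_ (and_congr ?_ (and_congr ?_ ?_))
  · have h1 := h.card_eq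
    constructor
    · intro h0
      have : Nontrivial Q := Finite.one_lt_card_iff_nontrivial.1 (by omega)
      exact exists_ne 0
    · rintro ⟨y, hy⟩
      have : Nontrivial Q := ⟨y, 0, hy⟩
      have := Finite.one_lt_card (α := Q)
      omega
  · simp only [h.val_iff hx, e0]
    rw [List.forall_mem_iff_getElem]
    refine forall₂_congr fun i hi => ?_
    rw [List.getD_eq_getElem _ _ hi]
  · rw [h.forall_lt]
    simp only [h.val_iff hx, h.inj.eq_iff]
  · rw [h.forall_lt]
    simp only [h.exists_lt, ← h.map_nsmul, ← h.map_lam, ← h.map_neg, ← h.map_add, ne_eq, e0,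
      h.inj.eq_iff]

end Represents

end Table

namespace Table

/-- The set of numbers on which the tables operate. -/
def Carrier (D : Table) : Type := {a : ℕ // a < D.1 + 1}

namespace Carrier

variable {D : Table}

/-- The residue of a number. -/
def ofMod (D : Table) (a : ℕ) : D.Carrier := ⟨a % (D.1 + 1), Nat.mod_lt _ (Nat.succ_pos _)⟩

instance : Add D.Carrier := ⟨fun a b => ofMod D (D.2.1.getD (Nat.pair a.1 b.1) 0)⟩
instance : Mul D.Carrier := ⟨fun a b => ofMod D (D.2.2.1.getD (Nat.pair a.1 b.1) 0)⟩
instance : Neg D.Carrier := ⟨fun a => ofMod D (D.2.2.2.1.getD a.1 0)⟩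
instance : Inv D.Carrier := ⟨fun a => ofMod D (D.2.2.2.2.1.getD a.1 0)⟩
instance : Zero D.Carrier := ⟨⟨0, Nat.succ_pos _⟩⟩
instance : One D.Carrier := ⟨⟨0, Nat.succ_pos _⟩⟩

/-- The skew brace defined by tables. -/
@[reducible]
def skewBrace (h : D.IsBrace) : SkewBrace D.Carrier where
  toAddGroup := AddGroup.ofLeftAxioms
    (fun a b c => Subtype.ext (h _ a.2 _ b.2 _ c.2).1)
    (fun a => Subtype.ext (h _ a.2 _ a.2 _ a.2).2.1)
    (fun a => Subtype.ext (h _ a.2 _ a.2 _ a.2).2.2.1)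
  toGroup := Group.ofLeftAxioms
    (fun a b c => Subtype.ext (h _ a.2 _ b.2 _ c.2).2.2.2.1)
    (fun a => Subtype.ext (h _ a.2 _ a.2 _ a.2).2.2.2.2.1)
    (fun a => Subtype.ext (h _ a.2 _ a.2 _ a.2).2.2.2.2.2.1)
  mul_add_eq a b c := Subtype.ext (h _ a.2 _ b.2 _ c.2).2.2.2.2.2.2

theorem represents (h : D.IsBrace) :
    letI := skewBrace h
    D.Represents D.Carrier Subtype.val :=
  letI := skewBrace h
  { inj := Subtype.val_injective
    lt := Subtype.property
    surj := fun a ha => ⟨⟨a, ha⟩, rfl⟩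
    map_zero := rfl
    map_add := fun _ _ => rfl
    map_mul := fun _ _ => rfl
    map_neg := fun _ => rfl
    map_inv := fun _ => rfl }

end Carrier

theorem Represents.isBrace {D : Table} {Q : Type u} [SkewBrace Q] {e : Q → ℕ}
    (h : D.Represents Q e) : D.IsBrace := by
  rw [IsBrace, h.forall_lt]
  intro x
  rw [h.forall_lt]
  intro y
  rw [h.forall_lt]
  intro z
  simp only [← h.map_zero, ← h.map_add, ← h.map_mul, ← h.map_neg, ← h.map_inv, h.inj.eq_iff]
  refine ⟨add_assoc _ _ _, zero_add _, neg_add_cancel _, mul_assoc _ _ _, ?_, ?_, ?_⟩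
  · rw [← one_eq_zero, one_mul]
  · rw [← one_eq_zero, inv_mul_cancel]
  · rw [mul_add_eq, sub_eq_add_neg]

theorem exists_list_getD (f : ℕ → ℕ) (n : ℕ) : ∃ l : List ℕ, ∀ i < n, l.getD i 0 = f i :=
  ⟨(List.range n).map f, fun i hi => by simp [List.getD_eq_getElem?_getD, hi]⟩

/-- Every finite skew brace with a finite list of elements is described by tables. -/
theorem exists_represents (Q : Type u) [SkewBrace Q] [Finite Q] (n : ℕ) (x : ℕ → Q)
    (hx : ∀ i, n ≤ i → x i = 0) :
    ∃ (D : Table) (e : Q → ℕ), D.Represents Q e ∧ ∀ i, e (x i) = D.tgen n i := by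
  obtain ⟨N, hN⟩ : ∃ N, Nat.card Q = N + 1 := Nat.exists_eq_succ_of_ne_zero Nat.card_pos.ne'
  let e₀ : Q ≃ Fin (N + 1) := Finite.equivFinOfCardEq hN
  -- The swap gives the zero element the number 0, as the tables require.
  let e₁ : Q ≃ Fin (N + 1) := e₀.trans (Equiv.swap (e₀ 0) 0)
  let e : Q → ℕ := fun y => e₁ y
  have he0 : e 0 = 0 := by simp [e, e₁]
  have hlt : ∀ y, e y < N + 1 := fun y => (e₁ y).2
  have hmod : ∀ y, e y % (N + 1) = e y := fun y => Nat.mod_eq_of_lt (hlt y)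
  have hinj : Function.Injective e := Fin.val_injective.comp e₁.injective
  let d : ℕ → Q := Function.invFun e
  have hd : ∀ y, d (e y) = y := Function.leftInverse_invFun hinj
  -- Codes of pairs of numbers at most N are below (N + 1)², the length of the binary tables.
  have hpair : ∀ y z, Nat.pair (e y) (e z) < (N + 1) ^ 2 := fun y z =>
    (Nat.pair_lt_max_add_one_sq _ _).trans_le
      (Nat.pow_le_pow_left (Nat.succ_le_of_lt (max_lt (hlt y) (hlt z))) 2)
  obtain ⟨A, hA⟩ := exists_list_getD (fun c => e (d c.unpair.1 + d c.unpair.2)) ((N + 1) ^ 2)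
  obtain ⟨M, hM⟩ := exists_list_getD (fun c => e (d c.unpair.1 * d c.unpair.2)) ((N + 1) ^ 2)
  obtain ⟨A', hA'⟩ := exists_list_getD (fun c => e (-d c)) (N + 1)
  obtain ⟨M', hM'⟩ := exists_list_getD (fun c => e (d c)⁻¹) (N + 1)
  obtain ⟨G, hG⟩ := exists_list_getD (fun i => e (x i)) n
  refine ⟨(N, A, M, A', M', G), e, ⟨hinj, hlt, fun a ha => ⟨e₁.symm ⟨a, ha⟩, by simp [e]⟩, he0,
    fun y z => ?_, fun y z => ?_, fun y => ?_, fun y => ?_⟩, fun i => ?_⟩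
  · simp only [tadd]
    rw [hA _ (hpair y z), Nat.unpair_pair, hd, hd, hmod]
  · simp only [tmul]
    rw [hM _ (hpair y z), Nat.unpair_pair, hd, hd, hmod]
  · simp only [tneg]
    rw [hA' _ (hlt y), hd, hmod]
  · simp only [tinv]
    rw [hM' _ (hlt y), hd, hmod]
  · simp only [tgen]
    rcases lt_or_ge i n with hi | hi
    · rw [List.getD_eq_getElem?_getD, List.getElem?_take_of_lt hi, ← List.getD_eq_getElem?_getD,
        hG _ hi, hmod]
    · rw [hx i hi, he0, List.getD_eq_default, Nat.zero_mod]
      exact (List.length_take_le _ _).trans hi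

variable {P : FiniteBracePresentation} {B : Type u} [SkewBrace B]
  {θ : BraceHom (FreeBrace (Fin P.n)) B}

/-- The relators hold in the table brace, so it receives a homomorphism from B, which is onto
because every table element is the value of a word. -/
theorem not_isSupersoluble_of_isQuotient (hθ : P.IsPresentation θ) {D : Table} (h : D.IsBrace)
    (hq : D.IsQuotient P.code) : ¬ IsSupersoluble B := by
  let := Carrier.skewBrace h
  have hr : D.Represents D.Carrier Subtype.val := Carrier.represents h
  have := hr.finite
  obtain ⟨h0, hrel, hsurj, hn⟩ :=
    (hr.isQuotient_iff (x := fun i => Carrier.ofMod D _) fun i => rfl).1 hq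
  obtain ⟨f, hf⟩ := hθ.exists_hom hrel (fun i hi => Subtype.ext (by
    change D.tgen P.n i = 0
    rw [tgen, List.getD_eq_default, Nat.zero_mod]
    exact (List.length_take_le _ _).trans hi))
  refine not_isSupersoluble_of_noPrimeIdeal f (fun y => ?_) h0 hn
  obtain ⟨w, hw⟩ := hsurj y
  exact ⟨_, (hf w).trans hw⟩

/-- The finite quotient of B without ideals of prime order is written out as tables, with the images
of the generators listed. -/
theorem exists_isQuotient (hθ : P.IsPresentation θ) (hB : IsAlmostPolycyclic B)
    (h : ¬ IsSupersoluble B) : ∃ D : Table, D.IsBrace ∧ D.IsQuotient P.code := by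
  obtain ⟨J, hfin, h0, hn⟩ := exists_finite_noPrimeIdeal hB h
  let x : ℕ → J.Quot := fun i => J.projHom.toFun (FiniteBracePresentation.genOf θ i)
  have heval : ∀ w : BWord ℕ,
      w.eval x = J.projHom.toFun (w.eval (FiniteBracePresentation.genOf θ)) := fun w =>
    (J.projHom.map_eval _ w).symm
  obtain ⟨D, e, hD, he⟩ := exists_represents J.Quot P.n x fun i hi => by
    change J.projHom.toFun _ = 0
    rw [FiniteBracePresentation.genOf_of_le hi, J.projHom.map_zero]
  refine ⟨D, hD.isBrace, (hD.isQuotient_iff he).2 ⟨h0, fun w hw => ?_, fun y => ?_, hn⟩⟩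
  · rw [heval, hθ.eval_relator hw, J.projHom.map_zero]
  · obtain ⟨b, rfl⟩ := J.proj_surjective y
    obtain ⟨w, rfl⟩ := hθ.exists_eval b
    exact ⟨w, heval w⟩

end Table

end

/-- Two semidecidable predicates are separated by an algorithm. -/
theorem Semidecidable.exists_partrec {α : Type*} [Primcodable α] {p q : α → Prop}
    (hp : Semidecidable p) (hq : Semidecidable q) :
    ∃ f : α →. Bool, Partrec f ∧ (∀ a b, b ∈ f a → (b = true → p a) ∧ (b = false → q a)) ∧
      ∀ a, p a ∨ q a → ∃ b, b ∈ f a := by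
  obtain ⟨r, ⟨dr, hr⟩, hr'⟩ := hp
  obtain ⟨s, ⟨ds, hs⟩, hs'⟩ := hq
  have dr' : ∀ a n, Decidable (r a n) := fun a n => dr (a, n)
  have ds' : ∀ a n, Decidable (s a n) := fun a n => ds (a, n)
  -- At stage n the n-th candidate witness of each predicate is tested. Any answer returned is
  -- backed by a witness, even if both predicates hold.
  let g : α → ℕ → Option Bool := fun a n =>
    bif decide (r a n) then some true else bif decide (s a n) then some false else none
  have hg : Primrec₂ g := by
    refine Primrec.cond (hr.of_eq fun a => ?_) (Primrec.const _)
      (Primrec.cond (hs.of_eq fun a => ?_) (Primrec.const _) (Primrec.const _))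
    all_goals congr 1
  refine ⟨fun a => Nat.rfindOpt (g a), Partrec.rfindOpt hg.to_comp, fun a b hb => ?_,
    fun a ha => ?_⟩
  · obtain ⟨n, hn⟩ := Nat.rfindOpt_spec hb
    by_cases h1 : r a n
    · have : b = true := by simpa [g, h1, eq_comm] using hn
      exact ⟨fun _ => (hr' a).2 ⟨n, h1⟩, fun h => by simp [this] at h⟩
    · by_cases h2 : s a n
      · have : b = false := by simpa [g, h1, h2, eq_comm] using hn
        exact ⟨fun h => by simp [this] at h, fun _ => (hs' a).2 ⟨n, h2⟩⟩
      · simp [g, h1, h2] at hn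
  · refine Part.dom_iff_mem.1 (Nat.rfindOpt_dom.2 ?_)
    rcases ha with ha | ha
    · obtain ⟨n, hn⟩ := (hr' a).1 ha
      exact ⟨n, true, by simp [g, hn]⟩
    · obtain ⟨n, hn⟩ := (hs' a).1 ha
      by_cases h1 : r a n
      · exact ⟨n, true, by simp [g, h1]⟩
      · exact ⟨n, false, by simp [g, h1, hn]⟩

theorem theorem3p46 :
    ∃ alg : ℕ × List (BWord ℕ) →. Bool, Partrec alg ∧
      ∀ (B : Type u) [SkewBrace B] (P : FiniteBracePresentation)
        (θ : BraceHom (FreeBrace (Fin P.n)) B), P.IsPresentation θ →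
        SkewBrace.IsAlmostPolycyclic B →
        ∃ answer : Bool, answer ∈ alg P.code ∧
          (answer = true ↔ SkewBrace.IsSupersoluble B) := by
  obtain ⟨alg, halg, hspec, hdom⟩ :=
    BWord.semidecidable_posCert.exists_partrec Table.semidecidable_isQuotient
  refine ⟨alg, halg, fun B _ P θ hθ hB => ?_⟩
  -- Being almost polycyclic guarantees that the search ends; either answer, once found, is correct
  -- for the brace presented.
  obtain ⟨b, hb⟩ := hdom P.code (by
    by_cases h : SkewBrace.IsSupersoluble B
    · exact Or.inl ((BWord.exists_posCert_iff hθ).2 h)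
    · exact Or.inr (Table.exists_isQuotient hθ hB h))
  refine ⟨b, hb, fun h => (BWord.exists_posCert_iff hθ).1 ((hspec _ _ hb).1 h), fun h => ?_⟩
  by_contra h1
  obtain ⟨D, hD, hq⟩ := (hspec _ _ hb).2 (Bool.eq_false_of_not_eq_true h1)
  exact Table.not_isSupersoluble_of_isQuotient hθ hD hq h
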